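/- **Conventions.** All products, smash products and quotients are formed in compactly generated spaces, and $[A,B]$ is the set of pointed homotopy classes of pointed maps. For a pointed space $Y$, $Y^{(k)}$ is the $k$-fold self smash product. $J(Y)$ is the James construction: the set of words in $Y\setminus\{*\}$ with concatenation as product and the quotient topology from $\bigsqcup_m Y^m$. $J_n(Y)\subseteq J(Y)$ is the set of words of length at most $n$, with the quotient topology from $Y^n$, and $E\colon Y\to J(Y)$ is the inclusion. $[A,J(Y)]$ carries the pointwise product. *Combinatorial groups.* For a finite index set $S$, let $K_S(k)$ be the group with generators $\{x_{i_1}|\cdots|x_{i_k}\}$, $i_1,\dots,i_k\in S$, and relations, where $[x,y]=x^{-1}y^{-1}xy$ and $[[a_1,\dots,a_r]=[\cdots[a_1,a_2],\cdots,a_r]$ with $r\ge1$: 1. $\{x_{i_1}|\cdots|x_{i_k}\}=1$ if two of its indices are equal; 2. $[[g_1,\dots,g_r]=1$ for generators $g_1,\dots,g_r$ whose $kr$ indices are not pairwise distinct; 3. $[[g_1^{m_1},\dots,g_r^{m_r}]=[[g_1,\dots,g_r]^{m_1\cdots m_r}$ for generators $g_i$ and $m_i\in\mathbb Z$. Take $S=\{1,\dots,n\}\times\{1,\dots,l\}$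 and write $K_{ln}(k)$ for $K_S(k)$; the pair $(s,j)$ is the $j$-th index of the $s$-th block of length $l$. For $T\subseteq S$ let $\varepsilon_T\colon K_{ln}(k)\to K_{ln}(k)$ send a generator to $1$ if it involves an index in $T$ and to itself otherwise. Let $D_s\colon K_{ln}(k)\to K_{l(n-1)}(k)$ send a generator to $1$ if it involves an index of block $s$, and otherwise move the blocks after $s$ down by one. With $B_s$ the set of indices of block $s$, put $$\mathcal H^{(l)(k)}_n=\{a\in K_{ln}(k):\ \varepsilon_{\{(s,j)\}}a=\varepsilon_{B_s}a\ \text{for all }(s,j),\quad D_sa=D_ta\ \text{for all }s,t\}.$$ *Geometric groups.* For a pointed space $X$, $\{x_{i_1}|\cdots|x_{i_k}\}\in[X^{ln},J(X^{(k)})]$ is the class of $x\mapsto E(x_{i_1}\wedge\cdots\wedge x_{i_k})$, and $K_{ln}(k)(X)$ is the subgroup generated by these classes. Let $\varepsilon_T$ on $[X^{ln},J(X^{(k)})]$ be induced by the self-map of $X^{ln}$ replacing the coordinates in $T$ by the base point, and $D_s$ by the map $X^{l(n-1)}\to X^{ln}$ inserting a block of base points in place $s$. Let $q\colon X^{ln}\to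 (X^{(l)})^n\to J_n(X^{(l)})$ be the quotient map. Then $\mathcal H^{(l)(k)}_n(X)$ is the subgroup of those $\alpha\in[J_n(X^{(l)}),J(X^{(k)})]$ for which $q^*\alpha$ lies in $K_{ln}(k)(X)$ and satisfies $\varepsilon_{\{(s,j)\}}q^*\alpha=\varepsilon_{B_s}q^*\alpha$ for all $(s,j)$ and $D_sq^*\alpha=D_tq^*\alpha$ for all $s,t$. **Proposition.** Let $X$ be a path connected, compactly generated space with non-degenerate base point (that is, $(X,*)$ is an NDR pair) and weak LS-category less than $2$ (that is, the reduced diagonal $X\to X\wedge X$ is null homotopic as a pointed map). Let $n\ge0$ and $l,k\ge1$. Then $[X^{ln},J(X^{(k)})]$ and $[J_n(X^{(l)}),J(X^{(k)})]$ are groups, and $q^*\colon[J_n(X^{(l)}),J(X^{(k)})]\to[X^{ln},J(X^{(k)})]$ is a monomorphism. There is a homomorphism $e_X\colon K_{ln}(k)\to[X^{ln},J(X^{(k)})]$ with $e_X(\{x_{i_1}|\cdots|x_{i_k}\})=\{x_{i_1}|\cdots|x_{i_k}\}$ on generators, and there is a homomorphism $$e_X\colon\mathcal H^{(l)(k)}_n\longrightarrow\mathcal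 H^{(l)(k)}_n(X)\subseteq[J_n(X^{(l)}),J(X^{(k)})]$$ such that $q^*\circ e_X\colon\mathcal H^{(l)(k)}_n\to[X^{ln},J(X^{(k)})]$ is the restriction of $e_X\colon K_{ln}(k)\to[X^{ln},J(X^{(k)})]$ to $\mathcal H^{(l)(k)}_n$. Moreover, if $a\in\mathcal H^{(l)(k)}_n$ satisfies $\varepsilon_{\{(s,j)\}}a=1$ for all $(s,j)$, then $\varepsilon_{\{(s,j)\}}q^*e_X(a)=1$ for all $(s,j)$. -/

import Mathlib

universe u

open Topology Set

noncomputable section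

namespace GeoReal

/-! ### Compactly generated spaces, powers and smash powers -/

/-- A choice of base point. -/
class BasePoint (X : Type u) where
  /-- The base point. -/
  pt : X

/-- The base point of `X`. -/
abbrev pt {X : Type u} [BasePoint X] : X := BasePoint.pt

/-- The set `Y` with the compactly generated topology attached to the topology of `Y`. -/
def KIfy (Y : Type u) : Type u := Y

instance {Y : Type u} [TopologicalSpace Y] : TopologicalSpace (KIfy Y) :=
  TopologicalSpace.compactlyGenerated.{u} Y

/-- The identity map `KIfy Y → Y`. -/
def KIfy.out {Y : Type u} (y : KIfy Y) : Y := y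

/-- The identity map `Y → KIfy Y`. -/
def KIfy.of {Y : Type u} (y : Y) : KIfy Y := y

theorem KIfy.continuous_out {Y : Type u} [TopologicalSpace Y] :
    Continuous (KIfy.out : KIfy Y → Y) :=
  continuous_from_compactlyGenerated (Y := Y) id fun _ g => g.continuous

theorem KIfy.continuous_test {Y : Type u} [TopologicalSpace Y] (S : CompHaus.{u}) (g : C(S, Y)) :
    Continuous fun s => KIfy.of (g s) := by
  have h : Continuous fun x : (Σ i : (S : CompHaus.{u}) × C(S, Y), i.fst) =>
      (KIfy.of (x.1.2 x.2) : KIfy Y) := continuous_coinduced_rng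
  exact (continuous_sigma_iff.1 h) ⟨S, g⟩

instance {Y : Type u} [TopologicalSpace Y] : CompactlyGeneratedSpace (KIfy Y) :=
  uCompactlyGeneratedSpace_of_continuous_maps fun {_} _ f hf =>
    continuous_from_compactlyGenerated (X := Y) f fun S g =>
      hf S ⟨fun s => KIfy.of (g s), KIfy.continuous_test S g⟩

/-- A continuous map from a compactly generated space to `Y` is continuous as a map to `KIfy Y`. -/
theorem KIfy.continuous_of {A Y : Type u} [TopologicalSpace A] [CompactlyGeneratedSpace A]
    [TopologicalSpace Y] {f : A → Y} (hf : Continuous f) : Continuous fun a => KIfy.of (f a) :=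
  continuous_from_uCompactlyGeneratedSpace _ fun S g =>
    KIfy.continuous_test S ⟨fun s => f (g s), hf.comp g.continuous⟩

/-- The product of a compactly generated space with a compact Hausdorff space is compactly
generated. -/
theorem cg_prod {A K : Type u} [TopologicalSpace A] [CompactlyGeneratedSpace A]
    [TopologicalSpace K] [CompactSpace K] [T2Space K] : CompactlyGeneratedSpace (A × K) := by
  refine compactlyGeneratedSpace_of_continuous_maps fun {Y} _ f hf => ?_
  have h1 : ∀ (L : Type u) [TopologicalSpace L] [CompactSpace L] [T2Space L] (g : L → A),
      Continuous g → Continuous fun p : L × K => f (g p.1, p.2) := fun L _ _ _ g hg =>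
    hf (L × K) (fun p => (g p.1, p.2)) (by fun_prop)
  have h2 : ∀ a : A, Continuous fun y : K => f (a, y) := fun a =>
    hf K (fun y => (a, y)) (by fun_prop)
  let G : A → C(K, Y) := fun a => ⟨_, h2 a⟩
  have hG : Continuous G := by
    refine continuous_from_compactlyGeneratedSpace G fun L _ _ _ g hg => ?_
    exact (ContinuousMap.curry ⟨_, h1 L g hg⟩).continuous
  exact ContinuousMap.continuous_uncurry_of_continuous ⟨G, hG⟩

/-- The product of the unit interval with a compactly generated space is compactly generated. -/
theorem cg_interval {A : Type u} [TopologicalSpace A] [CompactlyGeneratedSpace A] :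
    CompactlyGeneratedSpace (unitInterval × A) := by
  have h : CompactlyGeneratedSpace (A × ULift.{u} unitInterval) := cg_prod
  let e : A × ULift.{u} unitInterval ≃ₜ unitInterval × A :=
    ((Homeomorph.refl A).prodCongr Homeomorph.ulift).trans (Homeomorph.prodComm _ _)
  exact compactlyGeneratedSpace_of_coinduced e.continuous e.isQuotientMap.eq_coinduced

/-- The Cartesian power `X ^ ι`, formed in compactly generated spaces. -/
abbrev Power (ι : Type) (X : Type u) : Type u := KIfy (ι → X)

section Power

variable {ι κ : Type} {X : Type u}

instance [BasePoint X] : BasePoint (Power ι X) := ⟨KIfy.of fun _ => pt⟩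

variable [TopologicalSpace X]

theorem Power.continuous_apply (i : ι) : Continuous fun x : Power ι X => x.out i :=
  (_root_.continuous_apply i).comp KIfy.continuous_out

theorem Power.continuous_mk {A : Type u} [TopologicalSpace A] [CompactlyGeneratedSpace A]
    {f : A → ι → X} (hf : ∀ i, Continuous fun a => f a i) :
    Continuous fun a => (KIfy.of (f a) : Power ι X) :=
  KIfy.continuous_of (continuous_pi hf)

end Power

/-- The relation on `X ^ k` collapsing the fat wedge (the tuples with some coordinate equal to the
base point) to a point. -/
def smashSetoid (k : ℕ) (X : Type u) [BasePoint X] : Setoid (Power (Fin k) X) where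
  r x y := x = y ∨ ((∃ i, x.out i = pt) ∧ ∃ i, y.out i = pt)
  iseqv :=
    ⟨fun _ => Or.inl rfl, by rintro x y (rfl | h); exacts [Or.inl rfl, Or.inr ⟨h.2, h.1⟩], by
      rintro x y z (rfl | h) (rfl | h')
      exacts [Or.inl rfl, Or.inr h', Or.inr h, Or.inr ⟨h.1, h'.2⟩]⟩

/-- The `k`-fold self smash product `X^{(k)}` of a pointed space (for `k ≥ 1`). -/
def Smash (k : ℕ) (X : Type u) [BasePoint X] : Type u := Quotient (smashSetoid k X)

section Smash

variable {k : ℕ} {X : Type u} [TopologicalSpace X] [BasePoint X]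

instance : TopologicalSpace (Smash k X) :=
  inferInstanceAs (TopologicalSpace (Quotient (smashSetoid k X)))

instance : CompactlyGeneratedSpace (Smash k X) :=
  inferInstanceAs (CompactlyGeneratedSpace (Quotient (smashSetoid k X)))

/-- The point `x₁ ∧ ⋯ ∧ x_k`. -/
def Smash.mk (x : Power (Fin k) X) : Smash k X := Quotient.mk (smashSetoid k X) x

theorem Smash.continuous_mk : Continuous (Smash.mk : Power (Fin k) X → Smash k X) :=
  continuous_quotient_mk'

instance : BasePoint (Smash k X) := ⟨Smash.mk pt⟩

end Smash

/-! ### The James construction -/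

open Classical in
/-- The reduced word of a tuple: delete all letters equal to the base point. -/
def reduceWord {X : Type u} [BasePoint X] {n : ℕ} (x : Fin n → X) : List X :=
  (List.ofFn x).filter (fun a => a ≠ pt)

theorem pt_notMem_reduceWord {X : Type u} [BasePoint X] {n : ℕ} (x : Fin n → X) :
    pt ∉ reduceWord x := by
  simp [reduceWord]

theorem reduceWord_get {X : Type u} [BasePoint X] (L : List X) (h : pt ∉ L) :
    reduceWord L.get = L := by
  unfold reduceWord
  rw [List.ofFn_get, List.filter_eq_self]
  intro a ha
  simpa using fun e : a = pt => h (e ▸ ha)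

theorem reduceWord_append {X : Type u} [BasePoint X] {m n : ℕ} (x : Fin m → X) (y : Fin n → X) :
    reduceWord (Fin.append x y) = reduceWord x ++ reduceWord y := by
  simp [reduceWord, List.ofFn_fin_append]

/-- The James construction `J(X)`: the words `x₁ x₂ ⋯ x_n` in letters of `X`, none of them the base
point, multiplied by concatenation. -/
def James (X : Type u) [BasePoint X] : Type u := {L : List X // pt ∉ L}

/-- The stage `J_n(X)` of the James filtration: words of length at most `n`. -/
def JamesFil (n : ℕ) (X : Type u) [BasePoint X] : Type u :=
  {L : List X // pt ∉ L ∧ L.length ≤ n}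

section James

variable {X : Type u} [BasePoint X]

instance : Monoid (James X) where
  mul a b := ⟨a.1 ++ b.1, by simpa using ⟨a.2, b.2⟩⟩
  one := ⟨[], by simp⟩
  mul_assoc a b c := Subtype.ext (List.append_assoc _ _ _)
  one_mul a := Subtype.ext (List.nil_append _)
  mul_one a := Subtype.ext (List.append_nil _)

instance : BasePoint (James X) := ⟨1⟩

instance {n : ℕ} : BasePoint (JamesFil n X) := ⟨⟨[], by simp⟩⟩

/-- The projection `⨆ₙ Xⁿ → J(X)`. -/
def James.word (x : Σ n : ℕ, Power (Fin n) X) : James X :=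
  ⟨reduceWord x.2.out, pt_notMem_reduceWord _⟩

/-- The projection `q_n : Xⁿ → J_n(X)`. -/
def JamesFil.word {n : ℕ} (x : Power (Fin n) X) : JamesFil n X :=
  ⟨reduceWord x.out, pt_notMem_reduceWord _,
    (List.length_filter_le _ _).trans (by simp)⟩

variable [TopologicalSpace X]

/-- `J(X)` has the quotient topology from the disjoint union of all powers of `X`. -/
instance : TopologicalSpace (James X) := TopologicalSpace.coinduced James.word inferInstance

/-- `J_n(X)` has the quotient topology from `Xⁿ`. -/
instance {n : ℕ} : TopologicalSpace (JamesFil n X) :=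
  TopologicalSpace.coinduced JamesFil.word inferInstance

theorem James.continuous_word : Continuous (James.word (X := X)) := continuous_coinduced_rng

theorem JamesFil.continuous_word {n : ℕ} : Continuous (JamesFil.word (X := X) (n := n)) :=
  continuous_coinduced_rng

instance {n : ℕ} : CompactlyGeneratedSpace (JamesFil n X) :=
  compactlyGeneratedSpace_of_coinduced JamesFil.continuous_word rfl

theorem James.isQuotientMap_word : IsQuotientMap (James.word (X := X)) :=
  ⟨⟨rfl⟩, fun a => ⟨⟨a.1.length, KIfy.of a.1.get⟩, Subtype.ext (reduceWord_get a.1 a.2)⟩⟩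

/-- Multiplication in `J(X)` is continuous on compact Hausdorff test spaces, that is, on the product
formed in compactly generated spaces. -/
theorem James.continuous_mul_of_compact {K : Type u} [TopologicalSpace K] [CompactSpace K]
    [T2Space K] {f g : K → James X} (hf : Continuous f) (hg : Continuous g) :
    Continuous fun x => f x * g x := by
  have s1 : ∀ (L : Type u) [TopologicalSpace L] [CompactSpace L] [T2Space L] (m n : ℕ)
      (a : L → Power (Fin m) X) (b : L → Power (Fin n) X), Continuous a → Continuous b →
      Continuous fun x => James.word ⟨m, a x⟩ * James.word ⟨n, b x⟩ := by
    intro L _ _ _ m n a b ha hb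
    have e : (fun x => James.word ⟨m, a x⟩ * James.word ⟨n, b x⟩) =
        fun x => James.word ⟨m + n, KIfy.of (Fin.append (a x).out (b x).out)⟩ := by
      funext x
      exact Subtype.ext (reduceWord_append _ _).symm
    rw [e]
    refine James.continuous_word.comp (continuous_sigmaMk.comp (Power.continuous_mk fun i => ?_))
    refine Fin.addCases (fun i => ?_) (fun i => ?_) i
    · simp only [Fin.append_left]
      exact (Power.continuous_apply i).comp ha
    · simp only [Fin.append_right]
      exact (Power.continuous_apply i).comp hb
  have s2 : ∀ (L : Type u) [TopologicalSpace L] [CompactSpace L] [T2Space L] (m : ℕ)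
      (a : L → Power (Fin m) X) (b : L → James X), Continuous a → Continuous b →
      Continuous fun x => James.word ⟨m, a x⟩ * b x := by
    intro L _ _ _ m a b ha hb
    have h : Continuous fun p : James X × L => James.word ⟨m, a p.2⟩ * p.1 := by
      refine James.isQuotientMap_word.continuous_lift_prod_left ?_
      refine (Homeomorph.sigmaProdDistrib (X := fun n : ℕ => Power (Fin n) X)
        (Y := L)).symm.isQuotientMap.continuous_iff.2 (continuous_sigma fun n => ?_)
      have : CompactlyGeneratedSpace (Power (Fin n) X × L) := cg_prod
      refine continuous_from_compactlyGeneratedSpace _ fun M _ _ _ g hg => ?_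
      exact s1 M m n (fun y => a (g y).2) (fun y => (g y).1) (by fun_prop) (by fun_prop)
    exact h.comp (hb.prodMk continuous_id)
  have h : Continuous fun p : James X × K => p.1 * g p.2 := by
    refine James.isQuotientMap_word.continuous_lift_prod_left ?_
    refine (Homeomorph.sigmaProdDistrib (X := fun n : ℕ => Power (Fin n) X)
      (Y := K)).symm.isQuotientMap.continuous_iff.2 (continuous_sigma fun n => ?_)
    have : CompactlyGeneratedSpace (Power (Fin n) X × K) := cg_prod
    refine continuous_from_compactlyGeneratedSpace _ fun M _ _ _ g' hg' => ?_
    exact s2 M n (fun y => (g' y).1) (fun y => g (g' y).2) (by fun_prop) (by fun_prop)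
  exact h.comp (hf.prodMk continuous_id)

/-- The pointwise product of continuous maps from a compactly generated space to `J(X)` is
continuous. -/
theorem James.continuous_mul {A : Type u} [TopologicalSpace A] [CompactlyGeneratedSpace A]
    {f g : A → James X} (hf : Continuous f) (hg : Continuous g) :
    Continuous fun x => f x * g x :=
  continuous_from_compactlyGeneratedSpace _ fun _ _ _ _ _ hk =>
    James.continuous_mul_of_compact (hf.comp hk) (hg.comp hk)

/-- The canonical inclusion `E : X → J(X)`. -/
def James.incl (x : X) : James X := James.word ⟨1, KIfy.of fun _ => x⟩

theorem James.continuous_incl [CompactlyGeneratedSpace X] :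
    Continuous (James.incl : X → James X) :=
  James.continuous_word.comp (continuous_sigmaMk.comp (Power.continuous_mk fun _ => continuous_id))

end James

/-! ### Pointed homotopy classes -/

/-- Pointed continuous maps. -/
def PMap (A B : Type u) [TopologicalSpace A] [BasePoint A] [TopologicalSpace B] [BasePoint B] :
    Type u := {f : C(A, B) // f pt = pt}

/-- Pointed homotopy of pointed maps. -/
def pmapSetoid (A B : Type u) [TopologicalSpace A] [BasePoint A] [TopologicalSpace B]
    [BasePoint B] : Setoid (PMap A B) where
  r f g := f.1.HomotopicRel g.1 {pt}
  iseqv := ⟨fun f => .refl f.1, fun h => h.symm, fun h h' => h.trans h'⟩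

/-- The set `[A, B]` of pointed homotopy classes of pointed maps. -/
def PClass (A B : Type u) [TopologicalSpace A] [BasePoint A] [TopologicalSpace B] [BasePoint B] :
    Type u := Quotient (pmapSetoid A B)

section PClass

variable {A A' B X : Type u} [TopologicalSpace A] [BasePoint A] [TopologicalSpace A']
  [BasePoint A'] [TopologicalSpace B] [BasePoint B] [TopologicalSpace X] [BasePoint X]

/-- The class of a pointed map. -/
def PClass.mk (f : PMap A B) : PClass A B := Quotient.mk (pmapSetoid A B) f

/-- Composition of pointed maps. -/
def PMap.comp (f : PMap A' B) (φ : PMap A A') : PMap A B :=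
  ⟨f.1.comp φ.1, by rw [ContinuousMap.comp_apply, φ.2, f.2]⟩

/-- The pointwise product of pointed maps into `J(X)`. -/
def PMap.mul [CompactlyGeneratedSpace A] (f g : PMap A (James X)) : PMap A (James X) :=
  ⟨⟨fun a => f.1 a * g.1 a, James.continuous_mul f.1.continuous g.1.continuous⟩, by
    change f.1 pt * g.1 pt = pt
    rw [f.2, g.2]
    exact one_mul (1 : James X)⟩

/-- The constant map to the unit of `J(X)`. -/
def PMap.one : PMap A (James X) := ⟨ContinuousMap.const A 1, rfl⟩

/-- `[A, J(X)]` is a monoid under pointwise multiplication. -/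
instance [CompactlyGeneratedSpace A] : Monoid (PClass A (James X)) where
  mul := Quotient.map₂ PMap.mul <| by
    rintro f f' ⟨F⟩ g g' ⟨G⟩
    have : CompactlyGeneratedSpace (unitInterval × A) := cg_interval
    exact ⟨{
      toFun := fun p => F p * G p
      continuous_toFun := James.continuous_mul F.continuous G.continuous
      map_zero_left := fun a => by
        change F (0, a) * G (0, a) = f.1 a * g.1 a
        rw [F.apply_zero, G.apply_zero]
      map_one_left := fun a => by
        change F (1, a) * G (1, a) = f'.1 a * g'.1 a
        rw [F.apply_one, G.apply_one]
      prop' := fun t a ha => by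
        change F (t, a) * G (t, a) = f.1 a * g.1 a
        rw [F.eq_fst t ha, G.eq_fst t ha] }⟩
  one := PClass.mk PMap.one
  mul_assoc := by
    rintro ⟨f⟩ ⟨g⟩ ⟨h⟩
    exact congrArg PClass.mk (Subtype.ext (ContinuousMap.ext fun a => mul_assoc _ _ _))
  one_mul := by
    rintro ⟨f⟩
    exact congrArg PClass.mk (Subtype.ext (ContinuousMap.ext fun a => one_mul _))
  mul_one := by
    rintro ⟨f⟩
    exact congrArg PClass.mk (Subtype.ext (ContinuousMap.ext fun a => mul_one _))

/-- The homomorphism `φ^* : [A', J(X)] → [A, J(X)]` induced by a pointed map `φ : A → A'`. -/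
def pullback [CompactlyGeneratedSpace A] [CompactlyGeneratedSpace A'] (φ : PMap A A') :
    PClass A' (James X) →* PClass A (James X) where
  toFun := Quotient.map (fun f => f.comp φ) <| by
    rintro f g ⟨F⟩
    exact ⟨{
      toFun := fun p => F (p.1, φ.1 p.2)
      continuous_toFun := by fun_prop
      map_zero_left := fun a => F.apply_zero _
      map_one_left := fun a => F.apply_one _
      prop' := fun t a ha => F.eq_fst t (by rw [mem_singleton_iff.1 ha]; exact φ.2) }⟩
  map_one' := rfl
  map_mul' := by rintro ⟨f⟩ ⟨g⟩; rfl

/-- The group of invertible pointed homotopy classes of maps `A → J(X)`; it is the whole of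
`[A, J(X)]` as soon as every class is invertible. -/
abbrev HGroup (A X : Type u) [TopologicalSpace A] [BasePoint A] [CompactlyGeneratedSpace A]
    [TopologicalSpace X] [BasePoint X] : Type u := (PClass A (James X))ˣ

/-- The homomorphism `φ^*` on groups of homotopy classes. -/
abbrev gpullback [CompactlyGeneratedSpace A] [CompactlyGeneratedSpace A'] (φ : PMap A A') :
    HGroup A' X →* HGroup A X := Units.map (pullback φ)

end PClass

/-! ### Hypotheses on the space -/

/-- The base point is non-degenerate: `(X, pt)` is an NDR pair. -/
def NondegenerateBasePoint (X : Type u) [TopologicalSpace X] [BasePoint X] : Prop :=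
  ∃ (v : C(X, unitInterval)) (h : C(unitInterval × X, X)),
    (∀ x, v x = 0 ↔ x = pt) ∧ (∀ x, h (0, x) = x) ∧ (∀ t, h (t, pt) = pt) ∧
      ∀ x, v x < 1 → h (1, x) = pt

/-- The reduced diagonal `X → X ∧ X`. -/
def reducedDiagonal (X : Type u) [TopologicalSpace X] [CompactlyGeneratedSpace X] [BasePoint X] :
    PMap X (Smash 2 X) :=
  ⟨⟨fun x => Smash.mk (KIfy.of fun _ => x),
    Smash.continuous_mk.comp (Power.continuous_mk fun _ => continuous_id)⟩, rfl⟩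

/-- Weak Lusternik–Schnirelmann category less than 2: the reduced diagonal is null homotopic. -/
def WeakCatLtTwo (X : Type u) [TopologicalSpace X] [CompactlyGeneratedSpace X] [BasePoint X] :
    Prop :=
  (reducedDiagonal X).1.HomotopicRel (ContinuousMap.const X pt) {pt}

/-! ### The combinatorial groups -/

section Combinatorial

/-- The commutator `[x, y] = x⁻¹ y⁻¹ x y`. -/
def comm {G : Type*} [Group G] (x y : G) : G := x⁻¹ * y⁻¹ * x * y

/-- The iterated commutator `[⋯[[a, b₁], b₂], ⋯, b_m]`. -/
def iterComm {G : Type*} [Group G] (a : G) (b : List G) : G := b.foldl comm a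

variable {ι κ : Type} {k : ℕ}

/-- The defining relators of `K(k)` with indices in `ι`; the generator `{x_{i₁}|⋯|x_{i_k}}` is the
index tuple `(i₁, …, i_k)`. -/
inductive CohenRel (ι : Type) (k : ℕ) : FreeGroup (Fin k → ι) → Prop
  /-- A generator with a repeated index is trivial. -/
  | gen (I : Fin k → ι) (h : ¬ Function.Injective I) : CohenRel ι k (FreeGroup.of I)
  /-- An iterated commutator of generators in which some index occurs twice is trivial. -/
  | comm (I : Fin k → ι) (w : List (Fin k → ι)) (h : ¬ ((I :: w).flatMap List.ofFn).Nodup) :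
      CohenRel ι k (iterComm (FreeGroup.of I) (w.map FreeGroup.of))
  /-- Iterated commutators of powers of generators. -/
  | pow (I : Fin k → ι) (m : ℤ) (w : List ((Fin k → ι) × ℤ)) :
      CohenRel ι k (iterComm (FreeGroup.of I ^ m) (w.map fun p => FreeGroup.of p.1 ^ p.2) *
        (iterComm (FreeGroup.of I) (w.map fun p => FreeGroup.of p.1) ^
          (m * (w.map Prod.snd).prod))⁻¹)

/-- The combinatorial group `K_N(k)`, with the index set `{1, …, N}` replaced by any set `ι`. -/
abbrev CohenGroup (ι : Type) (k : ℕ) : Type := PresentedGroup {r | CohenRel ι k r}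

/-- The generator `{x_{i₁}|⋯|x_{i_k}}`. -/
def cgen (I : Fin k → ι) : CohenGroup ι k := PresentedGroup.of I

/-- Renaming of indices along a partially defined map `f : ι → κ`; a generator that involves an
index on which `f` is undefined goes to `1`. -/
def renameGen (f : ι → Option κ) (I : Fin k → ι) : CohenGroup κ k :=
  if h : ∀ j, (f (I j)).isSome then cgen fun j => (f (I j)).get (h j) else 1

theorem iterComm_eq_one {G : Type*} [Group G] (b : List G) (a : G) (h : a = 1 ∨ (1 : G) ∈ b) :
    iterComm a b = 1 := by
  induction b generalizing a with
  | nil => simpa [iterComm] using h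
  | cons c b ih =>
    refine ih (GeoReal.comm a c) ?_
    rcases h with rfl | h
    · left; simp [GeoReal.comm]
    · rcases List.mem_cons.1 h with rfl | h
      · left; simp [GeoReal.comm]
      · exact Or.inr h

theorem map_iterComm {G H : Type*} [Group G] [Group H] (φ : G →* H) (a : G) (b : List G) :
    φ (iterComm a b) = iterComm (φ a) (b.map φ) := by
  induction b generalizing a with
  | nil => rfl
  | cons c b ih =>
    refine (ih (GeoReal.comm a c)).trans ?_
    simp [iterComm, GeoReal.comm]

theorem cohen_one_of_rel {r : FreeGroup (Fin k → ι)} (h : CohenRel ι k r) :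
    FreeGroup.lift (cgen : (Fin k → ι) → CohenGroup ι k) r = 1 := by
  have e : FreeGroup.lift (cgen : (Fin k → ι) → CohenGroup ι k) =
      PresentedGroup.mk {r | CohenRel ι k r} := by
    ext I
    simp [cgen, PresentedGroup.of]
  rw [e]
  exact PresentedGroup.one_of_mem h

theorem rename_rel (f : ι → Option κ) {r : FreeGroup (Fin k → ι)} (h : CohenRel ι k r) :
    FreeGroup.lift (renameGen f) r = 1 := by
  classical
  have dead : ∀ I : Fin k → ι, (¬ ∀ j, (f (I j)).isSome) →
      renameGen f I = (1 : CohenGroup κ k) := fun I hI => dif_neg hI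
  have live : ∀ (I : Fin k → ι) (I' : Fin k → κ), (∀ j, f (I j) = some (I' j)) →
      renameGen f I = cgen I' := by
    intro I I' hI
    have h1 : ∀ j, (f (I j)).isSome := fun j => by rw [hI j]; rfl
    unfold renameGen
    rw [dif_pos h1]
    congr 1
    funext j
    simp [hI j]
  have choose : ∀ I : Fin k → ι, (∀ j, (f (I j)).isSome) →
      ∃ I' : Fin k → κ, ∀ j, f (I j) = some (I' j) := fun I hI =>
    ⟨fun j => (f (I j)).get (hI j), fun j => by simp⟩
  induction h with
  | gen I h =>
    rw [FreeGroup.lift_apply_of]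
    by_cases hI : ∀ j, (f (I j)).isSome
    · obtain ⟨I', hI'⟩ := choose I hI
      rw [live I I' hI', ← FreeGroup.lift_apply_of (f := (cgen : (Fin k → κ) → CohenGroup κ k))]
      refine cohen_one_of_rel (.gen I' fun hinj => h fun a b hab => hinj ?_)
      have := hI' a
      rw [hab, hI' b] at this
      exact (Option.some.inj this).symm
    · exact dead I hI
  | comm I w h =>
    by_cases hall : ∀ J ∈ I :: w, ∀ j, (f (J j)).isSome
    · have hw : ∀ v : List (Fin k → ι), (∀ J ∈ v, ∀ j, (f (J j)).isSome) →
          ∃ v' : List (Fin k → κ),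
            (v.flatMap List.ofFn).map f = (v'.flatMap List.ofFn).map some ∧
            v.map (renameGen f) = v'.map cgen := by
        intro v hv
        induction v with
        | nil => exact ⟨[], rfl, rfl⟩
        | cons J v ih =>
          obtain ⟨v', h1, h2⟩ := ih fun J' hJ' => hv J' (List.mem_cons_of_mem _ hJ')
          obtain ⟨J', hJ'⟩ := choose J (hv J List.mem_cons_self)
          refine ⟨J' :: v', ?_, ?_⟩
          · have : f ∘ J = some ∘ J' := funext hJ'
            simp [h1, this, List.map_ofFn]
          · simp [h2, live J J' hJ']
      obtain ⟨I', hI'⟩ := choose I (hall I List.mem_cons_self)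
      obtain ⟨w', h1, h2⟩ := hw w fun J hJ => hall J (List.mem_cons_of_mem _ hJ)
      have key : FreeGroup.lift (cgen : (Fin k → κ) → CohenGroup κ k)
          (iterComm (FreeGroup.of I') (w'.map FreeGroup.of)) = 1 := by
        refine cohen_one_of_rel (.comm I' w' fun hnd => h ?_)
        have e : ((I :: w).flatMap List.ofFn).map f = ((I' :: w').flatMap List.ofFn).map some := by
          have : f ∘ I = some ∘ I' := funext hI'
          simp [h1, this, List.map_ofFn]
        refine List.Nodup.of_map f ?_
        rw [e]
        exact hnd.map (Option.some_injective κ)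
      rw [map_iterComm, FreeGroup.lift_apply_of, List.map_map] at key ⊢
      have e1 : (⇑(FreeGroup.lift (renameGen (k := k) f)) ∘ FreeGroup.of) = renameGen f :=
        funext fun _ => FreeGroup.lift_apply_of
      have e2 : (⇑(FreeGroup.lift (cgen : (Fin k → κ) → CohenGroup κ k)) ∘ FreeGroup.of) = cgen :=
        funext fun _ => FreeGroup.lift_apply_of
      rw [e2] at key
      rw [e1, h2, live I I' hI', key]
    · push Not at hall
      obtain ⟨J, hJ, hJd⟩ := hall
      have hd := dead J (by push Not; exact hJd)
      rw [map_iterComm, FreeGroup.lift_apply_of]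
      refine iterComm_eq_one _ _ ?_
      rcases List.mem_cons.1 hJ with rfl | hJ
      · exact Or.inl hd
      · refine Or.inr (List.mem_map.2 ⟨FreeGroup.of J, List.mem_map.2 ⟨J, hJ, rfl⟩, ?_⟩)
        rw [FreeGroup.lift_apply_of, hd]
  | pow I m w =>
    have e1 : ∀ v : List ((Fin k → ι) × ℤ),
        (v.map fun p => FreeGroup.of p.1 ^ p.2).map (FreeGroup.lift (renameGen (k := k) f)) =
          v.map fun p => renameGen f p.1 ^ p.2 := by
      intro v; simp
    have e2 : ∀ v : List ((Fin k → ι) × ℤ),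
        (v.map fun p => FreeGroup.of p.1).map (FreeGroup.lift (renameGen (k := k) f)) =
          v.map fun p => renameGen f p.1 := by
      intro v; simp
    rw [map_mul, map_inv, map_zpow, map_iterComm, map_iterComm, map_zpow, FreeGroup.lift_apply_of,
      e1, e2]
    by_cases hall : (∀ j, (f (I j)).isSome) ∧ ∀ p ∈ w, ∀ j, (f (p.1 j)).isSome
    · have hw : ∀ v : List ((Fin k → ι) × ℤ), (∀ p ∈ v, ∀ j, (f (p.1 j)).isSome) →
          ∃ v' : List ((Fin k → κ) × ℤ), v.map Prod.snd = v'.map Prod.snd ∧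
            (v.map fun p => renameGen f p.1 ^ p.2) = (v'.map fun p => cgen p.1 ^ p.2) ∧
            (v.map fun p => renameGen f p.1) = v'.map fun p => cgen p.1 := by
        intro v hv
        induction v with
        | nil => exact ⟨[], rfl, rfl, rfl⟩
        | cons p v ih =>
          obtain ⟨v', h1, h2, h3⟩ := ih fun J' hJ' => hv J' (List.mem_cons_of_mem _ hJ')
          obtain ⟨J', hJ'⟩ := choose p.1 (hv p List.mem_cons_self)
          refine ⟨(J', p.2) :: v', ?_, ?_, ?_⟩
          · simp [h1]
          · simp [h2, live p.1 J' hJ']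
          · simp [h3, live p.1 J' hJ']
      obtain ⟨I', hI'⟩ := choose I hall.1
      obtain ⟨w', h1, h2, h3⟩ := hw w hall.2
      have key := cohen_one_of_rel (CohenRel.pow I' m w')
      rw [map_mul, map_inv, map_zpow, map_iterComm, map_iterComm, map_zpow,
        FreeGroup.lift_apply_of] at key
      simp only [List.map_map, Function.comp_def, map_zpow, FreeGroup.lift_apply_of] at key
      rw [live I I' hI', h1, h2, h3]
      exact key
    · have hd : renameGen f I = (1 : CohenGroup κ k) ∨ ∃ p ∈ w,
          renameGen f p.1 = (1 : CohenGroup κ k) := by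
        by_cases hI : ∀ j, (f (I j)).isSome
        · have : ¬ ∀ p ∈ w, ∀ j, (f (p.1 j)).isSome := fun h => hall ⟨hI, h⟩
          push Not at this
          obtain ⟨p, hp, hpd⟩ := this
          exact Or.inr ⟨p, hp, dead p.1 (by push Not; exact hpd)⟩
        · exact Or.inl (dead I hI)
      have a1 : iterComm (renameGen f I ^ m : CohenGroup κ k)
          (w.map fun p => renameGen f p.1 ^ p.2) = 1 := by
        refine iterComm_eq_one _ _ ?_
        rcases hd with h | ⟨p, hp, h⟩
        · left; rw [h, one_zpow]
        · exact Or.inr (List.mem_map.2 ⟨p, hp, by rw [h, one_zpow]⟩)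
      have a2 : iterComm (renameGen f I : CohenGroup κ k)
          (w.map fun p => renameGen f p.1) = 1 := by
        refine iterComm_eq_one _ _ ?_
        rcases hd with h | ⟨p, hp, h⟩
        · exact Or.inl h
        · exact Or.inr (List.mem_map.2 ⟨p, hp, h⟩)
      rw [a1, a2, one_zpow, inv_one, one_mul]

/-- The homomorphism of combinatorial groups renaming indices along a partial map. -/
def rename (f : ι → Option κ) : CohenGroup ι k →* CohenGroup κ k :=
  PresentedGroup.toGroup (f := renameGen f) fun _ h => rename_rel f h

open Classical in
/-- The partial identity of `ι` that is undefined on `T`. -/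
def kill (T : Set ι) (i : ι) : Option ι := if i ∈ T then none else some i

/-- The indices of the block `s`, that is, `x_{sl+1}, …, x_{sl+l}`. -/
def block {n l : ℕ} (s : Fin n) : Set (Fin n × Fin l) := {p | p.1 = s}

/-- The partial map `{1, …, n} × {1, …, l} → {1, …, n-1} × {1, …, l}` that is undefined on the block
`s` and moves the later blocks down by one. -/
def dropBlock {n l : ℕ} (s : Fin n) (p : Fin n × Fin l) : Option (Fin (n - 1) × Fin l) :=
  if h : p.1 < s then some (⟨p.1, by omega⟩, p.2)
  else if h' : p.1 = s then none
  else some (⟨p.1 - 1, by omega⟩, p.2)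

/-- The combinatorial group `H_n^{(l)(k)}`, a subgroup of `K_{ln}(k)`; the `ln` indices are written
as pairs `(s, j)` of a block `s` and a position `j` in it. It consists of the elements `a` such
that killing a single index `(s, j)` has the same effect on `a` as killing the whole block `s`, and
whose images under the projections `D_s : K_{ln}(k) → K_{l(n-1)}(k)` all agree. -/
def HComb (n l k : ℕ) : Subgroup (CohenGroup (Fin n × Fin l) k) :=
  (⨅ p : Fin n × Fin l,
      (rename (k := k) (kill {p})).eqLocus (rename (kill (block p.1)))) ⊓
    ⨅ (s : Fin n) (t : Fin n), (rename (k := k) (dropBlock s)).eqLocus (rename (dropBlock t))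

end Combinatorial

/-! ### The geometric groups -/

section Geometric

variable {ι κ : Type} (k n l : ℕ) (X : Type u) [TopologicalSpace X] [BasePoint X]

/-- The coordinate inclusion `X ^ κ → X ^ ι` of a partial map `f : ι → κ`: the coordinate `i` of the
image is the coordinate `f i`, and the base point if `f i` is undefined. -/
def insertPt (f : ι → Option κ) : PMap (Power κ X) (Power ι X) :=
  ⟨⟨fun y => KIfy.of fun i => (f i).elim pt y.out, Power.continuous_mk fun i => by
      cases f i with
      | none => exact continuous_const
      | some c => exact Power.continuous_apply c⟩, by
    refine congrArg KIfy.of (funext fun i => ?_)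
    change (f i).elim pt (fun _ => pt) = pt
    cases f i <;> rfl⟩

variable {k}

/-- The composite `E ∘ p_{i₁⋯i_k} : X ^ ι → X^{(k)} → J(X^{(k)})`,
`x ↦ x_{i₁} ∧ ⋯ ∧ x_{i_k}`. -/
def genMap (I : Fin k → ι) : PMap (Power ι X) (James (Smash k X)) :=
  ⟨⟨fun x => James.incl (Smash.mk (KIfy.of fun j => x.out (I j))),
    James.continuous_incl.comp (Smash.continuous_mk.comp
      (Power.continuous_mk fun j => Power.continuous_apply (I j)))⟩, by
    refine Subtype.ext ?_
    change reduceWord (fun _ : Fin 1 => (pt : Smash k X)) = []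
    simp [reduceWord]⟩

/-- The homotopy class `{x_{i₁}|⋯|x_{i_k}}` in `[X ^ ι, J(X^{(k)})]`. -/
def geoGen (I : Fin k → ι) : PClass (Power ι X) (James (Smash k X)) := PClass.mk (genMap X I)

variable (k) (ι)

/-- The subgroup `K(k)(X)` of `[X ^ ι, J(X^{(k)})]` generated by the classes
`{x_{i₁}|⋯|x_{i_k}}`. -/
def KGeo : Subgroup (HGroup (Power ι X) (Smash k X)) :=
  Subgroup.closure {a | ∃ I : Fin k → ι, (a : PClass _ _) = geoGen X I}

/-- The quotient map `X^{ln} → (X^{(l)})^n → J_n(X^{(l)})`. -/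
def quotMap : PMap (Power (Fin n × Fin l) X) (JamesFil n (Smash l X)) :=
  ⟨⟨fun x => JamesFil.word (KIfy.of fun s => Smash.mk (KIfy.of fun j => x.out (s, j))),
    JamesFil.continuous_word.comp (Power.continuous_mk fun s => Smash.continuous_mk.comp
      (Power.continuous_mk fun j => Power.continuous_apply (s, j)))⟩, by
    refine Subtype.ext ?_
    change reduceWord (fun _ : Fin n => (pt : Smash l X)) = []
    simp [reduceWord]⟩

/-- The group `H_n^{(l)(k)}(X)`: the subgroup of `[J_n(X^{(l)}), J(X^{(k)})]` of the classes whose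
restriction to `X^{ln}` lies in `K_{ln}(k)(X)` and satisfies the same conditions as in the
combinatorial group, the projections being induced by coordinate inclusions. -/
def HGeo : Subgroup (HGroup (JamesFil n (Smash l X)) (Smash k X)) :=
  Subgroup.comap (gpullback (quotMap n l X)) <|
    KGeo (Fin n × Fin l) k X ⊓
    (⨅ p : Fin n × Fin l, (gpullback (X := Smash k X) (insertPt X (kill {p}))).eqLocus
        (gpullback (insertPt X (kill (block p.1))))) ⊓
      ⨅ (s : Fin n) (t : Fin n), (gpullback (X := Smash k X)
        (insertPt X (dropBlock (l := l) s))).eqLocus (gpullback (insertPt X (dropBlock t)))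

end Geometric

end GeoReal
end

/-!
Moving one coordinate, the weak category hypothesis and the contraction near the base point give a
countable numerable cover of `Z = X^{(k)}` over whose pieces the inclusion into `J(Z)` is null
homotopic. Over each piece a path from `z` to `1` shows that `1` is a right inverse of `z`; these
inverses are glued along the paths, and words are then inverted letter by letter, so that `J(Z)` has
right inverses up to homotopy and `[-, J(Z)]` is group valued.

With inverses at hand, a class on a power of `X` that dies when a coordinate is killed has a
representative that is trivial wherever this coordinate is the base point. If this holds for two
coordinates, the class restricted to their diagonal factors through the reduced diagonal of `X`,
hence is trivial. This yields the relations of the combinatorial group: commutators of classes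
sharing an index, in particular, vanish.

A null homotopy of `q^* α` descends to `J_n(X^{(l)})`, by induction on `n`, once it is made constant
where a coordinate is the base point. Conversely, a map on `(X^{(l)})^n` that is trivial on the fat
wedge extends to `J(X^{(l)})` by multiplying its values over the subwords of length `n`, as in the
definition of the James–Hopf maps. By induction on `n` every class that satisfies the compatibility
conditions is therefore in the image of `q^*`.
-/

open Topology Set

namespace GeoReal

noncomputable section

/-! ### Compactly generated spaces -/

instance instCompactlyGeneratedInterval {A : Type u} [TopologicalSpace A]
    [CompactlyGeneratedSpace A] : CompactlyGeneratedSpace (unitInterval × A) := cg_interval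

theorem cg_prod_of_locallyCompact {A : Type u} {K : Type} [TopologicalSpace A]
    [CompactlyGeneratedSpace A] [TopologicalSpace K] [LocallyCompactSpace K] [T2Space K] :
    CompactlyGeneratedSpace (A × K) := by
  refine compactlyGeneratedSpace_of_continuous_maps fun {Y} _ f hf => ?_
  have comp_left : ∀ (L : Type u) [TopologicalSpace L] [CompactSpace L] [T2Space L] (g : L → A),
      Continuous g → Continuous fun p : L × K => f (g p.1, p.2) := fun L _ _ _ g hg =>
    continuous_from_compactlyGeneratedSpace _ fun M _ _ _ k hk =>
      hf M (fun y => (g (k y).1, (k y).2)) (by fun_prop)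
  have slice (a : A) : Continuous fun y : K => f (a, y) :=
    (comp_left PUnit (fun _ => a) continuous_const).comp (.prodMk_right PUnit.unit)
  let G : A → C(K, Y) := fun a => ⟨_, slice a⟩
  have hG : Continuous G := continuous_from_compactlyGeneratedSpace G fun L _ _ _ g hg =>
    (ContinuousMap.curry ⟨_, comp_left L g hg⟩).continuous
  exact ContinuousMap.continuous_uncurry_of_continuous ⟨G, hG⟩

theorem compactlyGeneratedSpace_subtype_of_isOpen {A : Type u} [TopologicalSpace A]
    [CompactlyGeneratedSpace A] {U : Set A} (hU : IsOpen U) : CompactlyGeneratedSpace U := by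
  refine compactlyGeneratedSpace_of_isOpen fun V hV => ?_
  rw [hU.isOpenEmbedding_subtypeVal.isOpen_iff_image_isOpen]
  refine CompactlyGeneratedSpace.isOpen' fun K _ _ _ g hg => ?_
  have hW : IsOpen (g ⁻¹' U) := hU.preimage hg
  have := hW.locallyCompactSpace
  let g' : g ⁻¹' U → U := fun w => ⟨g w, w.2⟩
  have hV' : IsOpen (g' ⁻¹' V) := CompactlyGeneratedSpace.isOpen' fun L _ _ _ k hk =>
    hV L (fun y => g' (k y)) ((hg.comp (continuous_subtype_val.comp hk)).subtype_mk _)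
  convert hW.isOpenEmbedding_subtypeVal.isOpenMap _ hV' using 1
  ext x
  simp [g']

/-! ### Quotient maps -/

theorem isQuotientMap_of_lift {A Y : Type u} [TopologicalSpace A] [TopologicalSpace Y] {q : A → Y}
    (hq : Continuous q) (hs : Function.Surjective q)
    (h : ∀ {Z : Type u} [TopologicalSpace Z] (f : Y → Z), Continuous (f ∘ q) → Continuous f) :
    IsQuotientMap q := by
  refine ⟨⟨le_antisymm ?_ hq.coinduced_le⟩, hs⟩
  let t : TopologicalSpace Y := TopologicalSpace.coinduced q inferInstance
  exact continuous_id_iff_le.1 (@h Y t id continuous_coinduced_rng)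

section PowerMap

variable {ι : Type} {A Y Z : Type u} [TopologicalSpace A] [CompactlyGeneratedSpace A]
  [TopologicalSpace Y] [TopologicalSpace Z] {q : A → Y}

/- The coordinates outside `S` are already lifted along `q`; each induction step lifts one more,
by the exponential law for the quotient map `q × K` with `K` compact. -/
theorem continuous_of_continuous_comp_powerMap (hq : IsQuotientMap q) {F : Power ι Y → Z}
    (hF : Continuous fun x : Power ι A => F (KIfy.of fun i => q (x.out i))) (S : Finset ι) :
    ∀ {K : Type u} [TopologicalSpace K] [CompactSpace K] [T2Space K] {y : K → ι → Y},
      (∀ i, Continuous fun k => y k i) →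
      (∀ i, i ∉ S → ∃ a : K → A, Continuous a ∧ ∀ k, y k i = q (a k)) →
      Continuous fun k => F (KIfy.of (y k)) := by
  classical
  induction S using Finset.induction_on with
  | empty =>
    intro K _ _ _ y _ h
    choose a ha hay using fun i => h i (Finset.notMem_empty i)
    exact (hF.comp (Power.continuous_mk ha)).congr fun k =>
      congrArg F (funext fun i => (hay i k).symm)
  | insert j S _ ih =>
    intro K _ _ _ y hy h
    have hg : Continuous fun p : Y × K => F (KIfy.of (Function.update (y p.2) j p.1)) := by
      refine hq.continuous_lift_prod_left ?_
      have : CompactlyGeneratedSpace (A × K) := cg_prod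
      refine continuous_from_compactlyGeneratedSpace _ fun L _ _ _ g hg =>
        ih (y := fun s => Function.update (y (g s).2) j (q (g s).1)) (fun i => ?_) fun i hi => ?_
      all_goals rcases eq_or_ne i j with rfl | hij
      · simp only [Function.update_self]
        exact hq.continuous.comp (continuous_fst.comp hg)
      · simp only [Function.update_of_ne hij]
        exact (hy i).comp (continuous_snd.comp hg)
      · exact ⟨fun s => (g s).1, continuous_fst.comp hg, fun s => Function.update_self ..⟩
      · obtain ⟨a, ha, hay⟩ := h i (by simp [hij, hi])
        exact ⟨fun s => a (g s).2, ha.comp (continuous_snd.comp hg), fun s => by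
          rw [Function.update_of_ne hij, hay]⟩
    simpa [Function.comp_def] using hg.comp ((hy j).prodMk continuous_id)

theorem isQuotientMap_powerMap [Finite ι] (hq : IsQuotientMap q) :
    IsQuotientMap (fun x : Power ι A => (KIfy.of fun i => q (x.out i) : Power ι Y)) := by
  have := Fintype.ofFinite ι
  refine isQuotientMap_of_lift
    (Power.continuous_mk fun i => hq.continuous.comp (Power.continuous_apply i)) (fun y => ?_)
    fun F hF => continuous_from_compactlyGeneratedSpace F fun K _ _ _ g hg =>
      continuous_of_continuous_comp_powerMap hq hF Finset.univ
        (fun i => (Power.continuous_apply i).comp hg) fun i hi => absurd (Finset.mem_univ i) hi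
  choose a ha using fun i => hq.surjective (y.out i)
  exact ⟨KIfy.of a, funext ha⟩

end PowerMap

section Smash

variable {k : ℕ} {X : Type u} [BasePoint X]

theorem Smash.isQuotientMap_mk [TopologicalSpace X] :
    IsQuotientMap (Smash.mk : Power (Fin k) X → Smash k X) :=
  isQuotientMap_quotient_mk'

theorem Smash.mk_eq_mk_iff {x y : Power (Fin k) X} :
    Smash.mk x = Smash.mk y ↔ x = y ∨ ((∃ i, x.out i = pt) ∧ ∃ i, y.out i = pt) :=
  ⟨fun h => Quotient.exact h, fun h => Quotient.sound h⟩

theorem Smash.mk_eq_pt {x : Power (Fin k) X} (h : ∃ i, x.out i = pt) :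
    Smash.mk x = (pt : Smash k X) :=
  Quotient.sound (Or.inr ⟨h, h.imp fun _ _ => rfl⟩)

theorem Smash.mk_eq_pt_iff (hk : 1 ≤ k) {x : Power (Fin k) X} :
    Smash.mk x = (pt : Smash k X) ↔ ∃ i, x.out i = pt := by
  refine ⟨fun h => ?_, Smash.mk_eq_pt⟩
  rcases Smash.mk_eq_mk_iff.1 h with rfl | h
  · exact ⟨⟨0, hk⟩, rfl⟩
  · exact h.1

end Smash

section ReduceWord

variable {Y : Type u} [BasePoint Y]

theorem exists_reduceWord_eq {L : List Y} (hL : pt ∉ L) {n : ℕ} (hn : L.length ≤ n) :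
    ∃ x : Fin n → Y, reduceWord x = L := by
  obtain ⟨m, rfl⟩ := Nat.exists_eq_add_of_le hn
  refine ⟨Fin.append L.get fun _ => pt, ?_⟩
  rw [reduceWord_append, reduceWord_get L hL]
  simp [reduceWord]

theorem reduceWord_succAbove {n : ℕ} (x : Fin (n + 1) → Y) (s : Fin (n + 1)) (hs : x s = pt) :
    reduceWord x = reduceWord fun t => x (s.succAbove t) := by
  classical
  unfold reduceWord
  induction n with
  | zero =>
    obtain rfl : s = 0 := Fin.fin_one_eq_zero s
    simp [hs]
  | succ n ih =>
    refine Fin.cases (fun hs => ?_) (fun s hs => ?_) s hs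
    · simp [hs]
    · rw [List.ofFn_succ (f := x), List.ofFn_succ (f := fun t => x (s.succ.succAbove t)),
        List.filter_cons, List.filter_cons, ih (fun i => x i.succ) s hs]
      simp

theorem reduceWord_eq_ofFn {n : ℕ} {x : Fin n → Y} (hx : ∀ s, x s ≠ pt) :
    reduceWord x = List.ofFn x := by
  rw [reduceWord, List.filter_eq_self]
  intro a ha
  obtain ⟨s, rfl⟩ := (List.mem_ofFn' _ _).1 ha
  simpa using hx s

theorem length_reduceWord_lt_iff {n : ℕ} {x : Fin n → Y} :
    (reduceWord x).length < n ↔ ∃ s, x s = pt := by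
  classical
  constructor
  · intro h
    by_contra! hc
    rw [reduceWord_eq_ofFn hc] at h
    simp at h
  · rintro ⟨s, hs⟩
    refine (List.length_filter_lt_length_iff_exists.2 ⟨pt, ?_, by simp⟩).trans_eq (by simp)
    exact (List.mem_ofFn' _ _).2 ⟨s, hs⟩

end ReduceWord

section James

variable {X : Type u} [BasePoint X]

theorem James.incl_val [DecidableEq X] (x : X) :
    (James.incl x).1 = if x = pt then [] else [x] := by
  change reduceWord (fun _ : Fin 1 => x) = _
  by_cases h : x = pt <;> simp [reduceWord, h]

@[simp]
theorem James.incl_pt : James.incl (pt : X) = 1 := by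
  classical
  exact Subtype.ext (by rw [James.incl_val, if_pos rfl]; rfl)

variable [TopologicalSpace X]

instance instCompactlyGeneratedJames : CompactlyGeneratedSpace (James X) :=
  compactlyGeneratedSpace_of_coinduced James.continuous_word rfl

theorem JamesFil.isQuotientMap_word {n : ℕ} :
    IsQuotientMap (JamesFil.word : Power (Fin n) X → JamesFil n X) :=
  ⟨⟨rfl⟩, fun a => (exists_reduceWord_eq a.2.1 a.2.2).imp fun _ hx => Subtype.ext hx⟩

end James

section Blocks

variable (ι : Type) (l : ℕ) (X : Type u) [BasePoint X]

/-- The map `X^{ι × l} → (X^{(l)})^ι` taking the smash product of each block. -/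
def blockMap (x : Power (ι × Fin l) X) : Power ι (Smash l X) :=
  KIfy.of fun s => Smash.mk (KIfy.of fun j => x.out (s, j))

variable [TopologicalSpace X]

theorem isQuotientMap_blockMap [Finite ι] : IsQuotientMap (blockMap ι l X) := by
  let e : Power (ι × Fin l) X ≃ₜ Power ι (Power (Fin l) X) :=
    { toFun := fun x => KIfy.of fun s => KIfy.of fun j => x.out (s, j)
      invFun := fun y => KIfy.of fun p => (y.out p.1).out p.2
      left_inv := fun x => rfl
      right_inv := fun x => rfl
      continuous_toFun := Power.continuous_mk fun s => Power.continuous_mk fun j =>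
        Power.continuous_apply (s, j)
      continuous_invFun := Power.continuous_mk fun p =>
        (Power.continuous_apply p.2).comp (Power.continuous_apply p.1) }
  exact (isQuotientMap_powerMap Smash.isQuotientMap_mk).comp e.isQuotientMap

theorem isQuotientMap_quotMap (n : ℕ) : IsQuotientMap (quotMap n l X).1 :=
  JamesFil.isQuotientMap_word.comp (isQuotientMap_blockMap (Fin n) l X)

end Blocks

/-! ### Homotopy classes -/

section Classes

variable {A A' B X : Type u} [TopologicalSpace A] [BasePoint A] [TopologicalSpace A']
  [BasePoint A'] [TopologicalSpace B] [BasePoint B] [TopologicalSpace X] [BasePoint X]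

theorem PClass.mk_eq_mk_iff {f g : PMap A B} :
    PClass.mk f = PClass.mk g ↔ f.1.HomotopicRel g.1 {pt} :=
  ⟨fun h => Quotient.exact h, fun h => Quotient.sound h⟩

theorem PClass.mk_eq_of_homotopy {f g : PMap A B} (N : unitInterval × A → B) (hN : Continuous N)
    (hzero : ∀ a, N (0, a) = f.1 a) (hone : ∀ a, N (1, a) = g.1 a) (hp : ∀ t, N (t, pt) = pt) :
    PClass.mk f = PClass.mk g :=
  PClass.mk_eq_mk_iff.2 ⟨{
    toFun := N
    continuous_toFun := hN
    map_zero_left := hzero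
    map_one_left := hone
    prop' := fun t a ha => by
      obtain rfl : a = pt := ha
      exact (hp t).trans f.2.symm }⟩

theorem PClass.exists_mk (a : PClass A B) : ∃ f, PClass.mk f = a := Quotient.exists_rep a

theorem PMap.ext {f g : PMap A B} (h : ∀ a, f.1 a = g.1 a) : f = g :=
  Subtype.ext (ContinuousMap.ext h)

variable [CompactlyGeneratedSpace A] [CompactlyGeneratedSpace A']

theorem PClass.mk_mul (f g : PMap A (James X)) :
    PClass.mk f * PClass.mk g = PClass.mk (f.mul g) := rfl

theorem PClass.one_def : (1 : PClass A (James X)) = PClass.mk PMap.one := rfl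

@[simp]
theorem pullback_mk (φ : PMap A A') (f : PMap A' (James X)) :
    pullback φ (PClass.mk f) = PClass.mk (f.comp φ) := rfl

theorem pullback_pullback {A'' : Type u} [TopologicalSpace A''] [BasePoint A'']
    [CompactlyGeneratedSpace A''] (φ : PMap A A') (ψ : PMap A' A'') (a : PClass A'' (James X)) :
    pullback φ (pullback ψ a) = pullback (ψ.comp φ) a := by
  obtain ⟨f, rfl⟩ := a.exists_mk
  rfl

theorem gpullback_gpullback {A'' : Type u} [TopologicalSpace A''] [BasePoint A'']
    [CompactlyGeneratedSpace A''] (φ : PMap A A') (ψ : PMap A' A'') (a : HGroup A'' X) :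
    gpullback φ (gpullback ψ a) = gpullback (ψ.comp φ) a :=
  Units.ext (pullback_pullback φ ψ a.1)

end Classes

/-! ### Gluing right inverses over a countable numerable cover -/

section Glue

variable {Z : Type u} [BasePoint Z]

/-- A point of `J(Z)`, thought of as a candidate right inverse, together with a Moore path, which
is meant to exhibit it as one. -/
abbrev MarkedPath (Z : Type u) [BasePoint Z] : Type u := James Z × (ℝ → James Z)

/-- The path `p.2` runs from `f * p.1` to `1` and is stationary outside `[0, ℓ]`. -/
def IsRightInverseAt (f : James Z) (ℓ : ℝ) (p : MarkedPath Z) : Prop :=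
  (∀ t ≤ 0, p.2 t = f * p.1) ∧ ∀ t ≥ ℓ, p.2 t = 1

/-- The path from `p.1` to `1` that first follows `c * p.1` backwards, then `p.2`. -/
def glueAux (d : ℝ) (c : ℝ → James Z) (p : MarkedPath Z) (x : ℝ) : James Z :=
  if x ≤ d then c (d - x) * p.1 else p.2 (x - d)

/-- The deformation from the right inverse `p` (at `θ = 0`) to `(1, c)` (for large `θ`); its first
component moves along `glueAux`. -/
def glue (d : ℝ) (c : ℝ → James Z) (p : MarkedPath Z) (θ : ℝ) : MarkedPath Z :=
  (glueAux d c p (max (θ - d) 0), fun t =>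
    if t ≤ min θ d then c t * glueAux d c p (max (θ - d) 0)
    else glueAux d c p (|θ - d| + t - min θ d))

/-- One step of the gluing: keep `p` where `2 * L ≤ S`, use `(1, c)` where `S ≤ L`, and
interpolate in between. -/
def glueStep (d S L : ℝ) (c : ℝ → James Z) (p : MarkedPath Z) : MarkedPath Z :=
  if 2 * L ≤ S then p else if S ≤ L then (1, c) else glue d c p (4 * ((2 * L - S) / L))

variable {f : James Z} {ℓ d S L : ℝ} {c : ℝ → James Z} {p : MarkedPath Z}

theorem IsRightInverseAt.mono {ℓ' : ℝ} (hp : IsRightInverseAt f ℓ p) (h : ℓ ≤ ℓ') :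
    IsRightInverseAt f ℓ' p :=
  ⟨hp.1, fun t ht => hp.2 t (h.trans ht)⟩

theorem IsRightInverseAt.path_of_nonpos (hc : IsRightInverseAt f d (1, c)) {t : ℝ} (ht : t ≤ 0) :
    c t = f :=
  (hc.1 t ht).trans (mul_one f)

theorem IsRightInverseAt.path_of_ge (hc : IsRightInverseAt f d (1, c)) {t : ℝ} (ht : d ≤ t) :
    c t = 1 :=
  hc.2 t ht

theorem IsRightInverseAt.glue (hp : IsRightInverseAt f ℓ p) (hc : IsRightInverseAt f d (1, c))
    (hd : 0 < d) (hℓ : 0 < ℓ) {θ : ℝ} (hθ : 0 ≤ θ) :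
    IsRightInverseAt f (ℓ + 2 * d) (glue d c p θ) := by
  constructor <;> intro t ht <;> simp only [GeoReal.glue]
  · rw [if_pos (ht.trans (le_min hθ hd.le)), hc.path_of_nonpos ht]
  · have hmin := min_le_right θ d
    have habs := abs_nonneg (θ - d)
    rw [if_neg (by linarith), glueAux, if_neg (by linarith), hp.2 _ (by linarith)]

theorem IsRightInverseAt.glue_zero (hp : IsRightInverseAt f ℓ p) (hc : IsRightInverseAt f d (1, c))
    (hd : 0 < d) : GeoReal.glue d c p 0 = p := by
  have hmax : max (0 - d) 0 = 0 := max_eq_right (by linarith)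
  have haux : glueAux d c p 0 = p.1 := by
    rw [glueAux, if_pos hd.le, sub_zero, hc.path_of_ge le_rfl, one_mul]
  refine Prod.ext ?_ (funext fun t => ?_) <;> simp only [GeoReal.glue, hmax, haux]
  rw [min_eq_left hd.le, zero_sub, abs_neg, abs_of_pos hd, sub_zero]
  split_ifs with ht
  · rw [hp.1 t ht, hc.path_of_nonpos ht]
  · rw [glueAux, if_neg (by linarith), add_sub_cancel_left]

theorem IsRightInverseAt.glue_of_le (hp : IsRightInverseAt f ℓ p)
    (hc : IsRightInverseAt f d (1, c)) (hd : 0 < d) (hℓ : 0 < ℓ) {θ : ℝ} (hθ : ℓ + 2 * d ≤ θ) :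
    GeoReal.glue d c p θ = (1, c) := by
  have hmax : max (θ - d) 0 = θ - d := max_eq_left (by linarith)
  have haux : glueAux d c p (θ - d) = 1 := by
    rw [glueAux, if_neg (by linarith), hp.2 _ (by linarith)]
  refine Prod.ext ?_ (funext fun t => ?_) <;> simp only [GeoReal.glue, hmax, haux]
  rw [min_eq_right (show d ≤ θ by linarith), abs_of_pos (show 0 < θ - d by linarith)]
  split_ifs with ht
  · rw [mul_one]
  · rw [glueAux, if_neg (by linarith), hp.2 _ (by linarith), hc.path_of_ge (by linarith)]

theorem IsRightInverseAt.glueStep (hSL : 0 < S + L) (hp : 0 < S → IsRightInverseAt f ℓ p)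
    (hc : 0 < L → IsRightInverseAt f d (1, c)) (hd : 0 < d) (hℓ : 0 < ℓ) :
    IsRightInverseAt f (ℓ + 2 * d) (glueStep d S L c p) := by
  unfold GeoReal.glueStep
  split_ifs with hlow hhigh
  · exact (hp (by linarith)).mono (by linarith)
  · exact (hc (by linarith)).mono (by linarith)
  · exact (hp (by linarith)).glue (hc (by linarith)) hd hℓ
      (mul_nonneg (by norm_num) (div_nonneg (by linarith) (by linarith)))

theorem IsRightInverseAt.glueStep_eq_glue (hp : IsRightInverseAt f ℓ p)
    (hc : IsRightInverseAt f d (1, c)) (hd : 0 < d) (hℓ : 0 < ℓ) (hL : 0 < L)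
    (hb : ℓ + 2 * d ≤ 4) :
    GeoReal.glueStep d S L c p =
      GeoReal.glue d c p (4 * max 0 (min 1 ((2 * L - S) / L))) := by
  unfold GeoReal.glueStep
  split_ifs with hlow hhigh
  · rw [max_eq_left, mul_zero, hp.glue_zero hc hd]
    exact (min_le_right _ _).trans (div_nonpos_of_nonpos_of_nonneg (by linarith) hL.le)
  · have hge : 1 ≤ (2 * L - S) / L := by rw [le_div_iff₀ hL]; linarith
    rw [min_eq_left hge, max_eq_right zero_le_one, hp.glue_of_le hc hd hℓ (by linarith)]
  · have hle : (2 * L - S) / L ≤ 1 := by rw [div_le_one hL]; linarith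
    rw [min_eq_right hle, max_eq_right (div_nonneg (by linarith) hL.le)]

end Glue

section ContinuousFamily

variable {A Z : Type u} [TopologicalSpace A] [BasePoint Z] [TopologicalSpace Z]

/-- Continuity on `U` of a family of points with paths; the paths are continuous jointly with the
parameter. -/
def ContinuousFamilyOn (s : A → MarkedPath Z) (U : Set A) : Prop :=
  ContinuousOn (fun a => (s a).1) U ∧ ContinuousOn (fun q : A × ℝ => (s q.1).2 q.2) (U ×ˢ univ)

variable {s s' : A → MarkedPath Z} {U V : Set A}

theorem ContinuousFamilyOn.mono (h : ContinuousFamilyOn s V) (hUV : U ⊆ V) :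
    ContinuousFamilyOn s U :=
  ⟨h.1.mono hUV, h.2.mono (prod_mono hUV subset_rfl)⟩

theorem ContinuousFamilyOn.congr (h : ContinuousFamilyOn s U) (hs : EqOn s' s U) :
    ContinuousFamilyOn s' U :=
  ⟨h.1.congr fun a ha => by rw [hs ha], h.2.congr fun q hq => by rw [hs hq.1]⟩

theorem ContinuousFamilyOn.iUnion {ι : Type*} {U : ι → Set A} (hU : ∀ i, IsOpen (U i))
    (h : ∀ i, ContinuousFamilyOn s (U i)) : ContinuousFamilyOn s (⋃ i, U i) := by
  refine ⟨.iUnion_of_isOpen (fun i => (h i).1) hU, ?_⟩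
  rw [iUnion_prod_const]
  exact .iUnion_of_isOpen (fun i => (h i).2) fun i => (hU i).prod isOpen_univ

theorem ContinuousFamilyOn.union (hU : IsOpen U) (hV : IsOpen V) (h : ContinuousFamilyOn s U)
    (h' : ContinuousFamilyOn s V) : ContinuousFamilyOn s (U ∪ V) := by
  rw [union_eq_iUnion]
  exact .iUnion (Bool.forall_bool.2 ⟨hV, hU⟩) (Bool.forall_bool.2 ⟨h', h⟩)

theorem continuousFamilyOn_iff : ContinuousFamilyOn s U ↔
    (Continuous fun a : U => (s a).1) ∧ Continuous fun q : U × ℝ => (s q.1).2 q.2 := by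
  refine and_congr continuousOn_iff_continuous_domRestrict ⟨fun h => ?_, fun h => ?_⟩
  · exact h.comp_continuous (f := fun q : U × ℝ => (q.1.1, q.2)) (by fun_prop)
      fun q => ⟨q.1.2, mem_univ _⟩
  · exact continuousOn_iff_continuous_domRestrict.2 <| h.comp <|
      ((continuous_fst.comp continuous_subtype_val).subtype_mk fun q => q.2.1).prodMk
        (continuous_snd.comp continuous_subtype_val)

variable [CompactlyGeneratedSpace A] {f : A → James Z} {c : A → ℝ → James Z} {ℓ d : ℝ}

theorem ContinuousFamilyOn.glue (hU : IsOpen U) (hs : ContinuousFamilyOn s U)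
    (hc : ContinuousFamilyOn (fun a => (1, c a)) U) {θ : A → ℝ} (hθ : ContinuousOn θ U)
    (hsv : ∀ a ∈ U, IsRightInverseAt (f a) ℓ (s a))
    (hcv : ∀ a ∈ U, IsRightInverseAt (f a) d (1, c a)) (hd : 0 < d) (hθ0 : ∀ a ∈ U, 0 ≤ θ a) :
    ContinuousFamilyOn (fun a => glue d (c a) (s a) (θ a)) U := by
  have := compactlyGeneratedSpace_subtype_of_isOpen hU
  have : CompactlyGeneratedSpace (U × ℝ) := cg_prod_of_locallyCompact
  rw [continuousFamilyOn_iff] at hs hc ⊢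
  have hθ' : Continuous fun a : U => θ a := continuousOn_iff_continuous_domRestrict.1 hθ
  have hθ₁ : Continuous fun q : U × ℝ => θ q.1 := hθ'.comp continuous_fst
  have hc' : Continuous fun q : U × ℝ => c q.1 q.2 := hc.2
  have haux : Continuous fun q : U × ℝ => glueAux d (c q.1) (s q.1) q.2 := by
    refine Continuous.if_le (James.continuous_mul
      (hc'.comp (continuous_fst.prodMk (continuous_const.sub continuous_snd)))
      (hs.1.comp continuous_fst))
      (hs.2.comp (continuous_fst.prodMk (continuous_snd.sub continuous_const)))
      continuous_snd continuous_const fun q hq => ?_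
    rw [hq, sub_self, (hsv q.1 q.1.2).1 0 le_rfl, (hcv q.1 q.1.2).path_of_nonpos le_rfl]
  have hfst : Continuous fun a : U => glueAux d (c a) (s a) (max (θ a - d) 0) :=
    haux.comp (continuous_id.prodMk ((hθ'.sub continuous_const).max continuous_const))
  refine ⟨hfst, Continuous.if_le (James.continuous_mul hc' (hfst.comp continuous_fst))
    (haux.comp (continuous_fst.prodMk (((hθ₁.sub continuous_const).abs.add continuous_snd).sub
      (hθ₁.min continuous_const)))) continuous_snd (hθ₁.min continuous_const) fun q hq => ?_⟩
  have hθq := hθ0 q.1 q.1.2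
  have hcd : c q.1 d = 1 := (hcv q.1 q.1.2).path_of_ge le_rfl
  rw [hq, add_sub_cancel_right]
  rcases le_total (θ q.1) d with h | h
  · rw [min_eq_left h, max_eq_right (by linarith), abs_of_nonpos (by linarith), glueAux,
      if_pos hd.le, glueAux, if_pos (by linarith), sub_zero, hcd, one_mul, neg_sub, sub_sub_cancel]
  · rw [min_eq_right h, max_eq_left (by linarith), abs_of_nonneg (by linarith), hcd, one_mul]

theorem ContinuousFamilyOn.glueStep {S L : A → ℝ} (hS : Continuous S) (hL : Continuous L)
    (hS0 : ∀ a, 0 ≤ S a) (hL0 : ∀ a, 0 ≤ L a) (hs : ContinuousFamilyOn s {a | 0 < S a})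
    (hc : ContinuousFamilyOn (fun a => (1, c a)) {a | 0 < L a})
    (hsv : ∀ a, 0 < S a → IsRightInverseAt (f a) ℓ (s a))
    (hcv : ∀ a, 0 < L a → IsRightInverseAt (f a) d (1, c a))
    (hd : 0 < d) (hℓ : 0 < ℓ) (hb : ℓ + 2 * d ≤ 4) :
    ContinuousFamilyOn (fun a => glueStep d (S a) (L a) (c a) (s a)) {a | 0 < S a + L a} := by
  have hU₁ : IsOpen {a | 2 * L a < S a} := isOpen_lt (by fun_prop) hS
  have hU₂ : IsOpen {a | S a < L a} := isOpen_lt hS hL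
  have hU₃ : IsOpen ({a | 0 < S a} ∩ {a | 0 < L a}) :=
    (isOpen_lt continuous_const hS).inter (isOpen_lt continuous_const hL)
  have keep : ContinuousFamilyOn (fun a => GeoReal.glueStep d (S a) (L a) (c a) (s a))
      {a | 2 * L a < S a} :=
    (hs.mono fun a (ha : 2 * L a < S a) => show 0 < S a by linarith [hL0 a]).congr
      fun a (ha : 2 * L a < S a) => if_pos ha.le
  have replace : ContinuousFamilyOn (fun a => GeoReal.glueStep d (S a) (L a) (c a) (s a))
      {a | S a < L a} :=
    (hc.mono fun a (ha : S a < L a) => (hS0 a).trans_lt ha).congr fun a (ha : S a < L a) =>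
      (if_neg (by linarith [hS0 a])).trans (if_pos ha.le)
  have interpolate : ContinuousFamilyOn (fun a => GeoReal.glueStep d (S a) (L a) (c a) (s a))
      ({a | 0 < S a} ∩ {a | 0 < L a}) := by
    refine ((hs.mono inter_subset_left).glue
      (θ := fun a => 4 * max 0 (min 1 ((2 * L a - S a) / L a))) hU₃ (hc.mono inter_subset_right)
      ?_ (fun a ha => hsv a ha.1) (fun a ha => hcv a ha.2) hd
      fun a _ => mul_nonneg (by norm_num) (le_max_left _ _)).congr
      fun a ha => (hsv a ha.1).glueStep_eq_glue (hcv a ha.2) hd hℓ ha.2 hb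
    have : ContinuousOn (fun a => (2 * L a - S a) / L a) ({a | 0 < S a} ∩ {a | 0 < L a}) :=
      ContinuousOn.div (by fun_prop) (by fun_prop) fun a ha => ne_of_gt ha.2
    fun_prop
  refine ((keep.union hU₁ hU₂ replace).union (hU₁.union hU₂) hU₃ interpolate).mono
    fun a (ha : 0 < S a + L a) => ?_
  rcases (hS0 a).eq_or_lt with h | h
  · exact .inl (.inr (show S a < L a by linarith))
  rcases (hL0 a).eq_or_lt with h' | h'
  · exact .inl (.inl (show 2 * L a < S a by linarith))
  · exact .inr ⟨h, h'⟩

end ContinuousFamily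

/-- A countable family of null homotopies of `f` to `b`, the `i`-th one defined where the weight
`weight i` is positive, such that every point of `S` has a positive weight. The values of the paths
are junk where their weight vanishes. -/
structure NullCover {A B : Type u} [TopologicalSpace A] [TopologicalSpace B] (f : A → B) (b : B)
    (S : Set A) where
  weight : ℕ → C(A, unitInterval)
  path : ℕ → A → unitInterval → B
  continuousOn_path (i : ℕ) :
    ContinuousOn (fun q : A × unitInterval => path i q.1 q.2) ({a | 0 < weight i a} ×ˢ univ)
  path_zero {i : ℕ} {a : A} : 0 < weight i a → path i a 0 = f a
  path_one {i : ℕ} {a : A} : 0 < weight i a → path i a 1 = b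
  exists_pos {a : A} : a ∈ S → ∃ i, 0 < weight i a

/-- A right inverse of `f` up to a homotopy, both trivial on `T`. -/
structure RightInverse {A Z : Type u} [TopologicalSpace A] [BasePoint Z] [TopologicalSpace Z]
    (f : A → James Z) (T : Set A) where
  inv : C(A, James Z)
  homotopy : C(unitInterval × A, James Z)
  homotopy_zero (a : A) : homotopy (0, a) = f a * inv a
  homotopy_one (a : A) : homotopy (1, a) = 1
  inv_eq_one {a : A} : a ∈ T → inv a = 1
  homotopy_eq_one {a : A} : a ∈ T → ∀ t, homotopy (t, a) = 1

namespace NullCover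

variable {A Z : Type u} [TopologicalSpace A] [BasePoint Z] [TopologicalSpace Z] {f : A → James Z}
  (N : NullCover f 1 univ)

/-- The weights, scaled so as to be summable. -/
def scaledWeight (i : ℕ) (a : A) : ℝ := (1 / 2) ^ i * N.weight i a

/-- The `i`-th null homotopy, as a family of Moore paths of length `2⁻ⁱ`. -/
def scaledPath (i : ℕ) (a : A) (t : ℝ) : James Z :=
  N.path i a (projIcc 0 1 zero_le_one (2 ^ i * t))

/-- The sum of the first `j + 1` scaled weights. -/
def partialSum (j : ℕ) (a : A) : ℝ := ∑ i ∈ Finset.range (j + 1), N.scaledWeight i a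

/-- The right inverse of `f` glued from the first `j + 1` null homotopies. -/
def glueSeq : ℕ → A → MarkedPath Z
  | 0 => fun a => (1, N.scaledPath 0 a)
  | j + 1 => fun a => glueStep ((1 / 2) ^ (j + 1)) (N.partialSum j a) (N.scaledWeight (j + 1) a)
      (N.scaledPath (j + 1) a) (glueSeq j a)

theorem continuous_scaledWeight (i : ℕ) : Continuous (N.scaledWeight i) := by
  unfold scaledWeight
  fun_prop

theorem scaledWeight_nonneg (i : ℕ) (a : A) : 0 ≤ N.scaledWeight i a :=
  mul_nonneg (by positivity) (N.weight i a).2.1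

theorem scaledWeight_le (i : ℕ) (a : A) : N.scaledWeight i a ≤ (1 / 2) ^ i :=
  mul_le_of_le_one_right (by positivity) (N.weight i a).2.2

theorem scaledWeight_pos_iff {i : ℕ} {a : A} : 0 < N.scaledWeight i a ↔ 0 < N.weight i a :=
  mul_pos_iff_of_pos_left (by positivity)

theorem continuous_partialSum (j : ℕ) : Continuous (N.partialSum j) :=
  continuous_finsetSum _ fun i _ => N.continuous_scaledWeight i

theorem partialSum_nonneg (j : ℕ) (a : A) : 0 ≤ N.partialSum j a :=
  Finset.sum_nonneg fun i _ => N.scaledWeight_nonneg i a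

theorem partialSum_succ (j : ℕ) (a : A) :
    N.partialSum (j + 1) a = N.partialSum j a + N.scaledWeight (j + 1) a :=
  Finset.sum_range_succ _ _

theorem partialSum_mono (a : A) : Monotone fun j => N.partialSum j a :=
  monotone_nat_of_le_succ fun j => by
    rw [partialSum_succ]
    exact le_add_of_nonneg_right (N.scaledWeight_nonneg _ a)

theorem continuousFamilyOn_scaledPath (i : ℕ) :
    ContinuousFamilyOn (fun a => (1, N.scaledPath i a)) {a | 0 < N.scaledWeight i a} :=
  ⟨continuousOn_const, (N.continuousOn_path i).comp
    (f := fun q : A × ℝ => (q.1, projIcc (0 : ℝ) 1 zero_le_one (2 ^ i * q.2)))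
    (continuous_fst.prodMk (continuous_projIcc.comp (by fun_prop))).continuousOn
    fun _ hq => ⟨N.scaledWeight_pos_iff.1 hq.1, mem_univ _⟩⟩

theorem isRightInverseAt_scaledPath {i : ℕ} {a : A} (h : 0 < N.scaledWeight i a) :
    IsRightInverseAt (f a) ((1 / 2) ^ i) (1, N.scaledPath i a) := by
  rw [scaledWeight_pos_iff] at h
  refine ⟨fun t ht => ?_, fun t ht => ?_⟩
  · have hle : 2 ^ i * t ≤ 0 := mul_nonpos_of_nonneg_of_nonpos (by positivity) ht
    exact (congrArg _ (projIcc_of_le_left _ hle)).trans ((N.path_zero h).trans (mul_one _).symm)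
  · refine (congrArg _ (projIcc_of_right_le _ ?_)).trans (N.path_one h)
    calc (1 : ℝ) = 2 ^ i * (1 / 2) ^ i := by rw [← mul_pow]; norm_num
      _ ≤ 2 ^ i * t := by gcongr

theorem isRightInverseAt_glueSeq {j : ℕ} {a : A} (h : 0 < N.partialSum j a) :
    IsRightInverseAt (f a) (4 - 2 * (1 / 2) ^ j) (N.glueSeq j a) := by
  induction j with
  | zero =>
    rw [partialSum, zero_add, Finset.sum_range_one] at h
    exact (N.isRightInverseAt_scaledPath h).mono (by norm_num)
  | succ j ih =>
    rw [partialSum_succ] at h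
    have hj : ((1 : ℝ) / 2) ^ j ≤ 1 := pow_le_one₀ (by norm_num) (by norm_num)
    refine (IsRightInverseAt.glueStep h ih N.isRightInverseAt_scaledPath (by positivity)
      (by linarith)).mono (le_of_eq ?_)
    rw [pow_succ]; ring

theorem glueSeq_eq_of_le {j k : ℕ} (hjk : j ≤ k) {a : A} (ha : (1 / 2) ^ j < N.partialSum j a) :
    N.glueSeq k a = N.glueSeq j a := by
  induction k, hjk using Nat.le_induction with
  | base => rfl
  | succ k hjk ih =>
    refine (if_pos ?_).trans ih
    calc 2 * N.scaledWeight (k + 1) a ≤ 2 * (1 / 2) ^ (k + 1) := by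
          gcongr; exact N.scaledWeight_le _ a
      _ = (1 / 2) ^ k := by rw [pow_succ]; ring
      _ ≤ (1 / 2) ^ j := pow_le_pow_of_le_one (by norm_num) (by norm_num) hjk
      _ ≤ N.partialSum k a := ha.le.trans (N.partialSum_mono a hjk)

theorem exists_pow_lt_partialSum (a : A) : ∃ j, (1 / 2) ^ j < N.partialSum j a := by
  obtain ⟨i, hi⟩ := N.exists_pos (mem_univ a)
  rw [← scaledWeight_pos_iff] at hi
  obtain ⟨m, hm⟩ := exists_pow_lt_of_lt_one hi (show (1 / 2 : ℝ) < 1 by norm_num)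
  refine ⟨max i m, ?_⟩
  calc ((1 : ℝ) / 2) ^ max i m ≤ (1 / 2) ^ m :=
        pow_le_pow_of_le_one (by norm_num) (by norm_num) (le_max_right _ _)
    _ < N.scaledWeight i a := hm
    _ ≤ N.partialSum (max i m) a :=
        Finset.single_le_sum (f := fun i => N.scaledWeight i a)
          (fun i _ => N.scaledWeight_nonneg i a)
          (Finset.mem_range.2 (Nat.lt_succ_of_le (le_max_left _ _)))

theorem glueSeq_eq_scaledPath_zero {a : A} (ha : ∀ i, N.weight (i + 1) a = 0) (j : ℕ) :
    N.glueSeq j a = (1, N.scaledPath 0 a) := by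
  induction j with
  | zero => rfl
  | succ j ih =>
    refine (if_pos ?_).trans ih
    rw [scaledWeight, ha j, Icc.coe_zero, mul_zero, mul_zero]
    exact N.partialSum_nonneg j a

variable [CompactlyGeneratedSpace A]

theorem continuousFamilyOn_glueSeq (j : ℕ) :
    ContinuousFamilyOn (N.glueSeq j) {a | 0 < N.partialSum j a} := by
  induction j with
  | zero =>
    simp only [partialSum, zero_add, Finset.sum_range_one]
    exact N.continuousFamilyOn_scaledPath 0
  | succ j ih =>
    have hj : ((1 : ℝ) / 2) ^ j ≤ 1 := pow_le_one₀ (by norm_num) (by norm_num)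
    have hj0 : (0 : ℝ) < (1 / 2) ^ j := by positivity
    simp only [partialSum_succ]
    refine ContinuousFamilyOn.glueStep (N.continuous_partialSum j) (N.continuous_scaledWeight _)
      (N.partialSum_nonneg j) (N.scaledWeight_nonneg _) ih (N.continuousFamilyOn_scaledPath _)
      (fun a => N.isRightInverseAt_glueSeq) (fun a => N.isRightInverseAt_scaledPath)
      (by positivity) (by linarith) ?_
    rw [pow_succ]; linarith

theorem exists_continuousFamilyOn_univ : ∃ s : A → MarkedPath Z, ContinuousFamilyOn s univ ∧
    (∀ a, IsRightInverseAt (f a) 4 (s a)) ∧ ∀ a, ∃ j, s a = N.glueSeq j a := by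
  choose J hJ using N.exists_pow_lt_partialSum
  have stable (j : ℕ) : EqOn (fun a => N.glueSeq (J a) a) (N.glueSeq j)
      {a | (1 / 2) ^ j < N.partialSum j a} := fun a ha => by
    beta_reduce
    rw [← N.glueSeq_eq_of_le (le_max_left _ j) (hJ a), N.glueSeq_eq_of_le (le_max_right _ j) ha]
  have pos (j : ℕ) : (0 : ℝ) < (1 / 2) ^ j := by positivity
  have cover : ⋃ j, {a | (1 / 2) ^ j < N.partialSum j a} = univ :=
    eq_univ_of_forall fun a => mem_iUnion.2 ⟨J a, hJ a⟩
  refine ⟨fun a => N.glueSeq (J a) a, ?_, fun a => ?_, fun a => ⟨J a, rfl⟩⟩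
  · rw [← cover]
    exact .iUnion (fun j => isOpen_lt continuous_const (N.continuous_partialSum j)) fun j =>
      ((N.continuousFamilyOn_glueSeq j).mono fun a ha => (pos j).trans ha).congr
        (stable j)
  · exact (N.isRightInverseAt_glueSeq ((pos _).trans (hJ a))).mono (by linarith [pos (J a)])

theorem nonempty_rightInverse {T : Set A} (hT : ∀ a ∈ T, ∀ i, N.weight (i + 1) a = 0)
    (hT₀ : ∀ a ∈ T, ∀ t, N.path 0 a t = 1) : Nonempty (RightInverse f T) := by
  obtain ⟨s, hs, hsf, hsj⟩ := N.exists_continuousFamilyOn_univ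
  have s_eq {a : A} (ha : a ∈ T) : s a = (1, fun _ => 1) := by
    obtain ⟨j, hj⟩ := hsj a
    rw [hj, N.glueSeq_eq_scaledPath_zero (hT a ha)]
    exact Prod.ext rfl (funext fun t => hT₀ a ha _)
  rw [ContinuousFamilyOn, univ_prod_univ, continuousOn_univ, continuousOn_univ] at hs
  exact ⟨{
    inv := ⟨fun a => (s a).1, hs.1⟩
    homotopy := ⟨fun q => (s q.2).2 (4 * q.1),
      hs.2.comp (f := fun q : unitInterval × A => (q.2, 4 * (q.1 : ℝ))) (by fun_prop)⟩
    homotopy_zero := fun a => (hsf a).1 _ (by simp)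
    homotopy_one := fun a => (hsf a).2 _ (by simp)
    inv_eq_one := fun ha => congrArg Prod.fst (s_eq ha)
    homotopy_eq_one := fun ha t => congrArg (fun p => p.2 (4 * (t : ℝ))) (s_eq ha) }⟩

end NullCover

/-! ### Neighbourhood deformation retracts -/

section Lift

variable {k : ℕ} {X : Type u} {Y : Type*} [BasePoint X]

/-- The map on the smash power induced by a map that is constant on the fat wedge. -/
def Smash.lift (g : Power (Fin k) X → Y) (y₀ : Y) (hg : ∀ x, (∃ i, x.out i = pt) → g x = y₀) :
    Smash k X → Y :=
  Quotient.lift g fun x y h => by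
    rcases h with rfl | h
    · rfl
    · rw [hg x h.1, hg y h.2]

theorem Smash.continuous_lift [TopologicalSpace X] [TopologicalSpace Y] {g : Power (Fin k) X → Y}
    {y₀ : Y} {hg : ∀ x, (∃ i, x.out i = pt) → g x = y₀} (h : Continuous g) :
    Continuous (Smash.lift g y₀ hg) :=
  Smash.isQuotientMap_mk.continuous_iff.2 h

end Lift

theorem Power.continuousOn_mk {ι : Type} {A X : Type u} [TopologicalSpace A]
    [CompactlyGeneratedSpace A] [TopologicalSpace X] {U : Set A} (hU : IsOpen U) {f : A → ι → X}
    (hf : ∀ i, ContinuousOn (fun a => f a i) U) :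
    ContinuousOn (fun a => (KIfy.of (f a) : Power ι X)) U := by
  have := compactlyGeneratedSpace_subtype_of_isOpen hU
  exact continuousOn_iff_continuous_domRestrict.2
    (Power.continuous_mk fun i => continuousOn_iff_continuous_domRestrict.1 (hf i))

/-- A witness that `(X, pt)` is an NDR pair: `v` cuts out the base point, and `h` deforms the
neighbourhood `v < 1` of the base point to the base point. -/
structure NDR (X : Type u) [TopologicalSpace X] [BasePoint X] where
  v : C(X, unitInterval)
  h : C(unitInterval × X, X)
  v_eq_zero {x : X} : v x = 0 ↔ x = pt
  h_zero (x : X) : h (0, x) = x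
  h_pt (t : unitInterval) : h (t, pt) = pt
  h_one {x : X} : v x < 1 → h (1, x) = pt

theorem NondegenerateBasePoint.nonempty_ndr {X : Type u} [TopologicalSpace X] [BasePoint X]
    (hX : NondegenerateBasePoint X) : Nonempty (NDR X) := by
  obtain ⟨v, h, hv, hzero, hpt, hone⟩ := hX
  exact ⟨⟨v, h, hv _, hzero, hpt, hone _⟩⟩

namespace NDR

variable {ι : Type} {k : ℕ} {X : Type u} [TopologicalSpace X] [BasePoint X] (D : NDR X)

open Classical in
/-- The deformation of a power of `X` that applies `D.h` to the coordinates in `S`. -/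
def push (S : Set ι) (t : unitInterval) (x : Power ι X) : Power ι X :=
  KIfy.of fun i => if i ∈ S then D.h (t, x.out i) else x.out i

theorem push_apply (S : Set ι) (t : unitInterval) (x : Power ι X) (i : ι) [Decidable (i ∈ S)] :
    (D.push S t x).out i = if i ∈ S then D.h (t, x.out i) else x.out i :=
  ite_congr rfl (fun _ => rfl) fun _ => rfl

theorem continuous_push {B : Type u} [TopologicalSpace B] [CompactlyGeneratedSpace B]
    (S : Set ι) {t : B → unitInterval} {x : B → Power ι X} (ht : Continuous t)
    (hx : Continuous x) : Continuous fun b => D.push S (t b) (x b) := by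
  refine Power.continuous_mk fun i => ?_
  have hxi : Continuous fun b => (x b).out i := (Power.continuous_apply i).comp hx
  by_cases hi : i ∈ S
  · simp only [if_pos hi]
    fun_prop
  · simpa only [if_neg hi] using hxi

theorem push_zero (S : Set ι) (x : Power ι X) : D.push S 0 x = x := by
  classical
  funext i
  exact (D.push_apply S 0 x i).trans (by rw [D.h_zero, ite_self]; rfl)

theorem push_apply_eq_pt (S : Set ι) (t : unitInterval) {x : Power ι X} {i : ι}
    (hx : x.out i = pt) : (D.push S t x).out i = pt := by
  classical
  rw [push_apply, hx, D.h_pt, ite_self]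

theorem push_one_apply_eq_pt {S : Set ι} {x : Power ι X} {i : ι} (hi : i ∈ S)
    (hx : D.v (x.out i) < 1) : (D.push S 1 x).out i = pt := by
  classical
  rw [push_apply, if_pos hi, D.h_one hx]

theorem push_pt (S : Set ι) (t : unitInterval) : D.push S t (pt : Power ι X) = pt :=
  funext fun _ => D.push_apply_eq_pt S t rfl

section Weight

variable [Fintype ι]

/-- The product of the values of `v` at the coordinates, which cuts out the fat wedge. -/
def weight : C(Power ι X, unitInterval) :=
  ⟨fun x => ∏ i, D.v (x.out i),
    continuous_finsetProd _ fun i _ => D.v.continuous.comp (Power.continuous_apply i)⟩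

theorem weight_apply (x : Power ι X) : D.weight x = ∏ i, D.v (x.out i) := rfl

theorem weight_eq_zero_iff {x : Power ι X} : D.weight x = 0 ↔ ∃ i, x.out i = pt := by
  simp only [weight_apply, Finset.prod_eq_zero_iff, Finset.mem_univ, true_and, D.v_eq_zero]

theorem weight_eq_one_iff {x : Power ι X} : D.weight x = 1 ↔ ∀ i, D.v (x.out i) = 1 := by
  rw [weight_apply, Finset.prod_eq_one_iff_of_le_one' fun _ _ => unitInterval.le_one']
  simp only [Finset.mem_univ, true_imp_iff]

theorem exists_v_lt_one {x : Power ι X} (h : D.weight x < 1) : ∃ i, D.v (x.out i) < 1 := by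
  by_contra! hx
  exact h.ne (D.weight_eq_one_iff.2 fun i => le_antisymm unitInterval.le_one' (hx i))

end Weight

/-- The weight, as a function on the smash power; it cuts out the base point. -/
def smashWeight : C(Smash k X, unitInterval) :=
  ⟨Smash.lift D.weight 0 fun _ => D.weight_eq_zero_iff.2,
    Smash.continuous_lift D.weight.continuous⟩

theorem smashWeight_mk (x : Power (Fin k) X) : D.smashWeight (Smash.mk x) = D.weight x := rfl

theorem smashWeight_eq_zero_iff (hk : 1 ≤ k) {z : Smash k X} : D.smashWeight z = 0 ↔ z = pt := by
  obtain ⟨x, rfl⟩ := Smash.isQuotientMap_mk.surjective z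
  rw [smashWeight_mk, D.weight_eq_zero_iff, Smash.mk_eq_pt_iff hk]

end NDR

/-! ### A countable null cover from the null homotopy of the reduced diagonal -/

section Coordinates

variable {k : ℕ} {X : Type u} [BasePoint X]

open Classical in
/-- The `i`-th coordinate of a point of the smash power other than the base point, and the base
point of `X` at the base point. -/
def Smash.coord (i : Fin k) : Smash k X → X :=
  Smash.lift (fun x => if ∃ j, x.out j = pt then pt else x.out i) pt fun _ hx => if_pos hx

theorem Smash.coord_mk (i : Fin k) {x : Power (Fin k) X} (hx : ¬ ∃ j, x.out j = pt) :
    Smash.coord i (Smash.mk x) = x.out i := if_neg hx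

namespace NDR

variable [TopologicalSpace X] (D : NDR X)

theorem coord_mk {x : Power (Fin k) X} (hx : 0 < D.weight x) (i : Fin k) :
    Smash.coord i (Smash.mk x) = x.out i :=
  Smash.coord_mk i fun h => hx.ne' (D.weight_eq_zero_iff.2 h)

theorem continuousOn_coord (i : Fin k) :
    ContinuousOn (Smash.coord (X := X) i) {z | 0 < D.smashWeight z} := by
  rw [Smash.isQuotientMap_mk.continuousOn_isOpen_iff
    (isOpen_lt continuous_const D.smashWeight.continuous)]
  exact (Power.continuous_apply i).continuousOn.congr fun x hx => D.coord_mk hx i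

/-- A function on the smash power which is positive exactly where no coordinate is the base point
and the `i`-th coordinate lies in the neighbourhood `v < 1` of the base point. -/
def coordWeight (i : Fin k) : C(Smash k X, unitInterval) :=
  ⟨Smash.lift (fun x => D.weight x * unitInterval.symm (D.v (x.out i))) 0 fun x hx => by
      rw [D.weight_eq_zero_iff.2 hx, zero_mul],
    Smash.continuous_lift (D.weight.continuous.mul
      (unitInterval.continuous_symm.comp (D.v.continuous.comp (Power.continuous_apply i))))⟩

theorem coordWeight_pos_iff {i : Fin k} {z : Smash k X} :
    0 < D.coordWeight i z ↔ 0 < D.smashWeight z ∧ D.v (Smash.coord i z) < 1 := by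
  obtain ⟨x, rfl⟩ := Smash.isQuotientMap_mk.surjective z
  change 0 < D.weight x * unitInterval.symm (D.v (x.out i)) ↔ 0 < D.weight x ∧ _
  rw [unitInterval.pos_iff_ne_zero, mul_ne_zero_iff, ← unitInterval.pos_iff_ne_zero]
  refine and_congr_right fun hx => ?_
  rw [D.coord_mk hx, unitInterval.lt_one_iff_ne_one, ne_eq, unitInterval.symm_eq_zero]

theorem exists_coordWeight_pos {z : Smash k X} (h₀ : 0 < D.smashWeight z)
    (h₁ : D.smashWeight z < 1) : ∃ i, 0 < D.coordWeight i z := by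
  obtain ⟨x, rfl⟩ := Smash.isQuotientMap_mk.surjective z
  obtain ⟨i, hi⟩ := D.exists_v_lt_one h₁
  exact ⟨i, D.coordWeight_pos_iff.2 ⟨h₀, by rwa [D.coord_mk h₀]⟩⟩

end NDR

end Coordinates

section Infimum

variable {A : Type*} [TopologicalSpace A]

/-- The minimum of `g` over `[0, r] × {a}`. -/
def minUpTo (g : C(unitInterval × A, unitInterval)) : C(unitInterval × A, unitInterval) :=
  ⟨fun p => sInf ((fun s => g (p.1 * s, p.2)) '' univ),
    isCompact_univ.continuous_sInf
      (f := fun (p : unitInterval × A) (s : unitInterval) => g (p.1 * s, p.2)) (by fun_prop)⟩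

theorem minUpTo_le (g : C(unitInterval × A, unitInterval)) (r s : unitInterval) (a : A) :
    minUpTo g (r, a) ≤ g (r * s, a) :=
  sInf_le (mem_image_of_mem _ (mem_univ s))

theorem minUpTo_pos {g : C(unitInterval × A, unitInterval)} {r : unitInterval} {a : A}
    (h : ∀ s ≤ r, 0 < g (s, a)) : 0 < minUpTo g (r, a) := by
  obtain ⟨s, -, hs⟩ := (isCompact_univ.image (f := fun s : unitInterval => g (r * s, a))
    (by fun_prop)).sInf_mem (univ_nonempty.image _)
  exact (h _ unitInterval.mul_le_left).trans_eq hs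

theorem exists_lt_one_forall_le_pos (g : C(unitInterval, unitInterval)) (h₀ : g 0 = 1)
    (h₁ : g 1 = 0) : ∃ r, g r < 1 ∧ ∀ s ≤ r, 0 < g s := by
  obtain ⟨c, hc0, hc1⟩ := exists_between (zero_lt_one (α := unitInterval))
  have hivt : ∀ s, g s = 0 → ∃ r ≤ s, g r = c := fun s hs =>
    have ⟨r, hr, hgr⟩ := intermediate_value_Icc' (unitInterval.nonneg' : 0 ≤ s)
      g.continuous.continuousOn (show c ∈ Icc (g s) (g 0) by
        rw [hs, h₀]
        exact ⟨hc0.le, hc1.le⟩)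
    ⟨r, hr.2, hgr⟩
  have hclosed : IsClosed {s | g s = c} := isClosed_eq g.continuous continuous_const
  obtain ⟨r, hr, hmin⟩ := hclosed.isCompact.exists_isLeast ((hivt 1 h₁).imp fun _ h => h.2)
  refine ⟨r, (show g r = c from hr).trans_lt hc1,
    fun s hs => unitInterval.pos_iff_ne_zero.2 fun hgs => ?_⟩
  obtain ⟨r', hr's, hr'⟩ := hivt s hgs
  obtain rfl : s = r := le_antisymm hs ((hmin hr').trans hr's)
  exact hc0.ne' (hr.symm.trans hgs)

end Infimum

section NullCover

variable {X : Type u} [TopologicalSpace X] [CompactlyGeneratedSpace X] [BasePoint X] (D : NDR X)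
  (F : (reducedDiagonal X).1.HomotopyRel (ContinuousMap.const X pt) {pt})

namespace NDR

/-- The value of the weight along the null homotopy of the reduced diagonal. -/
def trackWeight : C(unitInterval × X, unitInterval) :=
  D.smashWeight.comp F.toContinuousMap

/-- Positive at `((r, i), x)` if the track of `x` does not meet the base point up to time `r`, and
its `i`-th coordinate lies in the neighbourhood `v < 1` of the base point at time `r`. -/
def coverWeight : C((unitInterval × Fin 2) × X, unitInterval) :=
  ⟨fun p => minUpTo (D.trackWeight F) (p.1.1, p.2) * D.coordWeight p.1.2 (F (p.1.1, p.2)), by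
    refine .mul (by fun_prop) ?_
    have : Continuous fun q : Fin 2 × Smash 2 X => D.coordWeight q.1 q.2 :=
      continuous_prod_of_discrete_left.2 fun i => (D.coordWeight i).continuous
    exact this.comp (g := fun q : Fin 2 × Smash 2 X => D.coordWeight q.1 q.2)
      (f := fun p : (unitInterval × Fin 2) × X => (p.1.2, F (p.1.1, p.2))) (by fun_prop)⟩

/-- Follow the `i`-th coordinate of the track of `x` up to time `r`, then contract it with `h`. -/
def coverPath (p : unitInterval × Fin 2) (x : X) (t : unitInterval) : X :=
  D.h (projIcc 0 1 zero_le_one (2 * t - 1 : ℝ),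
    Smash.coord p.2 (F (p.1 * projIcc 0 1 zero_le_one (2 * t : ℝ), x)))

variable {D F} {p : unitInterval × Fin 2} {x : X}

theorem coverWeight_pos_iff : 0 < D.coverWeight F (p, x) ↔
    0 < minUpTo (D.trackWeight F) (p.1, x) ∧ 0 < D.coordWeight p.2 (F (p.1, x)) := by
  simp only [unitInterval.pos_iff_ne_zero, ← mul_ne_zero_iff]
  rfl

theorem smashWeight_track_pos (h : 0 < D.coverWeight F (p, x)) (s : unitInterval) :
    0 < D.smashWeight (F (p.1 * s, x)) :=
  (coverWeight_pos_iff.1 h).1.trans_le (minUpTo_le _ _ _ _)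

variable (D F) in
theorem continuousOn_coverPath (p : unitInterval × Fin 2) :
    ContinuousOn (fun q : X × unitInterval => D.coverPath F p q.1 q.2)
      ({x | 0 < D.coverWeight F (p, x)} ×ˢ univ) := by
  refine D.h.continuous.comp_continuousOn (.prodMk (by fun_prop) ?_)
  exact (D.continuousOn_coord p.2).comp (by fun_prop) fun q hq => smashWeight_track_pos hq.1 _

theorem coverPath_zero (h : 0 < D.coverWeight F (p, x)) : D.coverPath F p x 0 = x := by
  have hpos := smashWeight_track_pos h 0
  rw [mul_zero, F.apply_zero] at hpos
  rw [coverPath, projIcc_of_le_left _ (by simp), projIcc_of_le_left _ (by simp)]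
  change D.h (0, Smash.coord p.2 (F (p.1 * 0, x))) = x
  rw [D.h_zero, mul_zero, F.apply_zero]
  exact D.coord_mk hpos p.2

theorem coverPath_one (h : 0 < D.coverWeight F (p, x)) : D.coverPath F p x 1 = pt := by
  rw [coverPath, projIcc_of_right_le _ (by norm_num), projIcc_of_right_le _ (by norm_num)]
  refine D.h_one ?_
  change D.v (Smash.coord p.2 (F (p.1 * 1, x))) < 1
  rw [mul_one]
  exact (D.coordWeight_pos_iff.1 (coverWeight_pos_iff.1 h).2).2

variable (D F) in
theorem exists_coverWeight_pos (hx : D.v x = 1) : ∃ p, 0 < D.coverWeight F (p, x) := by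
  obtain ⟨r, hr, hpos⟩ := exists_lt_one_forall_le_pos
    ((D.trackWeight F).comp ((ContinuousMap.id _).prodMk (.const _ x)))
    (by
      change D.smashWeight (F (0, x)) = 1
      rw [F.apply_zero]
      exact (D.weight_eq_one_iff (x := KIfy.of fun _ : Fin 2 => x)).2 fun _ => hx)
    (by
      change D.smashWeight (F (1, x)) = 0
      rw [F.apply_one]
      exact (D.weight_eq_zero_iff (x := (pt : Power (Fin 2) X))).2 ⟨0, rfl⟩)
  obtain ⟨i, hi⟩ := D.exists_coordWeight_pos (hpos r le_rfl) hr
  exact ⟨(r, i), coverWeight_pos_iff.2 ⟨minUpTo_pos hpos, hi⟩⟩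

/-- The null cover of the complement of the base point neighbourhood, obtained by letting `(r, i)`
run through a dense sequence. -/
def nullCover : NullCover id (pt : X) {x | D.v x = 1} where
  weight n := (D.coverWeight F).comp
    ((ContinuousMap.const _ (TopologicalSpace.denseSeq _ n)).prodMk (.id X))
  path n := D.coverPath F (TopologicalSpace.denseSeq _ n)
  continuousOn_path n := D.continuousOn_coverPath F _
  path_zero := coverPath_zero
  path_one := coverPath_one
  exists_pos {x} hx := by
    have hopen : IsOpen {p | 0 < D.coverWeight F (p, x)} :=
      isOpen_lt continuous_const (by fun_prop)
    exact (TopologicalSpace.denseRange_denseSeq _).exists_mem_open hopen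
      (D.exists_coverWeight_pos F hx)

end NDR

/-- Adding one more null homotopy, in front of a null cover. -/
def NullCover.cons {A B : Type u} [TopologicalSpace A] [TopologicalSpace B] {f : A → B} {b : B}
    {S : Set A} (N : NullCover f b S) (w : C(A, unitInterval)) (c : C(A × unitInterval, B))
    (hc₀ : ∀ a, c (a, 0) = f a) (hc₁ : ∀ a, 0 < w a → c (a, 1) = b)
    (hS : ∀ a, a ∉ S → 0 < w a) : NullCover f b univ where
  weight n := n.casesOn w N.weight
  path n := n.casesOn (fun a t => c (a, t)) N.path
  continuousOn_path
    | 0 => c.continuous.continuousOn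
    | i + 1 => N.continuousOn_path i
  path_zero {i a} h := match i with
    | 0 => hc₀ a
    | _ + 1 => N.path_zero h
  path_one {i a} h := match i with
    | 0 => hc₁ a h
    | _ + 1 => N.path_one h
  exists_pos {a} _ := by
    by_cases ha : a ∈ S
    · exact (N.exists_pos ha).elim fun i hi => ⟨i + 1, hi⟩
    · exact ⟨0, hS a ha⟩

variable {D} {ι : Type} [Fintype ι] {B : Type u} [TopologicalSpace B] {b : B}

open Classical in
/-- A null cover of `X` induces one of a map on `X ^ ι` that is trivial on the fat wedge, by
applying its paths to the `o`-th coordinate. -/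
def NullCover.onCoord (N : NullCover id (pt : X) {x | D.v x = 1}) (o : ι) (f : C(Power ι X, B))
    (hf : ∀ x, (∃ i, x.out i = pt) → f x = b) :
    NullCover f b {x : Power ι X | D.weight x = 1} where
  weight n :=
    ⟨fun x => N.weight n (x.out o) * D.weight x,
      ((N.weight n).continuous.comp (Power.continuous_apply o)).mul D.weight.continuous⟩
  path n x t := f (KIfy.of (Function.update x.out o (N.path n (x.out o) t)))
  continuousOn_path n := by
    have : CompactlyGeneratedSpace (Power ι X × unitInterval) := cg_prod_of_locallyCompact
    have hopen : IsOpen ({x : Power ι X | 0 < N.weight n (x.out o) * D.weight x} ×ˢ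
        (univ : Set unitInterval)) :=
      (isOpen_lt continuous_const (((N.weight n).continuous.comp
        (Power.continuous_apply o)).mul D.weight.continuous)).prod isOpen_univ
    refine f.continuous.comp_continuousOn (Power.continuousOn_mk hopen fun i => ?_)
    by_cases hi : i = o
    · subst hi
      simp only [Function.update_self]
      exact (N.continuousOn_path n).comp
        (f := fun q : Power ι X × unitInterval => (q.1.out i, q.2))
        (((Power.continuous_apply i).comp continuous_fst).prodMk continuous_snd).continuousOn
        fun q hq => ⟨pos_of_mul_pos_left hq.1 unitInterval.nonneg', mem_univ _⟩
    · simp only [Function.update_of_ne hi]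
      exact ((Power.continuous_apply i).comp continuous_fst).continuousOn
  path_zero {n x} h := by
    rw [N.path_zero (pos_of_mul_pos_left h unitInterval.nonneg'), id, Function.update_eq_self]
    rfl
  path_one {n x} h := by
    refine hf _ ⟨o, ?_⟩
    rw [N.path_one (pos_of_mul_pos_left h unitInterval.nonneg')]
    exact Function.update_self (f := x.out) o pt
  exists_pos {x} hx := by
    obtain ⟨n, hn⟩ := N.exists_pos (D.weight_eq_one_iff.1 hx o)
    refine ⟨n, ?_⟩
    change 0 < N.weight n (x.out o) * D.weight x
    rwa [show D.weight x = 1 from hx, mul_one]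

variable {Z : Type u} [TopologicalSpace Z] [BasePoint Z]

theorem nonempty_rightInverse_of_fatWedge (hX : NondegenerateBasePoint X) (hcat : WeakCatLtTwo X)
    {κ : Type} [Finite κ] [Nonempty κ] (f : C(Power κ X, James Z))
    (hf : ∀ x, (∃ i, x.out i = pt) → f x = 1) :
    Nonempty (RightInverse f {x | ∃ i, x.out i = pt}) := by
  have := Fintype.ofFinite κ
  obtain ⟨D⟩ := hX.nonempty_ndr
  obtain ⟨F⟩ := hcat
  have : CompactlyGeneratedSpace (Power κ X × unitInterval) := cg_prod_of_locallyCompact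
  let w : C(Power κ X, unitInterval) := ⟨_, unitInterval.continuous_symm.comp D.weight.continuous⟩
  let c : C(Power κ X × unitInterval, James Z) :=
    ⟨fun q => f (D.push univ q.2 q.1),
      f.continuous.comp (D.continuous_push univ continuous_snd continuous_fst)⟩
  have hw : ∀ x, 0 < w x ↔ D.weight x < 1 := fun x => by
    rw [unitInterval.lt_one_iff_ne_one, unitInterval.pos_iff_ne_zero, ne_eq, ne_eq,
      ← unitInterval.symm_eq_zero]
    rfl
  refine NullCover.nonempty_rightInverse
    (((D.nullCover (F := F)).onCoord (Classical.arbitrary κ) f hf).cons w c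
      (fun x => congrArg f (D.push_zero univ x)) (fun x hx => ?_) fun x hx => ?_)
    (fun x hx i => ?_) fun x ⟨i, hi⟩ t => hf _ ⟨i, D.push_apply_eq_pt univ t hi⟩
  · obtain ⟨i, hi⟩ := D.exists_v_lt_one ((hw x).1 hx)
    exact hf _ ⟨i, D.push_one_apply_eq_pt (mem_univ i) hi⟩
  · exact (hw x).2 (unitInterval.lt_one_iff_ne_one.2 hx)
  · change _ * D.weight x = 0
    rw [D.weight_eq_zero_iff.2 hx, mul_zero]

theorem nonempty_rightInverse_incl (hX : NondegenerateBasePoint X) (hcat : WeakCatLtTwo X) {k : ℕ}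
    (hk : 1 ≤ k) :
    Nonempty (RightInverse (James.incl : Smash k X → James (Smash k X)) {pt}) := by
  have : Nonempty (Fin k) := ⟨⟨0, hk⟩⟩
  obtain ⟨R⟩ := nonempty_rightInverse_of_fatWedge hX hcat
    ⟨fun x : Power (Fin k) X => James.incl (Smash.mk x),
      James.continuous_incl.comp Smash.continuous_mk⟩
    fun x hx => (congrArg James.incl (Smash.mk_eq_pt hx)).trans James.incl_pt
  have hpt : ∃ i, (pt : Power (Fin k) X).out i = pt := ⟨⟨0, hk⟩, rfl⟩
  exact ⟨{
    inv := ⟨Smash.lift R.inv 1 fun _ => R.inv_eq_one, Smash.continuous_lift R.inv.continuous⟩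
    homotopy := ⟨fun p => Smash.lift (fun x => R.homotopy (p.1, x)) 1
        (fun _ hx => R.homotopy_eq_one hx p.1) p.2,
      Smash.isQuotientMap_mk.continuous_lift_prod_right R.homotopy.continuous⟩
    homotopy_zero := by rintro ⟨x⟩; exact R.homotopy_zero x
    homotopy_one := by rintro ⟨x⟩; exact R.homotopy_one x
    inv_eq_one := by rintro _ rfl; exact R.inv_eq_one hpt
    homotopy_eq_one := by rintro _ rfl; exact R.homotopy_eq_one hpt }⟩

end NullCover

/-! ### Extending the right inverse from `Z` to `J(Z)` -/

/-- A right inverse of the identity of `J(Z)` up to pointed homotopy. -/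
abbrev JamesInverse (Z : Type u) [TopologicalSpace Z] [BasePoint Z] : Type u :=
  RightInverse (id : James Z → James Z) {1}

section Words

variable {Z : Type u} [BasePoint Z]

open Classical in
theorem James.mk_filter_eq_prod (l : List Z) (h : pt ∉ l.filter (fun a => a ≠ pt)) :
    (⟨l.filter (fun a => a ≠ pt), h⟩ : James Z) = (l.map James.incl).prod := by
  induction l with
  | nil => rfl
  | cons z l ih =>
    have h' : pt ∉ l.filter (fun a => a ≠ pt) := by simp
    rw [List.map_cons, List.prod_cons, ← ih h']
    refine Subtype.ext ?_
    change _ = (James.incl z).1 ++ l.filter (fun a => a ≠ pt)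
    rw [James.incl_val]
    by_cases hz : z = pt <;> simp [hz]

theorem James.prod_incl (g : James Z) : (g.1.map James.incl).prod = g := by
  classical
  have h : g.1.filter (fun a => a ≠ pt) = g.1 :=
    List.filter_eq_self.2 fun a ha => by simpa using fun e : a = pt => g.2 (e ▸ ha)
  rw [← James.mk_filter_eq_prod _ (by simp)]
  exact Subtype.ext h

end Words

section Length

variable {Z : Type u} [TopologicalSpace Z] (v : C(Z, unitInterval))

/-- The length of the null homotopy of a word, where `v z` is that of the letter `z`. -/
def mooreLen (l : List Z) : ℝ := (l.map fun z => (v z : ℝ)).sum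

variable {v}

theorem mooreLen_cons (z : Z) (l : List Z) : mooreLen v (z :: l) = v z + mooreLen v l := by
  rw [mooreLen, List.map_cons, List.sum_cons, mooreLen]

theorem mooreLen_nonneg (l : List Z) : 0 ≤ mooreLen v l :=
  List.sum_nonneg (by simpa using fun z _ => (v z).2.1)

variable (v) in
theorem continuous_mooreLen {A : Type u} [TopologicalSpace A] {m : ℕ} {x : A → Fin m → Z}
    (hx : ∀ i, Continuous fun a => x a i) : Continuous fun a => mooreLen v (List.ofFn (x a)) := by
  simp only [mooreLen, List.map_ofFn, List.sum_ofFn, Function.comp_def]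
  fun_prop

end Length

section Moore

variable {Z : Type u} [TopologicalSpace Z] [BasePoint Z] (v : C(Z, unitInterval))
  (R : RightInverse (James.incl : Z → James Z) {pt})

/-- The null homotopy of `z * R.inv z`, run on the interval `[0, v z]`. -/
def mooreLetter (z : Z) (s : ℝ) : James Z := R.homotopy (projIcc 0 1 zero_le_one (s / v z), z)

/-- The inverse of a word. -/
def mooreInv (l : List Z) : James Z := ((l.map R.inv).reverse).prod

/-- The null homotopy of a word times its inverse: contract the letters one by one, starting with
the last. -/
def moore : List Z → ℝ → James Z
  | [], _ => 1
  | z :: l, s => if s ≤ mooreLen v l then James.incl z * moore l s * R.inv z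
      else mooreLetter v R z (s - mooreLen v l)

variable {v R}

theorem mooreInv_cons (z : Z) (l : List Z) : mooreInv R (z :: l) = mooreInv R l * R.inv z := by
  rw [mooreInv, List.map_cons, List.reverse_cons, List.prod_append, List.prod_singleton, mooreInv]

theorem mooreLetter_pt (s : ℝ) : mooreLetter v R pt s = 1 := R.homotopy_eq_one rfl _

theorem mooreLetter_zero (z : Z) : mooreLetter v R z 0 = James.incl z * R.inv z := by
  rw [mooreLetter, zero_div, projIcc_of_le_left _ le_rfl]
  exact R.homotopy_zero z

theorem moore_zero (l : List Z) :
    moore v R l 0 = (l.map James.incl).prod * mooreInv R l := by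
  induction l with
  | nil => rfl
  | cons z l ih =>
    rw [moore, if_pos (mooreLen_nonneg l), ih, mooreInv_cons, List.map_cons, List.prod_cons]
    simp only [mul_assoc]

open Classical in
theorem mooreInv_filter (l : List Z) :
    mooreInv R (l.filter (fun a => a ≠ pt)) = mooreInv R l := by
  induction l with
  | nil => rfl
  | cons z l ih =>
    by_cases hz : z = pt
    · rw [List.filter_cons_of_neg (by simpa using hz), ih, mooreInv_cons, R.inv_eq_one hz, mul_one]
    · rw [List.filter_cons_of_pos (by simpa using hz), mooreInv_cons, ih, mooreInv_cons]

section Length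

variable (hv : ∀ z, v z = 0 ↔ z = pt)
include hv

theorem mooreLetter_of_le {z : Z} {s : ℝ} (hs : v z ≤ s) : mooreLetter v R z s = 1 := by
  rcases (v z).2.1.eq_or_lt with h | h
  · rw [(hv z).1 (Subtype.ext h.symm), mooreLetter_pt]
  · rw [mooreLetter, projIcc_of_right_le _ ((one_le_div h).2 hs)]
    exact R.homotopy_one z

theorem moore_of_le {l : List Z} {s : ℝ} (hs : mooreLen v l ≤ s) : moore v R l s = 1 := by
  induction l with
  | nil => rfl
  | cons z l ih =>
    rw [mooreLen_cons] at hs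
    rw [moore]
    split_ifs with h
    · have hz : z = pt := (hv z).1
        (Subtype.ext (le_antisymm (show (v z : ℝ) ≤ 0 by linarith) (v z).2.1))
      rw [hz, ih (by linarith [(v z).2.1]), R.inv_eq_one rfl, James.incl_pt, one_mul, one_mul]
    · exact mooreLetter_of_le hv (by linarith)

open Classical in
theorem mooreLen_filter (l : List Z) :
    mooreLen v (l.filter (fun a => a ≠ pt)) = mooreLen v l := by
  induction l with
  | nil => rfl
  | cons z l ih =>
    by_cases hz : z = pt
    · rw [List.filter_cons_of_neg (by simpa using hz), ih, mooreLen_cons, (hv z).2 hz, Icc.coe_zero,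
        zero_add]
    · rw [List.filter_cons_of_pos (by simpa using hz), mooreLen_cons, ih, mooreLen_cons]

open Classical in
theorem moore_filter (l : List Z) (s : ℝ) :
    moore v R (l.filter (fun a => a ≠ pt)) s = moore v R l s := by
  induction l with
  | nil => rfl
  | cons z l ih =>
    by_cases hz : z = pt
    · rw [List.filter_cons_of_neg (by simpa using hz), ih, moore]
      split_ifs with h
      · rw [hz, R.inv_eq_one rfl, James.incl_pt, one_mul, mul_one]
      · rw [hz, mooreLetter_pt, moore_of_le hv (not_le.1 h).le]
    · rw [List.filter_cons_of_pos (by simpa using hz), moore, moore, ih, mooreLen_filter hv]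

variable (v R) in
theorem continuous_mooreLetter : Continuous fun p : ℝ × Z => mooreLetter v R p.2 p.1 := by
  refine continuous_iff_continuousAt.2 fun ⟨s, z⟩ => ?_
  by_cases hz : z = pt
  · subst hz
    -- `s / v z` diverges here, but `R.homotopy (t, pt) = 1` for all `t` in the compact interval.
    intro O hO
    have hO₁ : O ∈ 𝓝 (1 : James Z) := by rwa [← mooreLetter_pt (v := v) (R := R) s]
    have htube : ∀ᶠ z in 𝓝 (pt : Z), ∀ t ∈ (univ : Set unitInterval), R.homotopy (t, z) ∈ O := by
      refine isCompact_univ.eventually_forall_of_forall_eventually fun t _ => ?_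
      have hcont : ContinuousAt (fun q : Z × unitInterval => R.homotopy (q.2, q.1)) (pt, t) := by
        fun_prop
      rw [ContinuousAt, R.homotopy_eq_one rfl] at hcont
      exact hcont hO₁
    exact ((continuous_snd (X := ℝ) (Y := Z)).continuousAt (x := (s, (pt : Z)))).eventually htube
      |>.mono fun p hp => hp _ (mem_univ _)
  · have hdiv : ContinuousAt (fun p : ℝ × Z => p.1 / v p.2) (s, z) :=
      continuousAt_fst.div (by fun_prop) fun h => hz ((hv z).1 (Subtype.ext h))
    exact ContinuousAt.comp (f := fun p : ℝ × Z => (projIcc 0 1 zero_le_one (p.1 / v p.2), p.2))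
      (g := R.homotopy) R.homotopy.continuous.continuousAt
      ((continuous_projIcc.continuousAt.comp hdiv).prodMk continuousAt_snd)

end Length

section Continuity

variable {A : Type u} [TopologicalSpace A] {m : ℕ} {x : A → Fin m → Z}

variable [CompactlyGeneratedSpace A]

variable (R) in
theorem continuous_mooreInv (hx : ∀ i, Continuous fun a => x a i) :
    Continuous fun a => mooreInv R (List.ofFn (x a)) := by
  induction m with
  | zero => simpa only [List.ofFn_zero] using continuous_const
  | succ m ih =>
    simp only [List.ofFn_succ, mooreInv_cons]
    exact James.continuous_mul (ih fun i => hx i.succ) (R.inv.continuous.comp (hx 0))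

variable [CompactlyGeneratedSpace Z]

variable (R) in
theorem continuous_moore (hv : ∀ z, v z = 0 ↔ z = pt) (hx : ∀ i, Continuous fun a => x a i)
    {s : A → ℝ} (hs : Continuous s) : Continuous fun a => moore v R (List.ofFn (x a)) (s a) := by
  induction m with
  | zero => simpa only [List.ofFn_zero, moore] using continuous_const
  | succ m ih =>
    simp only [List.ofFn_succ, moore]
    have hlen : Continuous fun a => mooreLen v (List.ofFn fun i : Fin m => x a i.succ) :=
      continuous_mooreLen v fun i => hx i.succ
    refine Continuous.if_le (James.continuous_mul (James.continuous_mul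
      (James.continuous_incl.comp (hx 0)) (ih fun i => hx i.succ)) (R.inv.continuous.comp (hx 0)))
      ((continuous_mooreLetter v R hv).comp ((hs.sub hlen).prodMk (hx 0))) hs hlen fun a ha => ?_
    rw [ha, sub_self, mooreLetter_zero, moore_of_le hv le_rfl, mul_one]

end Continuity

variable (R) in
theorem James.continuous_mooreInv : Continuous fun g : James Z => mooreInv R g.1 := by
  classical
  refine James.isQuotientMap_word.continuous_iff.2 (continuous_sigma fun n => ?_)
  refine (GeoReal.continuous_mooreInv R fun i => Power.continuous_apply i).congr fun x => ?_
  exact (mooreInv_filter (List.ofFn x.out)).symm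

theorem continuous_of_continuous_comp_word {T Y : Type*} [TopologicalSpace T]
    [LocallyCompactSpace T] [TopologicalSpace Y] {H : T × James Z → Y}
    (h : ∀ n, Continuous fun p : T × Power (Fin n) Z => H (p.1, James.word ⟨n, p.2⟩)) :
    Continuous H := by
  refine James.isQuotientMap_word.continuous_lift_prod_right ?_
  refine (Homeomorph.isQuotientMap (Homeomorph.prodComm _ _)).continuous_iff.2 ?_
  refine (Homeomorph.sigmaProdDistrib (X := fun n : ℕ => Power (Fin n) Z)
    (Y := T)).symm.isQuotientMap.continuous_iff.2 (continuous_sigma fun n => ?_)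
  exact (h n).comp continuous_swap

theorem James.continuous_moore [CompactlyGeneratedSpace Z] (hv : ∀ z, v z = 0 ↔ z = pt) :
    Continuous fun p : unitInterval × James Z => moore v R p.2.1 (p.1 * mooreLen v p.2.1) := by
  classical
  refine continuous_of_continuous_comp_word fun n => ?_
  have hx : ∀ i : Fin n, Continuous fun p : unitInterval × Power (Fin n) Z => p.2.out i :=
    fun i => (Power.continuous_apply i).comp continuous_snd
  refine (GeoReal.continuous_moore R hv hx
    ((continuous_subtype_val.comp continuous_fst).mul (continuous_mooreLen v hx))).congr fun p => ?_
  change moore v R (List.ofFn p.2.out) (p.1 * mooreLen v (List.ofFn p.2.out)) =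
    moore v R ((List.ofFn p.2.out).filter fun a => a ≠ pt)
      (p.1 * mooreLen v ((List.ofFn p.2.out).filter fun a => a ≠ pt))
  rw [mooreLen_filter hv, moore_filter hv]

/-- A pointed right inverse of the inclusion `Z → J(Z)` extends to one of the identity of `J(Z)`. -/
def JamesInverse.ofIncl [CompactlyGeneratedSpace Z] (hv : ∀ z, v z = 0 ↔ z = pt)
    (R : RightInverse (James.incl : Z → James Z) {pt}) : JamesInverse Z where
  inv := ⟨fun g => mooreInv R g.1, James.continuous_mooreInv R⟩
  homotopy := ⟨fun p => moore v R p.2.1 (p.1 * mooreLen v p.2.1), James.continuous_moore hv⟩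
  homotopy_zero g := by
    change moore v R g.1 ((0 : unitInterval) * mooreLen v g.1) = g * mooreInv R g.1
    rw [Icc.coe_zero, zero_mul, moore_zero, James.prod_incl]
  homotopy_one g := moore_of_le hv (by simp only [Icc.coe_one, one_mul, le_refl])
  inv_eq_one := by rintro _ rfl; rfl
  homotopy_eq_one := by rintro _ rfl t; rfl

end Moore

namespace JamesInverse

theorem nonempty_smash {X : Type u} [TopologicalSpace X] [CompactlyGeneratedSpace X]
    [BasePoint X] (hX : NondegenerateBasePoint X) (hcat : WeakCatLtTwo X) {k : ℕ} (hk : 1 ≤ k) :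
    Nonempty (JamesInverse (Smash k X)) := by
  obtain ⟨R⟩ := nonempty_rightInverse_incl hX hcat hk
  obtain ⟨D⟩ := hX.nonempty_ndr
  exact ⟨.ofIncl (v := D.smashWeight) (fun _ => D.smashWeight_eq_zero_iff hk) R⟩

variable {Z : Type u} [TopologicalSpace Z] [BasePoint Z] (R : JamesInverse Z)

theorem homotopy_zero (g : James Z) : R.homotopy (0, g) = g * R.inv g :=
  RightInverse.homotopy_zero R g

theorem homotopy_apply_one (t : unitInterval) : R.homotopy (t, 1) = 1 :=
  R.homotopy_eq_one rfl t

theorem inv_one : R.inv 1 = 1 := R.inv_eq_one rfl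

variable {A : Type u} [TopologicalSpace A] [BasePoint A]

/-- The composite of a pointed map with the inverse of `J(Z)`. -/
def comp (f : PMap A (James Z)) : PMap A (James Z) :=
  ⟨R.inv.comp f.1, by
    rw [ContinuousMap.comp_apply, f.2]
    exact R.inv_one⟩

variable [CompactlyGeneratedSpace A]

theorem mk_mul_mk_comp (f : PMap A (James Z)) : PClass.mk f * PClass.mk (R.comp f) = 1 := by
  refine PClass.mk_eq_of_homotopy (fun p => R.homotopy (p.1, f.1 p.2)) (by fun_prop)
    (fun a => R.homotopy_zero _) (fun a => R.homotopy_one _) fun t => ?_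
  change R.homotopy (t, f.1 pt) = 1
  rw [f.2]
  exact R.homotopy_apply_one t

include R in
theorem isUnit (a : PClass A (James Z)) : IsUnit a := by
  have hright : ∀ a : PClass A (James Z), ∃ b, a * b = 1 := fun a => by
    obtain ⟨f, rfl⟩ := a.exists_mk
    exact ⟨_, R.mk_mul_mk_comp f⟩
  obtain ⟨b, hab⟩ := hright a
  obtain ⟨c, hbc⟩ := hright b
  exact ⟨⟨a, b, hab, left_inv_eq_right_inv hab hbc ▸ hbc⟩, rfl⟩

/-- A class as an element of the group of invertible classes. -/
def unit (a : PClass A (James Z)) : HGroup A Z := (R.isUnit a).unit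

end JamesInverse

/-! ### Maps that are trivial where a coordinate is the base point -/

section InsertPt

variable {ι κ μ : Type} {X Z : Type u} [TopologicalSpace X] [BasePoint X]

theorem insertPt_comp (f : ι → Option κ) (g : κ → Option μ) :
    (insertPt X f).comp (insertPt X g) = insertPt X fun i => (f i).bind g := by
  refine PMap.ext fun y => funext fun i => ?_
  change (f i).elim pt (fun j => (g j).elim pt y) = ((f i).bind g).elim pt y
  cases f i <;> rfl

theorem kill_of_mem {T : Set ι} {i : ι} (hi : i ∈ T) : kill T i = none := if_pos hi

theorem insertPt_kill_apply (T : Set ι) (x : Power ι X) (i : ι) [Decidable (i ∈ T)] :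
    ((insertPt X (kill T)).1 x).out i = if i ∈ T then pt else x.out i := by
  change (kill T i).elim pt x.out = _
  unfold kill
  split_ifs <;> rfl

theorem insertPt_kill_singleton_eq_self {i : ι} {x : Power ι X} (hx : x.out i = pt) :
    (insertPt X (kill {i})).1 x = x := by
  classical
  refine funext fun j => (insertPt_kill_apply {i} x j).trans ?_
  split_ifs with h
  · exact (mem_singleton_iff.1 h) ▸ hx.symm
  · rfl

theorem insertPt_kill_apply_eq_pt (T : Set ι) {i : ι} {x : Power ι X} (hx : x.out i = pt) :
    ((insertPt X (kill T)).1 x).out i = pt := by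
  classical
  rw [insertPt_kill_apply, hx, ite_self]

variable [TopologicalSpace Z] [BasePoint Z]

theorem gpullback_insertPt_insertPt (f : ι → Option κ) (g : κ → Option μ)
    (a : HGroup (Power ι X) Z) :
    gpullback (insertPt X g) (gpullback (insertPt X f) a) =
      gpullback (insertPt X fun i => (f i).bind g) a := by
  rw [gpullback_gpullback, insertPt_comp]

theorem gpullback_insertPt_some (a : HGroup (Power ι X) Z) :
    gpullback (insertPt X (some : ι → Option ι)) a = a := by
  obtain ⟨f, hf⟩ := a.1.exists_mk
  refine Units.ext ?_
  change pullback _ a.1 = a.1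
  rw [← hf]
  rfl

end InsertPt

section Strictify

variable {ι : Type} {X Z : Type u} [TopologicalSpace X] [BasePoint X] [BasePoint Z]

/-- The map `f` is trivial wherever the coordinate `i` is the base point. -/
def TrivialAt (i : ι) (f : Power ι X → James Z) : Prop := ∀ ⦃x⦄, x.out i = pt → f x = 1

variable [TopologicalSpace Z] (D : NDR X) (R : JamesInverse Z)

/-- For `r = 1`, the modification of `x ↦ f x * R.inv (f (x with i-th coordinate killed))` that is
trivial wherever the coordinate `i` is the base point; `r = 0` gives this product itself, after
`D.push`. -/
def strictify (r : unitInterval) (i : ι) (f : Power ι X → James Z) (x : Power ι X) : James Z :=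
  if (D.v (x.out i) : ℝ) ≤ 1 / 2 then
    R.homotopy (projIcc 0 1 zero_le_one (r * (1 - 2 * D.v (x.out i))), f (D.push {i} 1 x))
  else f (D.push {i} 1 x) * R.inv (f ((insertPt X (kill {i})).1 (D.push {i} 1 x)))

variable {D R} {i j : ι} {f : Power ι X → James Z} {x : Power ι X} {r : unitInterval}

theorem push_apply_eq_pt_of_le_half (hx : (D.v (x.out i) : ℝ) ≤ 1 / 2) :
    (D.push {i} 1 x).out i = pt :=
  D.push_one_apply_eq_pt (mem_singleton i)
    (Subtype.coe_lt_coe.1 (show (D.v (x.out i) : ℝ) < 1 by linarith))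

theorem insertPt_kill_push (hx : (D.v (x.out i) : ℝ) ≤ 1 / 2) :
    (insertPt X (kill {i})).1 (D.push {i} 1 x) = D.push {i} 1 x :=
  insertPt_kill_singleton_eq_self (push_apply_eq_pt_of_le_half hx)

theorem trivialAt_strictify_one (i : ι) (f : Power ι X → James Z) :
    TrivialAt i (strictify D R 1 i f) := by
  intro x hx
  rw [strictify, D.v_eq_zero.2 hx, if_pos (by simp), projIcc_of_right_le _ (by simp)]
  exact R.homotopy_one _

theorem strictify_eq_one (h : f (D.push {i} 1 x) = 1)
    (h' : f ((insertPt X (kill {i})).1 (D.push {i} 1 x)) = 1) : strictify D R r i f x = 1 := by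
  rw [strictify, h, h', R.inv_one, mul_one, R.homotopy_apply_one, ite_self]

theorem TrivialAt.strictify (hf : TrivialAt j f) : TrivialAt j (strictify D R r i f) := fun _ hx =>
  strictify_eq_one (hf (D.push_apply_eq_pt _ _ hx))
    (hf (insertPt_kill_apply_eq_pt _ (D.push_apply_eq_pt _ _ hx)))

theorem TrivialAt.strictify_eq (hf : TrivialAt i f) (x : Power ι X) :
    GeoReal.strictify D R r i f x = f (D.push {i} 1 x) := by
  classical
  rw [GeoReal.strictify]
  split_ifs with h
  · rw [hf (push_apply_eq_pt_of_le_half h), R.homotopy_apply_one]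
  · rw [hf ((insertPt_kill_apply {i} _ i).trans (if_pos rfl)), R.inv_one, mul_one]

theorem strictify_zero (i : ι) (f : Power ι X → James Z) (x : Power ι X) :
    strictify D R 0 i f x =
      f (D.push {i} 1 x) * R.inv (f ((insertPt X (kill {i})).1 (D.push {i} 1 x))) := by
  rw [strictify]
  split_ifs with h
  · rw [insertPt_kill_push h, Icc.coe_zero, zero_mul, projIcc_of_le_left _ le_rfl]
    exact R.homotopy_zero _
  · rfl

theorem strictify_pt (hf : f pt = 1) : strictify D R r i f pt = 1 := by
  refine strictify_eq_one ?_ ?_ <;> rw [D.push_pt]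
  · exact hf
  · rwa [(insertPt X (kill {i})).2]

theorem continuous_strictify [CompactlyGeneratedSpace X] {B : Type u} [TopologicalSpace B]
    [CompactlyGeneratedSpace B] {r : B → unitInterval} {F : B → Power ι X → James Z}
    {y : B → Power ι X} (hr : Continuous r)
    (hF : ∀ z : B → Power ι X, Continuous z → Continuous fun b => F b (z b))
    (hy : Continuous y) : Continuous fun b => strictify D R (r b) i (F b) (y b) := by
  have hv : Continuous fun b => (D.v ((y b).out i) : ℝ) :=
    continuous_subtype_val.comp (D.v.continuous.comp ((Power.continuous_apply i).comp hy))
  have hpush : Continuous fun b => D.push {i} 1 (y b) := D.continuous_push _ continuous_const hy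
  refine Continuous.if_le (R.homotopy.continuous.comp (Continuous.prodMk
    (continuous_projIcc.comp (by fun_prop)) (hF _ hpush))) (James.continuous_mul (hF _ hpush)
    (R.inv.continuous.comp (hF _ ((insertPt X (kill {i})).1.continuous.comp hpush))))
    hv continuous_const fun b hb => ?_
  have hzero : projIcc (0 : ℝ) 1 zero_le_one (r b * (1 - 2 * D.v ((y b).out i))) = 0 :=
    projIcc_of_le_left _ (by rw [hb]; simp)
  change R.homotopy (projIcc (0 : ℝ) 1 zero_le_one (r b * (1 - 2 * D.v ((y b).out i))), _) =
    _ * R.inv (F b ((insertPt X (kill {i})).1 (D.push {i} 1 (y b))))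
  rw [hzero, insertPt_kill_push hb.le]
  exact R.homotopy_zero _

variable [CompactlyGeneratedSpace X]

variable (D R) in
/-- The strictification of a pointed map, for a fixed parameter `r`. -/
def strictifyMap (r : unitInterval) (i : ι) (f : PMap (Power ι X) (James Z)) :
    PMap (Power ι X) (James Z) :=
  ⟨⟨strictify D R r i f.1, continuous_strictify continuous_const
    (fun _ hz => f.1.continuous.comp hz) continuous_id⟩, strictify_pt f.2⟩

theorem mk_strictifyMap (i : ι) (f : PMap (Power ι X) (James Z)) :
    PClass.mk (strictifyMap D R 1 i f) =
      PClass.mk f * PClass.mk (R.comp (f.comp (insertPt X (kill {i})))) := by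
  have hdeform : PClass.mk (strictifyMap D R 0 i f) = PClass.mk (strictifyMap D R 1 i f) :=
    PClass.mk_eq_of_homotopy (fun p => strictify D R p.1 i f.1 p.2)
      (continuous_strictify continuous_fst (fun _ hz => f.1.continuous.comp hz) continuous_snd)
      (fun _ => rfl) (fun _ => rfl) fun _ => strictify_pt f.2
  let g : PMap (Power ι X) (James Z) := f.mul (R.comp (f.comp (insertPt X (kill {i}))))
  have hpush : PClass.mk g = PClass.mk (strictifyMap D R 0 i f) := by
    refine PClass.mk_eq_of_homotopy (fun p => g.1 (D.push {i} p.1 p.2)) (g.1.continuous.comp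
      (D.continuous_push _ continuous_fst continuous_snd)) (fun x => ?_) (fun x => ?_) fun t => ?_
    · rw [D.push_zero]
    · exact (strictify_zero i _ x).symm
    · rw [D.push_pt]
      exact g.2
  rw [← hdeform, ← hpush, PClass.mk_mul]

theorem exists_trivialAt_representative (D : NDR X) (R : JamesInverse Z) (S : Finset ι)
    (a : PClass (Power ι X) (James Z)) (ha : ∀ i ∈ S, pullback (insertPt X (kill {i})) a = 1) :
    ∃ f, PClass.mk f = a ∧ ∀ i ∈ S, TrivialAt i f.1 := by
  classical
  induction S using Finset.induction_on with
  | empty =>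
    obtain ⟨f, rfl⟩ := a.exists_mk
    exact ⟨f, rfl, by simp⟩
  | insert i S hi ih =>
    obtain ⟨f, rfl, hf⟩ := ih fun j hj => ha j (Finset.mem_insert_of_mem hj)
    refine ⟨strictifyMap D R 1 i f, ?_, fun j hj => ?_⟩
    · have hinv := R.mk_mul_mk_comp (f.comp (insertPt X (kill {i})))
      rw [← pullback_mk, ha i (Finset.mem_insert_self i S), one_mul] at hinv
      rw [mk_strictifyMap, hinv, mul_one]
    · rcases Finset.mem_insert.1 hj with rfl | hj
      · exact trivialAt_strictify_one _ _
      · exact (hf j hj).strictify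

end Strictify

/-! ### Identifying two coordinates -/

section Diagonal

variable {ι κ : Type} {X Z : Type u}

open Classical in
/-- The point `y` with the coordinates `i` and `j` replaced by those of `p`. -/
def replacePair (i j : κ) (p : Power (Fin 2) X) (y : Power κ X) : Power κ X :=
  KIfy.of fun m => if m = i then p.out 0 else if m = j then p.out 1 else y.out m

theorem continuous_replacePair [TopologicalSpace X] {B : Type u} [TopologicalSpace B]
    [CompactlyGeneratedSpace B] (i j : κ) {p : B → Power (Fin 2) X} {y : B → Power κ X}
    (hp : Continuous p) (hy : Continuous y) :
    Continuous fun b => replacePair i j (p b) (y b) := by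
  refine Power.continuous_mk fun m => ?_
  by_cases hmi : m = i
  · simp only [if_pos hmi]
    exact (Power.continuous_apply 0).comp hp
  · by_cases hmj : m = j
    · simp only [if_neg hmi, if_pos hmj]
      exact (Power.continuous_apply 1).comp hp
    · simp only [if_neg hmi, if_neg hmj]
      exact (Power.continuous_apply m).comp hy

variable [BasePoint X] [BasePoint Z]

theorem TrivialAt.comp_replacePair {i j : κ} (hij : i ≠ j) {f : Power κ X → James Z}
    (hi : TrivialAt i f) (hj : TrivialAt j f) (y : Power κ X) (p : Power (Fin 2) X)
    (hp : ∃ b, p.out b = pt) : f (replacePair i j p y) = 1 := by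
  obtain ⟨b, hb⟩ := hp
  fin_cases b
  · exact hi ((if_pos rfl).trans hb)
  · exact hj ((if_neg hij.symm).trans ((if_pos rfl).trans hb))

variable [TopologicalSpace X] [TopologicalSpace Z]

theorem continuous_lift_replacePair {i j : κ} (f : C(Power κ X, James Z))
    (hf : ∀ (y : Power κ X) (p : Power (Fin 2) X), (∃ b, p.out b = pt) →
      f (replacePair i j p y) = 1) {B : Type u} [TopologicalSpace B] [CompactlyGeneratedSpace B]
    {z : B → Smash 2 X} {y : B → Power κ X} (hz : Continuous z) (hy : Continuous y) :
    Continuous fun b => Smash.lift (fun p => f (replacePair i j p (y b))) 1 (hf (y b)) (z b) := by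
  refine continuous_from_compactlyGeneratedSpace _ fun K _ _ _ c hc => ?_
  have hK : Continuous fun q : Smash 2 X × K =>
      Smash.lift (fun p => f (replacePair i j p (y (c q.2)))) 1 (hf (y (c q.2))) q.1 := by
    refine Smash.isQuotientMap_mk.continuous_lift_prod_left ?_
    have : CompactlyGeneratedSpace (Power (Fin 2) X × K) := cg_prod
    exact f.continuous.comp
      (continuous_replacePair i j continuous_fst (hy.comp (hc.comp continuous_snd)))
  exact hK.comp ((hz.comp hc).prodMk continuous_id)

variable [CompactlyGeneratedSpace X]

/- A representative that is trivial at the coordinates `i` and `j` factors, in these coordinates,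
through `X ∧ X`, and the two identified coordinates enter it through the reduced diagonal. -/
theorem pullback_insertPt_eq_one (D : NDR X) (R : JamesInverse Z) (hcat : WeakCatLtTwo X) {i j : κ}
    (hij : i ≠ j) {c : PClass (Power κ X) (James Z)}
    (hi : pullback (insertPt X (kill {i})) c = 1) (hj : pullback (insertPt X (kill {j})) c = 1)
    {d : κ → ι} (hd : d i = d j) : pullback (insertPt X fun m => some (d m)) c = 1 := by
  classical
  obtain ⟨f, rfl, hf⟩ := exists_trivialAt_representative D R {i, j} c (by simp [hi, hj])
  obtain ⟨F⟩ := hcat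
  have htriv := TrivialAt.comp_replacePair hij (hf i (by simp)) (hf j (by simp))
  let dup : PMap (Power ι X) (Power κ X) := insertPt X fun m => some (d m)
  rw [pullback_mk, PClass.one_def]
  refine PClass.mk_eq_of_homotopy (fun q => Smash.lift
    (fun p => f.1 (replacePair i j p (dup.1 q.2))) 1 (htriv (dup.1 q.2)) (F (q.1, q.2.out (d i))))
    (continuous_lift_replacePair f.1 htriv ?_ (dup.1.continuous.comp continuous_snd))
    (fun x => ?_) (fun x => ?_) fun t => ?_
  · exact F.continuous.comp
      (continuous_fst.prodMk ((Power.continuous_apply (d i)).comp continuous_snd))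
  · rw [F.apply_zero]
    refine congrArg f.1 (funext fun m => ?_)
    change (if m = i then x.out (d i) else if m = j then x.out (d i) else x.out (d m)) =
      x.out (d m)
    split_ifs with hmi hmj
    · rw [hmi]
    · rw [hmj, hd]
    · rfl
  · rw [F.apply_one]
    exact htriv _ pt ⟨0, rfl⟩
  · have hpt : F (t, (pt : Power ι X).out (d i)) = pt := F.eq_fst t rfl
    rw [hpt]
    exact htriv _ pt ⟨0, rfl⟩

open scoped commutatorElement in
theorem commute_of_kill_eq_one (D : NDR X) (R : JamesInverse Z) (hcat : WeakCatLtTwo X) (i : ι)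
    {a b : HGroup (Power ι X) Z} (ha : gpullback (insertPt X (kill {i})) a = 1)
    (hb : gpullback (insertPt X (kill {i})) b = 1) : Commute a b := by
  classical
  -- Double the coordinate `i`, with `a` using the copy `some i` and `b` the copy `none`.
  let fa : ι → Option (Option ι) := fun j => some (some j)
  let fb : ι → Option (Option ι) := fun j => some (if j = i then none else some j)
  let merge : Option ι → Option ι := fun o => some (o.getD i)
  have hfa : (fun j => (fa j).bind (kill {some i})) = fun j => (kill {i} j).bind fa := by
    funext j
    by_cases h : j = i <;> simp [kill, h, fa]
  have hfb : (fun j => (fb j).bind (kill {none})) = fun j => (kill {i} j).bind fa := by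
    funext j
    by_cases h : j = i <;> simp [kill, h, fa, fb]
  have hmerge_fa : (fun j => (fa j).bind merge) = some := rfl
  have hmerge_fb : (fun j => (fb j).bind merge) = some := by
    funext j
    by_cases h : j = i <;> simp [fb, merge, h]
  have hkill_some : gpullback (insertPt X (kill {some i})) (gpullback (insertPt X fa) a) = 1 := by
    rw [gpullback_insertPt_insertPt, hfa, ← gpullback_insertPt_insertPt, ha, map_one]
  have hkill_none : gpullback (insertPt X (kill {none})) (gpullback (insertPt X fb) b) = 1 := by
    rw [gpullback_insertPt_insertPt, hfb, ← gpullback_insertPt_insertPt, hb, map_one]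
  let c := ⁅gpullback (insertPt X fa) a, gpullback (insertPt X fb) b⁆
  have hc_some : gpullback (insertPt X (kill {some i})) c = 1 := by
    rw [map_commutatorElement, hkill_some, commutatorElement_one_left]
  have hc_none : gpullback (insertPt X (kill {none})) c = 1 := by
    rw [map_commutatorElement, hkill_none, commutatorElement_one_right]
  have hcomm : gpullback (insertPt X merge) c = 1 :=
    Units.ext (pullback_insertPt_eq_one D R hcat (Option.some_ne_none i)
      (congrArg Units.val hc_some) (congrArg Units.val hc_none) (d := fun o => o.getD i) rfl)
  rw [map_commutatorElement, gpullback_insertPt_insertPt, gpullback_insertPt_insertPt, hmerge_fa,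
    hmerge_fb, gpullback_insertPt_some, gpullback_insertPt_some,
    commutatorElement_eq_one_iff_commute] at hcomm
  exact hcomm

end Diagonal

/-! ### The relations of the combinatorial groups -/

section Commutators

variable {H : Type*} [Group H]

theorem comm_eq_inv_mul_conj (a b : H) : comm a b = a⁻¹ * (b⁻¹ * a * b⁻¹⁻¹) := by
  simp only [comm, inv_inv, mul_assoc]

theorem comm_eq_conj_inv_mul (a b : H) : comm a b = a⁻¹ * b⁻¹ * a⁻¹⁻¹ * b := by
  simp only [comm, inv_inv]

theorem comm_eq_one_of_commute {a b : H} (h : Commute a b) : comm a b = 1 := by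
  rw [comm, mul_assoc, h.eq, ← mul_inv_rev, inv_mul_cancel]

section Normal

variable {K : Subgroup H} [K.Normal] {a b : H}

theorem comm_mem_left (ha : a ∈ K) (b : H) : comm a b ∈ K := by
  rw [comm_eq_inv_mul_conj]
  exact K.mul_mem (K.inv_mem ha) (Subgroup.Normal.conj_mem inferInstance a ha b⁻¹)

theorem comm_mem_right (a : H) (hb : b ∈ K) : comm a b ∈ K := by
  rw [comm_eq_conj_inv_mul]
  exact K.mul_mem (Subgroup.Normal.conj_mem inferInstance _ (K.inv_mem hb) a⁻¹) hb

variable (hK : ∀ x ∈ K, ∀ y ∈ K, Commute x y)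
include hK

theorem comm_zpow_left (ha : a ∈ K) (b : H) (m : ℤ) : comm (a ^ m) b = comm a b ^ m := by
  have hcomm : Commute a⁻¹ (b⁻¹ * a * b⁻¹⁻¹) :=
    hK _ (K.inv_mem ha) _ (Subgroup.Normal.conj_mem inferInstance a ha b⁻¹)
  rw [comm_eq_inv_mul_conj, comm_eq_inv_mul_conj, hcomm.mul_zpow, conj_zpow, inv_zpow]

theorem comm_zpow_right (a : H) (hb : b ∈ K) (m : ℤ) : comm a (b ^ m) = comm a b ^ m := by
  have hcomm : Commute (a⁻¹ * b⁻¹ * a⁻¹⁻¹) b :=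
    hK _ (Subgroup.Normal.conj_mem inferInstance _ (K.inv_mem hb) a⁻¹) _ hb
  rw [comm_eq_conj_inv_mul, comm_eq_conj_inv_mul, hcomm.mul_zpow, conj_zpow, inv_zpow]

end Normal

variable {ι : Type} {k : ℕ} {g : (Fin k → ι) → H} {K : ι → Subgroup H} [∀ i, (K i).Normal]
  (hK : ∀ i, ∀ x ∈ K i, ∀ y ∈ K i, Commute x y) (hg : ∀ I j, g I ∈ K (I j))
include hK hg

theorem iterComm_eq_one_of_not_nodup (hinj : ∀ I, ¬ Function.Injective I → g I = 1)
    (w : List (Fin k → ι)) (a : H) (s : List ι) (hs : s.Nodup) (ha : ∀ i ∈ s, a ∈ K i)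
    (hn : ¬ (s ++ w.flatMap List.ofFn).Nodup) : iterComm a (w.map g) = 1 := by
  induction w generalizing a s with
  | nil => exact absurd hs (by simpa using hn)
  | cons J w ih =>
    by_cases hJ : Function.Injective J
    · by_cases hd : List.Disjoint s (List.ofFn J)
      · refine ih (comm a (g J)) (s ++ List.ofFn J) (hs.append (List.nodup_ofFn.2 hJ) hd)
          (fun i hi => ?_) (by simpa using hn)
        rcases List.mem_append.1 hi with h | h
        · exact comm_mem_left (ha i h) _
        · obtain ⟨j, rfl⟩ := (List.mem_ofFn' _ _).1 h
          exact comm_mem_right _ (hg J j)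
      · simp only [List.Disjoint, not_forall, not_false_eq_true, exists_prop] at hd
        obtain ⟨i, his, hiJ, -⟩ := hd
        obtain ⟨j, rfl⟩ := (List.mem_ofFn' _ _).1 hiJ
        exact iterComm_eq_one (w.map g) (comm a (g J))
          (Or.inl (comm_eq_one_of_commute (hK _ a (ha _ his) _ (hg J j))))
    · exact iterComm_eq_one _ _ (Or.inr (by simp [hinj J hJ]))

theorem iterComm_zpow (hk : 1 ≤ k) (w : List ((Fin k → ι) × ℤ)) (a : H) (i : ι) (ha : a ∈ K i)
    (m : ℤ) : iterComm (a ^ m) (w.map fun p => g p.1 ^ p.2) =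
      iterComm a (w.map fun p => g p.1) ^ (m * (w.map Prod.snd).prod) := by
  induction w generalizing a m with
  | nil => simp [iterComm]
  | cons p w ih =>
    have hcomm : comm (a ^ m) (g p.1 ^ p.2) = comm a (g p.1) ^ (m * p.2) := by
      rw [comm_zpow_left (hK i) ha, comm_zpow_right (hK _) a (hg p.1 ⟨0, hk⟩), ← zpow_mul,
        mul_comm]
    rw [List.map_cons, List.map_cons, List.map_cons, List.prod_cons, ← mul_assoc]
    exact (congrArg (iterComm · _) hcomm).trans (ih _ (comm_mem_left ha _) _)

theorem CohenRel.lift_eq_one (hinj : ∀ I, ¬ Function.Injective I → g I = 1) (hk : 1 ≤ k)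
    {r : FreeGroup (Fin k → ι)} (hr : CohenRel ι k r) : FreeGroup.lift g r = 1 := by
  have hlift : ⇑(FreeGroup.lift g) ∘ FreeGroup.of = g := funext fun _ => FreeGroup.lift_apply_of
  induction hr with
  | gen I h => rw [FreeGroup.lift_apply_of, hinj I h]
  | comm I w h =>
    rw [map_iterComm, FreeGroup.lift_apply_of, List.map_map, hlift]
    by_cases hI : Function.Injective I
    · refine iterComm_eq_one_of_not_nodup hK hg hinj w _ (List.ofFn I) (List.nodup_ofFn.2 hI)
        (fun i hi => ?_) (by simpa using h)
      obtain ⟨j, rfl⟩ := (List.mem_ofFn' _ _).1 hi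
      exact hg I j
    · exact iterComm_eq_one _ _ (Or.inl (hinj I hI))
  | pow I m w =>
    rw [map_mul, map_inv, map_zpow, map_iterComm, map_iterComm, map_zpow, FreeGroup.lift_apply_of,
      mul_inv_eq_one]
    simp only [List.map_map, Function.comp_def, map_zpow, FreeGroup.lift_apply_of]
    exact iterComm_zpow hK hg hk w _ _ (hg I ⟨0, hk⟩) m

end Commutators

section Realize

variable {ι κ : Type} {k : ℕ} {X : Type u} [TopologicalSpace X] [BasePoint X]

theorem pullback_geoGen {f : ι → Option κ} {I : Fin k → ι} {I' : Fin k → κ}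
    (h : ∀ j, f (I j) = some (I' j)) : pullback (insertPt X f) (geoGen X I) = geoGen X I' := by
  refine congrArg PClass.mk (PMap.ext fun x => ?_)
  refine congrArg James.incl (congrArg Smash.mk (funext fun j => ?_))
  change (f (I j)).elim pt x.out = x.out (I' j)
  rw [h j]
  rfl

theorem pullback_geoGen_eq_one {f : ι → Option κ} {I : Fin k → ι} (h : ∃ j, f (I j) = none) :
    pullback (insertPt X f) (geoGen X I) = 1 := by
  obtain ⟨j, hj⟩ := h
  refine congrArg PClass.mk (PMap.ext fun x => ?_)
  have hsmash : Smash.mk (KIfy.of fun j => ((insertPt X f).1 x).out (I j)) = (pt : Smash k X) := by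
    refine Smash.mk_eq_pt ⟨j, ?_⟩
    change (f (I j)).elim pt x.out = pt
    rw [hj]
    rfl
  exact (congrArg James.incl hsmash).trans James.incl_pt

variable [CompactlyGeneratedSpace X]

theorem geoGen_eq_one (D : NDR X) (R : JamesInverse (Smash k X)) (hcat : WeakCatLtTwo X)
    {I : Fin k → ι} (hI : ¬ Function.Injective I) : geoGen X I = 1 := by
  simp only [Function.Injective, not_forall] at hI
  obtain ⟨a, b, hab, hne⟩ := hI
  have hkill : ∀ a : Fin k, pullback (insertPt X (kill {a})) (geoGen X (id : Fin k → Fin k)) = 1 :=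
    fun a => pullback_geoGen_eq_one ⟨a, kill_of_mem rfl⟩
  have hpull : pullback (insertPt X fun m => some (I m)) (geoGen X (id : Fin k → Fin k)) =
      geoGen X I := pullback_geoGen fun _ => rfl
  rw [← hpull]
  exact pullback_insertPt_eq_one D R hcat hne (hkill a) (hkill b) hab

/-- The subgroup of the classes that become trivial when the coordinate `i` is killed. -/
def killKer (k : ℕ) (X : Type u) [TopologicalSpace X] [BasePoint X] [CompactlyGeneratedSpace X]
    (i : ι) : Subgroup (HGroup (Power ι X) (Smash k X)) :=
  (gpullback (X := Smash k X) (insertPt X (kill {i}))).ker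

instance (i : ι) : (killKer k X i).Normal := MonoidHom.normal_ker _

theorem lift_geoGen_eq_one (D : NDR X) (R : JamesInverse (Smash k X)) (hcat : WeakCatLtTwo X)
    (hk : 1 ≤ k) {r : FreeGroup (Fin k → ι)} (hr : CohenRel ι k r) :
    FreeGroup.lift (fun I : Fin k → ι => R.unit (geoGen X I)) r = 1 :=
  hr.lift_eq_one (K := killKer k X) (g := fun I => R.unit (geoGen X I))
    (fun i _ ha _ hb => commute_of_kill_eq_one D R hcat i ha hb)
    (fun _ j => Units.ext (pullback_geoGen_eq_one ⟨j, kill_of_mem rfl⟩))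
    (fun _ hI => Units.ext (geoGen_eq_one D R hcat hI)) hk

/-- The homomorphism from the combinatorial group to the group of homotopy classes. -/
def realize (D : NDR X) (R : JamesInverse (Smash k X)) (hcat : WeakCatLtTwo X) (hk : 1 ≤ k)
    (ι : Type) : CohenGroup ι k →* HGroup (Power ι X) (Smash k X) :=
  PresentedGroup.toGroup (f := fun I : Fin k → ι => R.unit (geoGen X I)) fun _ hr =>
    lift_geoGen_eq_one D R hcat hk hr

variable (D : NDR X) (R : JamesInverse (Smash k X)) (hcat : WeakCatLtTwo X) (hk : 1 ≤ k)

theorem realize_cgen (I : Fin k → ι) : realize D R hcat hk ι (cgen I) = R.unit (geoGen X I) :=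
  PresentedGroup.toGroup.of _

theorem realize_rename (f : ι → Option κ) (a : CohenGroup ι k) :
    realize D R hcat hk κ (rename f a) = gpullback (insertPt X f) (realize D R hcat hk ι a) := by
  classical
  have hcomp : (realize D R hcat hk κ).comp (rename f) =
      (gpullback (insertPt X f)).comp (realize D R hcat hk ι) := by
    refine PresentedGroup.ext fun I => ?_
    change realize D R hcat hk κ (rename f (cgen I)) =
      gpullback (insertPt X f) (realize D R hcat hk ι (cgen I))
    have hrename : rename f (cgen I) = (renameGen f I : CohenGroup κ k) :=
      PresentedGroup.toGroup.of _
    rw [hrename, realize_cgen, renameGen]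
    split_ifs with h
    · rw [realize_cgen]
      exact Units.ext (pullback_geoGen fun j => by simp).symm
    · rw [map_one]
      push Not at h
      obtain ⟨j, hj⟩ := h
      exact Units.ext (pullback_geoGen_eq_one ⟨j, by simpa using hj⟩).symm
  exact DFunLike.congr_fun hcomp a

theorem realize_mem_KGeo (a : CohenGroup ι k) : realize D R hcat hk ι a ∈ KGeo ι k X := by
  have hle : Subgroup.closure (range (PresentedGroup.of (rels := {r | CohenRel ι k r}))) ≤
      (KGeo ι k X).comap (realize D R hcat hk ι) := by
    rw [Subgroup.closure_le]
    rintro _ ⟨I, rfl⟩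
    exact Subgroup.subset_closure ⟨I, congrArg Units.val (realize_cgen D R hcat hk I)⟩
  rw [PresentedGroup.closure_range_of] at hle
  exact hle (Subgroup.mem_top a)

end Realize

/-! ### The stages of the James filtration -/

section JamesFil

variable {n : ℕ} {Y : Type u} [BasePoint Y]

open Classical in
theorem reduceWord_comp {Y' : Type u} [BasePoint Y'] {P : Y → Y'} (hP : P pt = pt)
    (x : Fin n → Y) : reduceWord (P ∘ x) = ((reduceWord x).map P).filter fun a => a ≠ pt := by
  have hpt : ∀ a, P a ≠ pt → a ≠ pt := fun a h ha => h (ha ▸ hP)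
  rw [reduceWord, reduceWord, ← List.map_ofFn, List.filter_map, List.filter_map, List.filter_filter]
  refine congrArg (List.map P) (List.filter_congr fun a _ => ?_)
  simpa using hpt a

/-- The word `w`, as an element of the previous stage; the junk value on words of full length is the
base point. -/
def truncate (n : ℕ) (w : JamesFil (n + 1) Y) : JamesFil n Y :=
  if h : w.1.length ≤ n then ⟨w.1, w.2.1, h⟩ else pt

theorem truncate_eq {w : JamesFil (n + 1) Y} {w' : JamesFil n Y} (h : w'.1 = w.1) :
    truncate n w = w' :=
  (dif_pos (h ▸ w'.2.2)).trans (Subtype.ext h.symm)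

theorem JamesFil.eq_pt (w : JamesFil 0 Y) : w = pt :=
  Subtype.ext (List.length_eq_zero_iff.1 (Nat.le_zero.1 w.2.2))

variable (n Y) [TopologicalSpace Y]

/-- The inclusion of a stage of the James filtration into the James construction. -/
def jamesIncl : PMap (JamesFil n Y) (James Y) :=
  ⟨⟨fun a => ⟨a.1, a.2.1⟩, JamesFil.isQuotientMap_word.continuous_iff.2
    (James.continuous_word.comp (continuous_sigmaMk (σ := fun n => Power (Fin n) Y) (i := n)))⟩,
    rfl⟩

/-- The inclusion of a stage of the James filtration into the next one. -/
def jamesSucc : PMap (JamesFil n Y) (JamesFil (n + 1) Y) :=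
  ⟨⟨fun a => ⟨a.1, a.2.1, a.2.2.trans n.le_succ⟩, by
    refine JamesFil.isQuotientMap_word.continuous_iff.2 ?_
    refine Continuous.congr (f := fun x : Power (Fin n) Y =>
      JamesFil.word (KIfy.of (Fin.cons pt x.out : Fin (n + 1) → Y))) ?_ fun x =>
        Subtype.ext (reduceWord_succAbove (Fin.cons pt x.out : Fin (n + 1) → Y) 0 rfl)
    refine JamesFil.continuous_word.comp (Power.continuous_mk fun i => ?_)
    refine Fin.cases ?_ (fun i => ?_) i
    · simpa using continuous_const
    · simpa using Power.continuous_apply i⟩, rfl⟩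

end JamesFil

section QuotMap

variable {n l : ℕ}

/-- The projection of `X^{l(n+1)}` that forgets a block. -/
def forgetBlock (s : Fin (n + 1)) (p : Fin n × Fin l) : Option (Fin (n + 1) × Fin l) :=
  some (s.succAbove p.1, p.2)

theorem dropBlock_self (s : Fin (n + 1)) (j : Fin l) : dropBlock s (s, j) = none := by
  simp [dropBlock]

theorem dropBlock_succAbove (s : Fin (n + 1)) (t : Fin n) (j : Fin l) :
    dropBlock s (s.succAbove t, j) = some (t, j) := by
  unfold dropBlock
  rcases lt_or_ge t.castSucc s with hts | hst
  · rw [Fin.succAbove_of_castSucc_lt _ _ hts, dif_pos hts]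
    rfl
  · have hlt : s < t.succ := Fin.le_castSucc_iff.1 hst
    rw [Fin.succAbove_of_le_castSucc _ _ hst, dif_neg hlt.not_gt, dif_neg hlt.ne']
    rfl

theorem kill_block_eq (s : Fin (n + 1)) :
    (kill (block s) : Fin (n + 1) × Fin l → Option (Fin (n + 1) × Fin l)) =
      fun i => (dropBlock s i).bind (forgetBlock s) := by
  funext ⟨t, j⟩
  rcases Fin.eq_self_or_eq_succAbove s t with rfl | ⟨t, rfl⟩
  · rw [dropBlock_self]
    exact kill_of_mem rfl
  · rw [dropBlock_succAbove]
    exact if_neg (Fin.succAbove_ne s t)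

variable {X : Type u} [BasePoint X]

theorem exists_eq_pt_of_blockMap_eq_pt (hl : 1 ≤ l) {x : Power (Fin n × Fin l) X}
    (hx : ∃ s, (blockMap (Fin n) l X x).out s = pt) : ∃ p, x.out p = pt := by
  obtain ⟨s, hs⟩ := hx
  obtain ⟨j, hj⟩ := (Smash.mk_eq_pt_iff hl).1 hs
  exact ⟨(s, j), hj⟩

theorem eq_or_exists_eq_pt_of_blockMap_eq {ι : Type} {x x' : Power (ι × Fin l) X}
    (h : blockMap ι l X x = blockMap ι l X x') :
    x = x' ∨ (∃ p, x.out p = pt) ∧ ∃ p, x'.out p = pt := by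
  by_cases hx : ∀ s, (KIfy.of fun j => x.out (s, j) : Power (Fin l) X) =
      KIfy.of fun j => x'.out (s, j)
  · exact Or.inl (funext fun p => congrFun (hx p.1) p.2)
  · push Not at hx
    obtain ⟨s, hs⟩ := hx
    obtain ⟨⟨j, hj⟩, ⟨j', hj'⟩⟩ := (Smash.mk_eq_mk_iff.1 (congrFun h s)).resolve_left hs
    exact Or.inr ⟨⟨(s, j), hj⟩, ⟨(s, j'), hj'⟩⟩

variable [TopologicalSpace X]

theorem quotMap_val (x : Power (Fin n × Fin l) X) :
    ((quotMap n l X).1 x).1 = reduceWord (blockMap (Fin n) l X x).out := rfl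

theorem quotMap_forgetBlock {x : Power (Fin (n + 1) × Fin l) X} {p : Fin (n + 1) × Fin l}
    (hp : x.out p = pt) :
    ((quotMap n l X).1 ((insertPt X (forgetBlock p.1)).1 x)).1 =
      ((quotMap (n + 1) l X).1 x).1 := by
  rw [quotMap_val, quotMap_val, reduceWord_succAbove _ p.1 (Smash.mk_eq_pt ⟨p.2, hp⟩)]
  rfl

theorem quotMap_dropBlock (s : Fin (n + 1)) (y : Power (Fin n × Fin l) X) (hl : 1 ≤ l) :
    ((quotMap (n + 1) l X).1 ((insertPt X (dropBlock s)).1 y)).1 = ((quotMap n l X).1 y).1 := by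
  have hpt : ((insertPt X (dropBlock s)).1 y).out (s, ⟨0, hl⟩) = pt := by
    change (dropBlock s (s, _)).elim pt y.out = pt
    rw [dropBlock_self]
    rfl
  rw [← quotMap_forgetBlock hpt]
  congr 2
  funext ⟨t, j⟩
  change (dropBlock s (s.succAbove t, j)).elim pt y.out = y (t, j)
  rw [dropBlock_succAbove]
  rfl

theorem quotMap_kill (p : Fin n × Fin l) (x : Power (Fin n × Fin l) X) :
    (quotMap n l X).1 ((insertPt X (kill {p})).1 x) =
      (quotMap n l X).1 ((insertPt X (kill (block p.1))).1 x) := by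
  classical
  refine congrArg JamesFil.word (funext fun s => ?_)
  by_cases hs : s = p.1
  · subst hs
    refine (Smash.mk_eq_pt ⟨p.2, ?_⟩).trans (Smash.mk_eq_pt ⟨p.2, ?_⟩).symm
    · exact (insertPt_kill_apply {p} x p).trans (if_pos rfl)
    · exact (insertPt_kill_apply (block p.1) x p).trans (if_pos rfl)
  · refine congrArg Smash.mk (funext fun j => ?_)
    have hsj : (s, j) ∉ ({p} : Set (Fin n × Fin l)) := fun h => hs (congrArg Prod.fst h)
    refine (insertPt_kill_apply {p} x (s, j)).trans
      (Eq.trans ?_ (insertPt_kill_apply (block p.1) x (s, j)).symm)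
    rw [if_neg hsj, if_neg (show (s, j) ∉ block p.1 from hs)]

theorem eq_or_exists_eq_pt_of_quotMap_eq (hl : 1 ≤ l) {x x' : Power (Fin n × Fin l) X}
    (h : (quotMap n l X).1 x = (quotMap n l X).1 x') :
    x = x' ∨ (∃ p, x.out p = pt) ∧ ∃ p, x'.out p = pt := by
  have hword : reduceWord (blockMap (Fin n) l X x).out = reduceWord (blockMap (Fin n) l X x').out :=
    congrArg Subtype.val h
  have hiff : (∃ s, (blockMap (Fin n) l X x).out s = pt) ↔
      ∃ s, (blockMap (Fin n) l X x').out s = pt := by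
    rw [← length_reduceWord_lt_iff, ← length_reduceWord_lt_iff, hword]
  by_cases hx : ∃ s, (blockMap (Fin n) l X x).out s = pt
  · exact Or.inr ⟨exists_eq_pt_of_blockMap_eq_pt hl hx,
      exists_eq_pt_of_blockMap_eq_pt hl (hiff.1 hx)⟩
  · have hx' := mt hiff.2 hx
    push Not at hx hx'
    rw [reduceWord_eq_ofFn hx, reduceWord_eq_ofFn hx'] at hword
    exact eq_or_exists_eq_pt_of_blockMap_eq (List.ofFn_injective hword)

theorem quotMap_push_congr (D : NDR X) (hl : 1 ≤ l) {x x' : Power (Fin n × Fin l) X}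
    (h : (quotMap n l X).1 x = (quotMap n l X).1 x') (t : unitInterval) :
    (quotMap n l X).1 (D.push univ t x) = (quotMap n l X).1 (D.push univ t x') := by
  classical
  let P : Smash l X → Smash l X := Smash.lift (fun x => Smash.mk (D.push univ t x)) pt fun _ hx =>
    Smash.mk_eq_pt (hx.imp fun _ hi => D.push_apply_eq_pt _ _ hi)
  have hP : P pt = pt := Smash.mk_eq_pt ⟨⟨0, hl⟩, D.push_apply_eq_pt _ _ rfl⟩
  have hpush : ∀ x : Power (Fin n × Fin l) X, ((quotMap n l X).1 (D.push univ t x)).1 =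
      (((quotMap n l X).1 x).1.map P).filter fun a => a ≠ pt := fun x => by
    rw [quotMap_val x, ← reduceWord_comp hP]
    refine congrArg reduceWord (funext fun s => congrArg Smash.mk (funext fun j => ?_))
    exact ((D.push_apply univ t x (s, j)).trans (if_pos trivial)).trans
      ((D.push_apply univ t (KIfy.of fun j => x.out (s, j)) j).trans (if_pos trivial)).symm
  refine Subtype.ext ?_
  rw [hpush, hpush, h]

end QuotMap

/-! ### Injectivity of restriction along the quotient map -/

section Halo

variable {A Y Z : Type u} [TopologicalSpace A] [BasePoint A] [TopologicalSpace Y] [BasePoint Y]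
  [TopologicalSpace Z] [BasePoint Z]

/-- A halo of `A` in `Y`: a pointed deformation `h` of `Y` whose final stage factors through
`i : A → Y` on the neighbourhood `u < 1` of the zero set of `u`; the factorisation is `r`, whose
values outside this neighbourhood are irrelevant. -/
structure Halo (i : PMap A Y) where
  u : C(Y, unitInterval)
  h : C(unitInterval × Y, Y)
  r : Y → A
  h_zero (y : Y) : h (0, y) = y
  h_pt (t : unitInterval) : h (t, pt) = pt
  r_pt : r pt = pt
  continuousOn_r : ContinuousOn r {y | u y < 1}
  incl_r {y : Y} : u y < 1 → i.1 (r y) = h (1, y)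

namespace Halo

variable {i : PMap A Y} (N : Halo i) {f : PMap Y (James Z)}

/-- The time at which the null homotopy of `f ∘ i` is evaluated in the extended homotopy. -/
def time (t : unitInterval) (y : Y) : unitInterval :=
  projIcc 0 1 zero_le_one (t * (1 - 2 * (N.u y : ℝ)))

theorem continuous_time : Continuous fun p : unitInterval × Y => N.time p.1 p.2 :=
  continuous_projIcc.comp (by fun_prop)

theorem time_zero (y : Y) : N.time 0 y = 0 :=
  projIcc_of_le_left _ (by simp)

theorem time_one {y : Y} (hy : N.u y = 0) : N.time 1 y = 1 :=
  projIcc_of_right_le _ (by simp [hy])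

theorem time_of_half {y : Y} (t : unitInterval) (hy : (N.u y : ℝ) = 1 / 2) : N.time t y = 0 :=
  projIcc_of_le_left _ (by simp [hy])

/-- The extension to `Y` of a null homotopy of `f ∘ i`. -/
def extend (N : Halo i) (f : PMap Y (James Z)) (F : C(unitInterval × A, James Z))
    (p : unitInterval × Y) : James Z :=
  if (N.u p.2 : ℝ) ≤ 1 / 2 then F (N.time p.1 p.2, N.r p.2) else f.1 (N.h (1, p.2))

variable {F : C(unitInterval × A, James Z)} (hF : ∀ a, F (0, a) = f.1 (i.1 a))
include hF

theorem homotopy_zero_r {y : Y} (hy : N.u y < 1) : F (0, N.r y) = f.1 (N.h (1, y)) := by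
  rw [hF, N.incl_r hy]

theorem continuous_extend : Continuous (N.extend f F) := by
  have hlt : ∀ p : unitInterval × Y, (N.u p.2 : ℝ) ≤ 1 / 2 → N.u p.2 < 1 := fun p hp =>
    unitInterval.coe_lt_one.1 (by linarith)
  refine continuous_if_le (by fun_prop) continuous_const ?_ (by fun_prop) fun p hp => ?_
  · exact F.continuous.comp_continuousOn (N.continuous_time.continuousOn.prodMk
      (N.continuousOn_r.comp continuous_snd.continuousOn hlt))
  · rw [N.time_of_half _ hp, N.homotopy_zero_r hF (hlt p hp.le)]

theorem extend_zero (y : Y) : N.extend f F (0, y) = f.1 (N.h (1, y)) := by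
  rw [extend]
  split_ifs with hy
  · rw [N.time_zero, N.homotopy_zero_r hF (unitInterval.coe_lt_one.1 (by linarith))]
  · rfl

end Halo

theorem Halo.exists_representative [CompactlyGeneratedSpace A] {i : PMap A Y} (N : Halo i)
    {f : PMap Y (James Z)}
    (hf : PClass.mk (f.comp i) = 1) :
    ∃ g : PMap Y (James Z), PClass.mk g = PClass.mk f ∧ ∀ y, N.u y = 0 → g.1 y = 1 := by
  obtain ⟨F⟩ := PClass.mk_eq_mk_iff.1 (hf.trans PClass.one_def)
  have hF : ∀ a, F (0, a) = f.1 (i.1 a) := F.apply_zero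
  have hK : Continuous (N.extend f F.toContinuousMap) := N.continuous_extend hF
  have hKpt : ∀ t, N.extend f F.toContinuousMap (t, pt) = 1 := fun t => by
    rw [extend]
    split_ifs
    · rw [N.r_pt]
      exact (F.eq_fst _ rfl).trans (f.comp i).2
    · rw [N.h_pt]
      exact f.2
  refine ⟨⟨⟨fun y => N.extend f F.toContinuousMap (1, y), by fun_prop⟩, hKpt 1⟩, ?_,
    fun y hy => ?_⟩
  · refine Eq.trans (b := PClass.mk (f.comp ⟨⟨fun y => N.h (1, y), by fun_prop⟩, N.h_pt 1⟩))
      (PClass.mk_eq_of_homotopy _ hK (N.extend_zero hF) (fun _ => rfl) hKpt).symm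
      (PClass.mk_eq_of_homotopy (fun p => f.1 (N.h p)) (by fun_prop)
        (fun y => congrArg f.1 (N.h_zero y)) (fun _ => rfl) fun t => ?_).symm
    rw [N.h_pt]
    exact f.2
  · change N.extend f F.toContinuousMap (1, y) = 1
    rw [extend, if_pos (by simp [hy]), N.time_one hy]
    exact F.apply_one _

end Halo

section Descent

variable {A Y B T : Type*} [TopologicalSpace A] [TopologicalSpace Y] [TopologicalSpace B]
  [TopologicalSpace T] [LocallyCompactSpace T]

theorem exists_prod_lift {q : A → Y} (hq : IsQuotientMap q) {H : T × A → B} (hH : Continuous H)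
    (h : ∀ t x x', q x = q x' → H (t, x) = H (t, x')) :
    ∃ G : C(T × Y, B), ∀ t x, G (t, q x) = H (t, x) := by
  have hinv : ∀ t x, H (t, Function.surjInv hq.surjective (q x)) = H (t, x) := fun t x =>
    h t _ _ (Function.surjInv_eq hq.surjective _)
  exact ⟨⟨fun p => H (p.1, Function.surjInv hq.surjective p.2),
    hq.continuous_lift_prod_right (hH.congr fun p => (hinv p.1 p.2).symm)⟩, hinv⟩

end Descent

section Injectivity

variable {X Z : Type u} [TopologicalSpace X] [BasePoint X] [TopologicalSpace Z] [BasePoint Z]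

theorem homotopicRel_of_homotopic [CompactlyGeneratedSpace X] (D : NDR X) (R : JamesInverse Z)
    {ι : Type}
    {f : C(Power ι X, James Z)} (hf : ∀ i, TrivialAt i f)
    (hn : f.Homotopic (ContinuousMap.const _ 1)) (S : Finset ι) :
    f.HomotopicRel (ContinuousMap.const _ 1) {x | ∃ i ∈ S, x.out i = pt} := by
  classical
  induction S using Finset.induction_on with
  | empty =>
    obtain ⟨H⟩ := hn
    exact ⟨⟨H, by rintro t x ⟨i, hi, -⟩; simp at hi⟩⟩
  | insert i S hi ih =>
    obtain ⟨H⟩ := ih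
    let f' : C(Power ι X, James Z) :=
      ⟨fun x => f (D.push {i} 1 x), f.continuous.comp
        (D.continuous_push _ continuous_const continuous_id)⟩
    refine ContinuousMap.HomotopicRel.trans (g := f') ⟨⟨⟨⟨fun p => f (D.push {i} p.1 p.2),
      f.continuous.comp (D.continuous_push _ continuous_fst continuous_snd)⟩, fun x => ?_,
      fun x => rfl⟩, ?_⟩⟩ ⟨⟨⟨⟨fun p => strictify D R 1 i (fun x => H (p.1, x)) p.2,
      continuous_strictify continuous_const (fun _ hy => H.continuous.comp
        (continuous_fst.prodMk hy)) continuous_snd⟩, fun x => ?_, fun x => ?_⟩, ?_⟩⟩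
    · change f (D.push {i} 0 x) = f x
      rw [D.push_zero]
    · rintro t x ⟨j, -, hj⟩
      exact (hf j (D.push_apply_eq_pt _ _ hj)).trans (hf j hj).symm
    · change strictify D R 1 i (fun x => H (0, x)) x = f (D.push {i} 1 x)
      simp only [H.apply_zero]
      exact (hf i).strictify_eq x
    · change strictify D R 1 i (fun x => H (1, x)) x = 1
      exact strictify_eq_one (H.apply_one _) (H.apply_one _)
    · rintro t x ⟨j, hjS, hj⟩
      change strictify D R 1 i (fun x => H (t, x)) x = _
      refine Eq.trans ?_ (hf j (D.push_apply_eq_pt _ _ hj)).symm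
      rcases Finset.mem_insert.1 hjS with rfl | hjS
      · exact trivialAt_strictify_one _ _ hj
      · exact TrivialAt.strictify (fun y hy => (H.eq_fst t ⟨j, hjS, hy⟩).trans (hf j hy)) hj

variable {n l : ℕ}

theorem truncate_quotMap_push (D : NDR X) {x : Power (Fin (n + 1) × Fin l) X}
    {p : Fin (n + 1) × Fin l} (hp : D.v (x.out p) < 1) :
    truncate n ((quotMap (n + 1) l X).1 (D.push univ 1 x)) =
      (quotMap n l X).1 ((insertPt X (forgetBlock p.1)).1 (D.push univ 1 x)) :=
  truncate_eq (quotMap_forgetBlock (D.push_one_apply_eq_pt (mem_univ p) hp))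

theorem jamesSucc_truncate_quotMap_push (D : NDR X) {x : Power (Fin (n + 1) × Fin l) X}
    (hx : D.weight x < 1) :
    (jamesSucc n (Smash l X)).1 (truncate n ((quotMap (n + 1) l X).1 (D.push univ 1 x))) =
      (quotMap (n + 1) l X).1 (D.push univ 1 x) := by
  obtain ⟨p, hp⟩ := D.exists_v_lt_one hx
  rw [truncate_quotMap_push D hp]
  exact Subtype.ext (quotMap_forgetBlock (D.push_one_apply_eq_pt (mem_univ p) hp))

theorem continuousOn_truncate_quotMap_push (D : NDR X) :
    ContinuousOn (fun x : Power (Fin (n + 1) × Fin l) X =>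
      truncate n ((quotMap (n + 1) l X).1 (D.push univ 1 x))) {x | D.weight x < 1} := by
  intro x hx
  obtain ⟨p, hp⟩ := D.exists_v_lt_one hx
  have hlocal : (fun x : Power (Fin (n + 1) × Fin l) X =>
      (quotMap n l X).1 ((insertPt X (forgetBlock p.1)).1 (D.push univ 1 x))) =ᶠ[𝓝 x]
        fun x => truncate n ((quotMap (n + 1) l X).1 (D.push univ 1 x)) := by
    filter_upwards [(D.v.continuous.comp (Power.continuous_apply p)).continuousAt.eventually_lt
      continuousAt_const hp] with y hy using (truncate_quotMap_push D hy).symm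
  refine ContinuousAt.continuousWithinAt (ContinuousAt.congr (Continuous.continuousAt ?_) hlocal)
  exact (quotMap n l X).1.continuous.comp ((insertPt X (forgetBlock p.1)).1.continuous.comp
    (D.continuous_push _ continuous_const continuous_id))

theorem exists_halo_jamesSucc (D : NDR X) (n : ℕ) (hl : 1 ≤ l) :
    ∃ N : Halo (jamesSucc n (Smash l X)),
      ∀ x, N.u ((quotMap (n + 1) l X).1 x) = D.weight x := by
  have hq := isQuotientMap_quotMap l X (n + 1)
  have hqpt : (quotMap (n + 1) l X).1 pt = pt := (quotMap (n + 1) l X).2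
  have hweight : ∀ x x', (quotMap (n + 1) l X).1 x = (quotMap (n + 1) l X).1 x' →
      D.weight x = D.weight x' := fun x x' hxx => by
    rcases eq_or_exists_eq_pt_of_quotMap_eq hl hxx with rfl | ⟨hx, hx'⟩
    · rfl
    · rw [D.weight_eq_zero_iff.2 hx, D.weight_eq_zero_iff.2 hx']
  let u : C(JamesFil (n + 1) (Smash l X), unitInterval) := hq.lift D.weight hweight
  have hu : ∀ x, u ((quotMap (n + 1) l X).1 x) = D.weight x :=
    DFunLike.congr_fun (hq.lift_comp D.weight hweight)
  obtain ⟨h, hh⟩ := exists_prod_lift (T := unitInterval) hq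
    ((quotMap (n + 1) l X).1.continuous.comp
      (D.continuous_push univ continuous_fst continuous_snd))
    fun t x x' hxx => quotMap_push_congr D hl hxx t
  refine ⟨⟨u, h, fun y => truncate n (h (1, y)), fun y => ?_, fun t => ?_, ?_, ?_,
    fun {y} hy => ?_⟩, hu⟩
  · obtain ⟨x, rfl⟩ := hq.surjective y
    rw [hh]
    exact congrArg _ (D.push_zero univ x)
  · rw [← hqpt, hh]
    exact congrArg _ (D.push_pt univ t)
  · rw [← hqpt, hh]
    exact truncate_eq
      (congrArg Subtype.val ((congrArg _ (D.push_pt univ 1)).trans hqpt)).symm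
  · rw [hq.continuousOn_isOpen_iff (isOpen_lt (by fun_prop) continuous_const)]
    simpa [Function.comp_def, hh, hu, preimage] using continuousOn_truncate_quotMap_push D
  · obtain ⟨x, rfl⟩ := hq.surjective y
    rw [hh]
    exact jamesSucc_truncate_quotMap_push D (hu x ▸ hy)

variable [CompactlyGeneratedSpace X]

theorem eq_one_of_homotopic_quotMap (D : NDR X) (R : JamesInverse Z) (hl : 1 ≤ l)
    {g : PMap (JamesFil (n + 1) (Smash l X)) (James Z)}
    (hg : ∀ p, TrivialAt p (g.1 ∘ (quotMap (n + 1) l X).1))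
    (hn : pullback (quotMap (n + 1) l X) (PClass.mk g) = 1) : PClass.mk g = 1 := by
  have hq := isQuotientMap_quotMap l X (n + 1)
  obtain ⟨H⟩ := homotopicRel_of_homotopic D R (f := (g.comp (quotMap (n + 1) l X)).1) hg
    (PClass.mk_eq_mk_iff.1 (hn.trans PClass.one_def)).homotopic Finset.univ
  have hH : ∀ t (x : Power (Fin (n + 1) × Fin l) X), (∃ p, x.out p = pt) → H (t, x) = 1 := by
    rintro t x ⟨p, hp⟩
    exact (H.eq_fst t ⟨p, Finset.mem_univ p, hp⟩).trans (hg p hp)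
  obtain ⟨G, hG⟩ := exists_prod_lift hq H.continuous fun t x x' hxx => by
    rcases eq_or_exists_eq_pt_of_quotMap_eq hl hxx with rfl | ⟨hx, hx'⟩
    · rfl
    · exact (hH t x hx).trans (hH t x' hx').symm
  refine PClass.mk_eq_of_homotopy G G.continuous (fun z => ?_) (fun z => ?_) fun t => ?_
  · obtain ⟨x, rfl⟩ := hq.surjective z
    exact (hG 0 x).trans (H.apply_zero x)
  · obtain ⟨x, rfl⟩ := hq.surjective z
    exact (hG 1 x).trans (H.apply_one x)
  · rw [← (quotMap (n + 1) l X).2, hG]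
    exact hH t _ ⟨(0, ⟨0, hl⟩), rfl⟩

theorem eq_one_of_pullback_quotMap (D : NDR X) (R : JamesInverse Z) (hl : 1 ≤ l) (n : ℕ)
    (a : PClass (JamesFil n (Smash l X)) (James Z)) (ha : pullback (quotMap n l X) a = 1) :
    a = 1 := by
  induction n with
  | zero =>
    obtain ⟨f, rfl⟩ := a.exists_mk
    exact congrArg PClass.mk (PMap.ext fun z => z.eq_pt ▸ f.2)
  | succ n ih =>
    obtain ⟨f, rfl⟩ := a.exists_mk
    have hcomp : (quotMap (n + 1) l X).comp (insertPt X (dropBlock 0)) =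
        (jamesSucc n (Smash l X)).comp (quotMap n l X) :=
      PMap.ext fun y => Subtype.ext (quotMap_dropBlock 0 y hl)
    have hsucc : pullback (quotMap n l X) (PClass.mk (f.comp (jamesSucc n (Smash l X)))) = 1 := by
      rw [← pullback_mk, pullback_pullback, ← hcomp, ← pullback_pullback, ha, map_one]
    obtain ⟨N, hN⟩ := exists_halo_jamesSucc D n hl
    obtain ⟨g, hgf, hg⟩ := N.exists_representative (ih _ hsucc)
    rw [← hgf] at ha ⊢
    exact eq_one_of_homotopic_quotMap D R hl
      (fun p x hx => hg _ ((hN x).trans (D.weight_eq_zero_iff.2 ⟨p, hx⟩))) ha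

theorem gpullback_quotMap_injective (D : NDR X) (R : JamesInverse Z) (hl : 1 ≤ l) (n : ℕ) :
    Function.Injective (gpullback (X := Z) (quotMap n l X)) :=
  (injective_iff_map_eq_one _).2 fun a ha =>
    Units.ext (eq_one_of_pullback_quotMap D R hl n a.1 (congrArg Units.val ha))

end Injectivity

/-! ### Extension of maps along the James filtration -/

section HopfProd

variable {Y M : Type*} [Monoid M]

theorem prod_sublistsLen_filter (p : Y → Prop) [DecidablePred p] (L : List Y) (m : ℕ)
    (g : List Y → M) (hg : ∀ w, (∃ a ∈ w, ¬ p a) → g w = 1) :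
    (((L.filter p).sublistsLen m).map g).prod = ((L.sublistsLen m).map g).prod := by
  induction L generalizing m g with
  | nil => rfl
  | cons a L ih =>
    cases m with
    | zero => simp
    | succ m =>
      by_cases ha : p a
      · have hcons := ih m (g ∘ List.cons a) fun w ⟨b, hb, hpb⟩ =>
          hg _ ⟨b, List.mem_cons_of_mem _ hb, hpb⟩
        rw [List.filter_cons_of_pos (by simpa using ha), List.sublistsLen_succ_cons,
          List.sublistsLen_succ_cons, List.map_append, List.prod_append, List.map_append,
          List.prod_append, ih _ g hg, List.map_map, List.map_map, hcons]
      · have hcons : ((L.sublistsLen m).map (g ∘ List.cons a)).prod = 1 :=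
          List.prod_eq_one fun x hx => by
            obtain ⟨w, -, rfl⟩ := List.mem_map.1 hx
            exact hg _ ⟨a, List.mem_cons_self, ha⟩
        rw [List.filter_cons_of_neg (by simpa using ha), ih _ g hg, List.sublistsLen_succ_cons,
          List.map_append, List.prod_append, List.map_map, hcons, mul_one]

theorem sublistsLen_map {α β : Type*} (f : α → β) (m : ℕ) (L : List α) :
    (L.map f).sublistsLen m = (L.sublistsLen m).map (List.map f) := by
  induction L generalizing m with
  | nil => cases m <;> simp
  | cons a L ih =>
    cases m with
    | zero => simp
    | succ m => simp [List.sublistsLen_succ_cons, ih, Function.comp_def]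

end HopfProd

section Extension

variable {Y Z : Type u} [BasePoint Z] {m : ℕ}

/-- The function `f` on words of length `m`; the value on other words is `1`. -/
def onWords (f : Power (Fin m) Y → James Z) (w : List Y) : James Z :=
  if h : w.length = m then f (KIfy.of fun i => w.get (i.cast h.symm)) else 1

/-- The combinatorial extension of `f : Y^m → J(Z)` over all words, as in the definition of the
James–Hopf maps: the ordered product of the values of `f` on the subwords of length `m`. -/
def hopfProd (f : Power (Fin m) Y → James Z) (w : List Y) : James Z :=
  ((w.sublistsLen m).map (onWords f)).prod

theorem onWords_ofFn (f : Power (Fin m) Y → James Z) (y : Power (Fin m) Y) :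
    onWords f (List.ofFn y.out) = f y := by
  refine (dif_pos List.length_ofFn).trans (congrArg f (funext fun i => ?_))
  change (List.ofFn y.out).get _ = y i
  rw [List.get_ofFn]
  rfl

theorem hopfProd_ofFn (f : Power (Fin m) Y → James Z) (y : Power (Fin m) Y) :
    hopfProd f (List.ofFn y.out) = f y := by
  have hsub : (List.ofFn y.out).sublistsLen m = [List.ofFn y.out] := by
    simpa only [List.length_ofFn] using List.sublistsLen_length (List.ofFn y.out)
  rw [hopfProd, hsub, List.map_singleton, List.prod_singleton, onWords_ofFn]

theorem onWords_eq_one [BasePoint Y] {f : Power (Fin m) Y → James Z} (hf : ∀ i, TrivialAt i f)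
    {w : List Y} (hw : pt ∈ w) : onWords f w = 1 := by
  rw [onWords]
  split_ifs with h
  · obtain ⟨i, hi⟩ := List.get_of_mem hw
    exact hf (i.cast h) hi
  · rfl

theorem hopfProd_reduceWord [BasePoint Y] {f : Power (Fin m) Y → James Z}
    (hf : ∀ i, TrivialAt i f) {N : ℕ} (x : Fin N → Y) :
    hopfProd f (reduceWord x) = hopfProd f (List.ofFn x) := by
  classical
  refine Eq.trans ?_ (prod_sublistsLen_filter (fun a => a ≠ pt) _ m _ fun w hw => ?_)
  · simp only [hopfProd, reduceWord]
  · exact onWords_eq_one hf (by simpa using hw)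

variable [TopologicalSpace Z] [TopologicalSpace Y]

theorem continuous_onWords_map {f : Power (Fin m) Y → James Z} (hf : Continuous f) {N : ℕ}
    (w : List (Fin N)) : Continuous fun x : Power (Fin N) Y => onWords f (w.map x.out) := by
  by_cases h : w.length = m
  · simp only [onWords, List.length_map, h, dite_true]
    refine hf.comp (Power.continuous_mk fun i => ?_)
    simpa using Power.continuous_apply (X := Y) (w.get (i.cast h.symm))
  · simpa only [onWords, List.length_map, h, dite_false] using continuous_const

theorem James.continuous_list_prod {β : Type*} {A : Type u} [TopologicalSpace A]
    [CompactlyGeneratedSpace A] {F : β → A → James Z} (hF : ∀ b, Continuous (F b)) (L : List β) :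
    Continuous fun a => (L.map fun b => F b a).prod := by
  induction L with
  | nil => exact continuous_const
  | cons b L ih =>
    simp only [List.map_cons, List.prod_cons]
    exact James.continuous_mul (hF b) ih

theorem continuous_hopfProd_ofFn [CompactlyGeneratedSpace Y] {f : Power (Fin m) Y → James Z}
    (hf : Continuous f) (N : ℕ) :
    Continuous fun x : Power (Fin N) Y => hopfProd f (List.ofFn x.out) := by
  refine (James.continuous_list_prod (continuous_onWords_map hf)
    ((List.finRange N).sublistsLen m)).congr fun x => ?_
  rw [hopfProd, List.ofFn_eq_map, sublistsLen_map, List.map_map]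
  rfl

theorem James.exists_extension [BasePoint Y] [CompactlyGeneratedSpace Y] (hm : m ≠ 0)
    (f : C(Power (Fin m) Y, James Z)) (hf : ∀ i, TrivialAt i f) :
    ∃ Γ : PMap (James Y) (James Z), ∀ y, Γ.1 (James.word ⟨m, y⟩) = f y := by
  refine ⟨⟨⟨fun w => hopfProd f w.1, James.isQuotientMap_word.continuous_iff.2
    (continuous_sigma fun N => ?_)⟩, ?_⟩, fun y => ?_⟩
  · exact (continuous_hopfProd_ofFn f.continuous N).congr fun x => (hopfProd_reduceWord hf _).symm
  · obtain ⟨m, rfl⟩ := Nat.exists_eq_succ_of_ne_zero hm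
    rfl
  · exact (hopfProd_reduceWord hf y.out).trans (hopfProd_ofFn f y)

end Extension

/-! ### Descent to the James filtration -/

section Surjectivity

variable {X Z : Type u} [TopologicalSpace X] [BasePoint X] [TopologicalSpace Z] [BasePoint Z]
  {n m l : ℕ}

/-- The composite `X^{ln} → J_n(X^{(l)}) → J(X^{(l)})`. -/
def jamesQuot (n l : ℕ) (X : Type u) [TopologicalSpace X] [BasePoint X] :
    PMap (Power (Fin n × Fin l) X) (James (Smash l X)) :=
  (jamesIncl n (Smash l X)).comp (quotMap n l X)

theorem jamesQuot_comp_dropBlock (hl : 1 ≤ l) (s : Fin (n + 1)) :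
    (jamesQuot (n + 1) l X).comp (insertPt X (dropBlock s)) = jamesQuot n l X :=
  PMap.ext fun y => Subtype.ext (quotMap_dropBlock s y hl)

theorem jamesQuot_comp_kill (p : Fin n × Fin l) :
    (jamesQuot n l X).comp (insertPt X (kill {p})) =
      (jamesQuot n l X).comp (insertPt X (kill (block p.1))) :=
  PMap.ext fun y => congrArg (jamesIncl n (Smash l X)).1 (quotMap_kill p y)

theorem dropBlock_zero_succ (t : Fin n) (j : Fin l) : dropBlock 0 (t.succ, j) = some (t, j) :=
  dropBlock_succAbove 0 t j

theorem dropBlock_zero_bind_dropBlock (s : Fin (n + 1)) (i : Fin (n + 2) × Fin l) :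
    (dropBlock 0 i).bind (dropBlock s) =
      (dropBlock s.succ i).bind (dropBlock (0 : Fin (n + 1))) := by
  obtain ⟨t, j⟩ := i
  cases t using Fin.cases with
  | zero =>
    have hzero : dropBlock s.succ ((0 : Fin (n + 2)), j) = some ((0 : Fin (n + 1)), j) := by
      simpa only [Fin.succ_succAbove_zero] using dropBlock_succAbove s.succ 0 j
    rw [dropBlock_self, hzero]
    exact (dropBlock_self 0 j).symm
  | succ t =>
    rw [dropBlock_zero_succ]
    rcases Fin.eq_self_or_eq_succAbove s t with rfl | ⟨t, rfl⟩
    · rw [dropBlock_self]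
      exact dropBlock_self t j
    · rw [← Fin.succ_succAbove_succ, dropBlock_succAbove]
      exact (dropBlock_succAbove s t j).trans (dropBlock_zero_succ t j).symm

theorem dropBlock_zero_bind_kill {T : Set (Fin (n + 1) × Fin l)} {T' : Set (Fin n × Fin l)}
    (hT : ∀ p : Fin n × Fin l, (p.1.succ, p.2) ∈ T ↔ p ∈ T') (i : Fin (n + 1) × Fin l) :
    (dropBlock 0 i).bind (kill T') = (kill T i).bind (dropBlock 0) := by
  classical
  obtain ⟨t, j⟩ := i
  cases t using Fin.cases with
  | zero =>
    rw [dropBlock_self, kill]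
    split_ifs
    · rfl
    · exact (dropBlock_self 0 j).symm
  | succ t =>
    rw [dropBlock_zero_succ]
    by_cases hT' : (t, j) ∈ T'
    · rw [kill_of_mem ((hT (t, j)).2 hT')]
      exact kill_of_mem hT'
    · rw [kill, if_neg (mt (hT (t, j)).1 hT')]
      exact (if_neg hT').trans (dropBlock_zero_succ t j).symm

theorem gpullback_insertPt_comm {ι κ κ' μ : Type} {f : ι → Option κ} {g : κ → Option μ}
    {f' : ι → Option κ'} {g' : κ' → Option μ} (h : ∀ i, (f i).bind g = (f' i).bind g')
    (a : HGroup (Power ι X) Z) :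
    gpullback (insertPt X g) (gpullback (insertPt X f) a) =
      gpullback (insertPt X g') (gpullback (insertPt X f') a) := by
  rw [gpullback_insertPt_insertPt, gpullback_insertPt_insertPt, funext h]

/-- The conditions that `HGeo` imposes on the restriction of a class to `X^{ln}`, apart from
membership in `KGeo`. -/
def Compatible (a : HGroup (Power (Fin n × Fin l) X) Z) : Prop :=
  (∀ p, gpullback (insertPt X (kill {p})) a = gpullback (insertPt X (kill (block p.1))) a) ∧
    ∀ s t : Fin n, gpullback (insertPt X (dropBlock s)) a = gpullback (insertPt X (dropBlock t)) a

theorem Compatible.dropBlock_zero {a : HGroup (Power (Fin (n + 1) × Fin l) X) Z}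
    (ha : Compatible a) :
    Compatible (n := n) (gpullback (insertPt X (dropBlock (0 : Fin (n + 1)))) a) := by
  refine ⟨fun p => ?_, fun s t => ?_⟩
  · refine (gpullback_insertPt_comm (dropBlock_zero_bind_kill (T := {(p.1.succ, p.2)})
      fun q => ?_) a).trans ((congrArg (gpullback (insertPt X (dropBlock (0 : Fin (n + 1)))))
      (ha.1 (p.1.succ, p.2))).trans (gpullback_insertPt_comm
        (dropBlock_zero_bind_kill fun q => ?_) a).symm)
    · simp [Prod.ext_iff]
    · simp [block]
  · cases n with
    | zero => exact s.elim0
    | succ n =>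
      rw [gpullback_insertPt_comm (dropBlock_zero_bind_dropBlock s), ha.2 s.succ t.succ]
      exact (gpullback_insertPt_comm (dropBlock_zero_bind_dropBlock t) a).symm

variable [CompactlyGeneratedSpace X]

theorem exists_gpullback_jamesQuot_of_kill_eq_one (D : NDR X) (R : JamesInverse Z)
    (hl : 1 ≤ l) (hm : m ≠ 0) (a : HGroup (Power (Fin m × Fin l) X) Z)
    (ha : ∀ p, gpullback (insertPt X (kill {p})) a = 1) :
    ∃ b : HGroup (James (Smash l X)) Z, gpullback (jamesQuot m l X) b = a := by
  obtain ⟨f, hfa, hf⟩ := exists_trivialAt_representative D R Finset.univ a.1 fun p _ =>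
    congrArg Units.val (ha p)
  let β : C(Power (Fin m × Fin l) X, Power (Fin m) (Smash l X)) :=
    ⟨blockMap (Fin m) l X, (isQuotientMap_blockMap (Fin m) l X).continuous⟩
  have hquot : IsQuotientMap β := isQuotientMap_blockMap (Fin m) l X
  have hfactors : Function.FactorsThrough f.1 β := fun x x' hx => by
    rcases eq_or_exists_eq_pt_of_blockMap_eq hx with rfl | ⟨⟨p, hp⟩, ⟨p', hp'⟩⟩
    · rfl
    · exact (hf p (Finset.mem_univ _) hp).trans (hf p' (Finset.mem_univ _) hp').symm
  have hlift : ∀ x, hquot.lift f.1 hfactors (β x) = f.1 x :=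
    DFunLike.congr_fun (hquot.lift_comp f.1 hfactors)
  obtain ⟨Γ, hΓ⟩ := James.exists_extension hm (hquot.lift f.1 hfactors) fun s y hs => by
    obtain ⟨x, rfl⟩ := hquot.surjective y
    obtain ⟨j, hj⟩ := (Smash.mk_eq_pt_iff hl).1 hs
    exact (hlift x).trans (hf (s, j) (Finset.mem_univ _) hj)
  exact ⟨R.unit (PClass.mk Γ), Units.ext <|
    (congrArg PClass.mk (PMap.ext fun x => (hΓ _).trans (hlift x))).trans hfa⟩

-- Dropping a block gives a class that extends to `J(X^{(l)})` by induction; what remains after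
-- dividing by this extension is trivial on the fat wedge.
theorem exists_gpullback_jamesQuot (D : NDR X) (R : JamesInverse Z) (hl : 1 ≤ l)
    {a : HGroup (Power (Fin n × Fin l) X) Z} (ha : Compatible a) :
    ∃ b : HGroup (James (Smash l X)) Z, gpullback (jamesQuot n l X) b = a := by
  induction n with
  | zero =>
    refine ⟨1, (map_one _).trans (Units.ext ?_)⟩
    obtain ⟨f, hf⟩ := a.1.exists_mk
    have hpt : ∀ x : Power (Fin 0 × Fin l) X, x = pt := fun x => funext fun p => p.1.elim0
    rw [← hf]
    exact congrArg PClass.mk (PMap.ext fun x => by rw [hpt x]; exact f.2.symm)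
  | succ n ih =>
    obtain ⟨b, hb⟩ := ih ha.dropBlock_zero
    let d := a * (gpullback (jamesQuot (n + 1) l X) b)⁻¹
    have hdrop (s : Fin (n + 1)) : gpullback (insertPt X (dropBlock s)) d =
        (1 : HGroup (Power (Fin n × Fin l) X) Z) := by
      have hpull : gpullback (insertPt X (dropBlock s)) (gpullback (jamesQuot (n + 1) l X) b) =
          gpullback (jamesQuot n l X) b := by
        rw [gpullback_gpullback, jamesQuot_comp_dropBlock hl]
      rw [map_mul, map_inv, hpull, hb]
      exact mul_inv_eq_one.2 (ha.2 s 0)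
    have hkill (p : Fin (n + 1) × Fin l) : gpullback (insertPt X (kill {p})) d = 1 := by
      have hblock : gpullback (insertPt X (kill {p})) d =
          gpullback (insertPt X (kill (block p.1))) d := by
        rw [map_mul, map_mul, ha.1 p, map_inv, map_inv, gpullback_gpullback, gpullback_gpullback,
          jamesQuot_comp_kill]
      rw [hblock, kill_block_eq, ← insertPt_comp, ← gpullback_gpullback]
      exact (congrArg _ (hdrop p.1)).trans (map_one _)
    obtain ⟨c, hc⟩ := exists_gpullback_jamesQuot_of_kill_eq_one D R hl n.succ_ne_zero d hkill
    exact ⟨c * b, by rw [map_mul, hc]; exact inv_mul_cancel_right _ _⟩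

theorem exists_gpullback_quotMap (D : NDR X) (R : JamesInverse Z) (hl : 1 ≤ l)
    {a : HGroup (Power (Fin n × Fin l) X) Z} (ha : Compatible a) :
    ∃ b : HGroup (JamesFil n (Smash l X)) Z, gpullback (quotMap n l X) b = a := by
  obtain ⟨b, hb⟩ := exists_gpullback_jamesQuot D R hl ha
  exact ⟨gpullback (jamesIncl n (Smash l X)) b, (gpullback_gpullback _ _ b).trans hb⟩

end Surjectivity

section RealizeH

variable {n l k : ℕ} {X : Type u} [TopologicalSpace X] [BasePoint X]

theorem mem_HComb_iff {a : CohenGroup (Fin n × Fin l) k} :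
    a ∈ HComb n l k ↔ (∀ p, rename (kill {p}) a = rename (kill (block p.1)) a) ∧
      ∀ s t : Fin n, rename (dropBlock s) a = rename (dropBlock t) a := by
  simp only [HComb, Subgroup.mem_inf, Subgroup.mem_iInf]
  rfl

theorem mem_HGeo_iff {b : HGroup (JamesFil n (Smash l X)) (Smash k X)} :
    b ∈ HGeo k n l X ↔ gpullback (quotMap n l X) b ∈ KGeo (Fin n × Fin l) k X ∧
      Compatible (gpullback (quotMap n l X) b) := by
  simp only [HGeo, Compatible, Subgroup.mem_comap, Subgroup.mem_inf, Subgroup.mem_iInf, and_assoc]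
  rfl

variable [CompactlyGeneratedSpace X]
  (D : NDR X) (R : JamesInverse (Smash k X)) (hcat : WeakCatLtTwo X) (hk : 1 ≤ k)

theorem compatible_realize {a : CohenGroup (Fin n × Fin l) k} (ha : a ∈ HComb n l k) :
    Compatible (realize D R hcat hk (Fin n × Fin l) a) := by
  obtain ⟨hkill, hdrop⟩ := mem_HComb_iff.1 ha
  exact ⟨fun p => by rw [← realize_rename, ← realize_rename, hkill p],
    fun s t => by rw [← realize_rename, ← realize_rename, hdrop s t]⟩

/-- The homomorphism `e_X : H_n^{(l)(k)} → [J_n(X^{(l)}), J(X^{(k)})]`, obtained by inverting the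
monomorphism `q^*` on its range. -/
def realizeH (hl : 1 ≤ l) : HComb n l k →* HGroup (JamesFil n (Smash l X)) (Smash k X) :=
  (MonoidHom.ofInjective (gpullback_quotMap_injective D R hl n)).symm.toMonoidHom.comp
    (((realize D R hcat hk (Fin n × Fin l)).comp (HComb n l k).subtype).codRestrict _ fun a =>
      MonoidHom.mem_range.2
        (exists_gpullback_quotMap D R hl (compatible_realize D R hcat hk a.2)))

theorem gpullback_realizeH (hl : 1 ≤ l) (a : HComb n l k) :
    gpullback (quotMap n l X) (realizeH D R hcat hk hl a) =
      realize D R hcat hk (Fin n × Fin l) a :=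
  MonoidHom.apply_ofInjective_symm (gpullback_quotMap_injective D R hl n) _

theorem realizeH_mem_HGeo (hl : 1 ≤ l) (a : HComb n l k) :
    realizeH D R hcat hk hl a ∈ HGeo k n l X := by
  rw [mem_HGeo_iff, gpullback_realizeH]
  exact ⟨realize_mem_KGeo D R hcat hk a.1, compatible_realize D R hcat hk a.2⟩

end RealizeH

end

end GeoReal

open GeoReal in
theorem proposition2p14 {X : Type u} [TopologicalSpace X] [CompactlyGeneratedSpace X]
    [BasePoint X] [PathConnectedSpace X] (hX : NondegenerateBasePoint X)
    (hcat : WeakCatLtTwo X) (n l k : ℕ) (hl : 1 ≤ l) (hk : 1 ≤ k) :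
    (∀ a : PClass (Power (Fin n × Fin l) X) (James (Smash k X)), IsUnit a) ∧
    (∀ a : PClass (JamesFil n (Smash l X)) (James (Smash k X)), IsUnit a) ∧
    Function.Injective (gpullback (X := Smash k X) (quotMap n l X)) ∧
    ∃ eK : CohenGroup (Fin n × Fin l) k →* HGroup (Power (Fin n × Fin l) X) (Smash k X),
      (∀ I : Fin k → Fin n × Fin l,
        (eK (cgen I) : PClass (Power (Fin n × Fin l) X) (James (Smash k X))) = geoGen X I) ∧
      ∃ eH : HComb n l k →* HGeo k n l X,
        (∀ a : HComb n l k,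
          gpullback (quotMap n l X) (eH a : HGroup (JamesFil n (Smash l X)) (Smash k X)) =
            eK (a : CohenGroup (Fin n × Fin l) k)) ∧
        ∀ a : HComb n l k,
          (∀ p, rename (kill {p}) (a : CohenGroup (Fin n × Fin l) k) = 1) →
            ∀ p, gpullback (insertPt X (kill {p})) (gpullback (quotMap n l X)
              (eH a : HGroup (JamesFil n (Smash l X)) (Smash k X))) = 1 := by
  obtain ⟨D⟩ := hX.nonempty_ndr
  obtain ⟨R⟩ := JamesInverse.nonempty_smash hX hcat hk
  refine ⟨R.isUnit, R.isUnit, gpullback_quotMap_injective D R hl n, realize D R hcat hk _,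
    fun I => congrArg Units.val (realize_cgen D R hcat hk I),
    (realizeH D R hcat hk hl).codRestrict _ (realizeH_mem_HGeo D R hcat hk hl),
    gpullback_realizeH D R hcat hk hl, fun a ha p => ?_⟩
  calc gpullback (insertPt X (kill {p})) (gpullback (quotMap n l X) (realizeH D R hcat hk hl a))
    _ = gpullback (insertPt X (kill {p})) (realize D R hcat hk _ a) := by rw [gpullback_realizeH]
    _ = realize D R hcat hk _ (rename (kill {p}) a) := (realize_rename D R hcat hk _ _).symm
    _ = 1 := by rw [ha p, map_one]
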